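/- Let $\|f\|=\left(\int_{-\pi}^{\pi}|f|^2\,dx\right)^{1/2}$ and $(f,g)=\int_{-\pi}^{\pi}f\,\overline{g}\,dx$ be the $L^2$ norm and inner product on $[-\pi,\pi]$. For an integer $r\ge 0$ let $H^r$ be the space of $2\pi$-periodic square-integrable functions $f$ with $\|f\|_r^2=\sum_{k\in\mathbb Z}(1+k^2)^r|\hat f(k)|^2<\infty$, where $\hat f(k)=\frac1{2\pi}\int_{-\pi}^{\pi}e^{-ikx}f(x)\,dx$. For a positive integer $N$ let $S_N=\operatorname{span}_{\mathbb C}\{e^{ikx}:-N\le k\le N\}$ and let $P_N$ be the $L^2$-orthogonal projection onto $S_N$. Let $u_0\in H^r$ be real-valued with $r\ge 16$. Kawahara equation: $u$ denotes the real-valued, $2\pi$-periodic solution in $C([0,\infty);H^r)$ of $$u_t+uu_x+u_{xxx}=u_{xxxxx}\quad (t\ge 0),\qquad u(0)=u_0 .$$ Semi-discrete scheme: $U:[0,\infty)\to S_N$ is the real-valued solution of $$(U_t+UU_x+U_{xxx}-U_{xxxxx},\varphi)=0\quad\text{for all }\varphi\in S_N,\ t\ge 0,\qquad U(0)=P_Nu_0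 .$$ Leap-frog scheme: let $0<T<\infty$, let $\Delta t>0$ and the integer $M\ge1$ satisfy $M\Delta t=T$, and put $t_m=m\Delta t$. Let $U^0,\dots,U^M\in S_N$ satisfy, for all $\varphi\in S_N$ and $1\le m\le M-1$, $$(U^{m+1}-U^{m-1},\varphi)+2\Delta t\,(U^mU^m_x+U^m_{xxx}-U^m_{xxxxx},\varphi)=0 .$$ Theorem. Let $r\ge 16$, $u_0\in H^r$ real-valued, $0<T<\infty$ and a constant $K$ be given. Then there exist constants $C_1>0$ and $C$, independent of $N$ and $\Delta t$ (and of $M=T/\Delta t$), such that the following holds for all $N$ and $\Delta t$ as above. If $N^5\Delta t\le C_1$, $U^0=U(0)$ and $\|U^1-U(\Delta t)\|\le K\Delta t^2$, then $$\max_{0\le m\le M}\|U^m-U(t_m)\|\le C\,\Delta t^2,$$ and moreover $$\max_{0\le m\le M}\|u(t_m)-U^m\|\le C\left(\frac1{N^{r}}+\Delta t^2\right).$$ -/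

import Mathlib

open Set Filter Topology MeasureTheory

noncomputable section

namespace Kawahara

/-- The `k`-th Fourier coefficient of a real-valued function on `[-π, π]`. -/
def fhat (f : ℝ → ℝ) (k : ℤ) : ℂ :=
  fourierCoeffOn (neg_lt_self Real.pi_pos) (fun x => (f x : ℂ)) k

/-- The Fourier coefficient is `(2π)⁻¹ ∫_{-π}^{π} e^{-ikx} f(x) dx`. -/
theorem fhat_eq (f : ℝ → ℝ) (k : ℤ) :
    fhat f k = ((1 / (2 * Real.pi) : ℝ) : ℂ) *
      ∫ x in (-Real.pi)..Real.pi, Complex.exp (-(Complex.I * k * x)) * (f x : ℂ) := by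
  have hpi : (Real.pi : ℂ) ≠ 0 := by exact_mod_cast Real.pi_ne_zero
  rw [fhat, fourierCoeffOn_eq_integral, Complex.real_smul]
  congr 1
  · congr 2
    ring
  · refine intervalIntegral.integral_congr fun x _ => ?_
    simp only [fourier_coe_apply, smul_eq_mul]
    congr 2
    push_cast
    field_simp
    ring

/-- The norm `‖f‖_r = (∑_k (1 + k²)^r |f̂(k)|²)^{1/2}` of the periodic Sobolev space `H^r`. -/
def sobolevNorm (r : ℕ) (f : ℝ → ℝ) : ℝ :=
  Real.sqrt (∑' k : ℤ, (1 + (k : ℝ) ^ 2) ^ r * ‖fhat f k‖ ^ 2)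

/-- The real-valued function `f` is `2π`-periodic and belongs to `H^r`: it is square integrable over
a period and `∑_k (1 + k²)^r |f̂(k)|² < ∞`. -/
structure MemSobolev (r : ℕ) (f : ℝ → ℝ) : Prop where
  periodic : Function.Periodic f (2 * Real.pi)
  memLp : MemLp f 2 (volume.restrict (Ioc (-Real.pi) Real.pi))
  summable : Summable fun k : ℤ => (1 + (k : ℝ) ^ 2) ^ r * ‖fhat f k‖ ^ 2

/-- The `L²` inner product `(f, g)` on `[-π, π]`. -/
def ip (f g : ℝ → ℂ) : ℂ :=
  ∫ x in (-Real.pi)..Real.pi, f x * (starRingEnd ℂ) (g x)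

/-- The `L²` norm on `[-π, π]`. -/
def l2norm (f : ℝ → ℂ) : ℝ :=
  Real.sqrt (∫ x in (-Real.pi)..Real.pi, ‖f x‖ ^ 2)

/-- The space `S_N` spanned by `x ↦ e^{ikx}`, `-N ≤ k ≤ N`. -/
def trigSpace (N : ℕ) : Submodule ℂ (ℝ → ℂ) :=
  Submodule.span ℂ
    {e | ∃ k : ℤ, -(N : ℤ) ≤ k ∧ k ≤ (N : ℤ) ∧ e = fun x : ℝ => Complex.exp (Complex.I * k * x)}

/-- `p` is the `L²`-orthogonal projection of `f` onto `S_N`. -/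
def IsProjection (N : ℕ) (f p : ℝ → ℂ) : Prop :=
  p ∈ trigSpace N ∧ ∀ φ ∈ trigSpace N, ip (fun x => f x - p x) φ = 0

/-- The spatial operator `v v_x + v_xxx - v_xxxxx`. -/
def spatialOp (v : ℝ → ℂ) (x : ℝ) : ℂ :=
  v x * deriv v x + iteratedDeriv 3 v x - iteratedDeriv 5 v x

/-- `u` (written `u t x`, for times `t ≥ 0`) is the real-valued `2π`-periodic solution of
`u_t + u u_x + u_xxx = u_xxxxx`, `u(0) = u₀`, in the class `C([0, ∞); H^r)`. Elements of `H^r` are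
represented by their `C⁵` representatives, and the equation holds pointwise (at `t = 0` the time
derivative is one-sided). -/
structure IsSolution (r : ℕ) (u₀ : ℝ → ℝ) (u : ℝ → ℝ → ℝ) : Prop where
  memSobolev : ∀ t, 0 ≤ t → MemSobolev r (u t)
  contDiff : ∀ t, 0 ≤ t → ContDiff ℝ 5 (u t)
  continuous : ∀ t, 0 ≤ t →
    Tendsto (fun s => sobolevNorm r (fun x => u s x - u t x)) (𝓝[Ici 0] t) (𝓝 0)
  equation : ∀ t, 0 ≤ t → ∀ x, HasDerivWithinAt (fun s => u s x)
    (-(u t x * deriv (u t) x) - iteratedDeriv 3 (u t) x + iteratedDeriv 5 (u t) x) (Ici 0) t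
  initial : u 0 =ᵐ[volume] u₀

/-- `U` is the solution of the semi-discrete Fourier-Galerkin problem: for `t ≥ 0`, `U t` is a
real-valued element of `S_N`, `(U_t + U U_x + U_xxx - U_xxxxx, φ) = 0` for all `φ ∈ S_N`, and
`U(0) = P_N u₀`. -/
structure IsSemiDiscrete (N : ℕ) (u₀ : ℝ → ℝ) (U : ℝ → ℝ → ℂ) : Prop where
  mem : ∀ t, 0 ≤ t → U t ∈ trigSpace N
  real : ∀ t, 0 ≤ t → ∀ x, (U t x).im = 0
  equation : ∀ t, 0 ≤ t → ∃ Ut : ℝ → ℂ,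
    (∀ x, HasDerivWithinAt (fun s => U s x) (Ut x) (Ici 0) t) ∧
    ∀ φ ∈ trigSpace N, ip (fun x => Ut x + spatialOp (U t) x) φ = 0
  initial : IsProjection N (fun x => (u₀ x : ℂ)) (U 0)

/-- `W 0, …, W M` are elements of `S_N` that satisfy the leap-frog scheme with time step `dt`:
`(W^{m+1} - W^{m-1}, φ) + 2 dt (W^m W^m_x + W^m_xxx - W^m_xxxxx, φ) = 0` for all `φ ∈ S_N`. -/
structure IsLeapFrog (N : ℕ) (dt : ℝ) (M : ℕ) (W : ℕ → ℝ → ℂ) : Prop where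
  mem : ∀ m, m ≤ M → W m ∈ trigSpace N
  step : ∀ m, 1 ≤ m → m < M → ∀ φ ∈ trigSpace N,
    ip (fun x => W (m + 1) x - W (m - 1) x) φ + 2 * (dt : ℂ) * ip (spatialOp (W m)) φ = 0

end Kawahara

end

/-! Put ω(k) = k³ + k⁵. In Fourier coefficients the semi-discrete scheme is the finite system c_k' =
iω(k)c_k − (ik/2)(c∗c)_k for |k| ≤ N. The error splits into a time error and a space error, and
everything rests on bounds for c that do not depend on N.

Uniform bounds (`exists_galerkin_bound`). The Galerkin flow conserves the L² norm and the
Hamiltonian, which gives an H² bound for all times and hence a bound on the ℓ¹ norm of k c_k. The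
nonlinearity enters the H^r energy balance only through a commutator, so Gronwall's inequality is
linear and the H^r norm stays bounded on [0, T]. Since r ≥ 16, the coefficients are summable against
(1 + |k|)^15. Each time derivative costs five powers of this weight, so three time derivatives are
bounded in ℓ¹.

Time error (`leapfrog_stability`, `exists_leapfrog_bound`). The leap-frog error solves a linear
leap-frog recursion, forced by the O(dt³) defect of the symmetric difference quotient and by a
quadratic term. The linear operator is skew-adjoint up to a bounded remainder. Testing with e_{m+2}
+ e_m therefore makes a modified energy grow by a factor 1 + O(dt) per step; N⁵dt ≤ C₁ makes this
energy coercive. The quadratic term is treated as linear as long as the error is at most N⁻², and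
the bound so obtained reproduces this smallness.

Space error (`exists_galerkin_error`). For u minus its Galerkin approximation, the direct energy
argument loses one power of N, through the interaction ik(low ∗ high) in which the derivative is not
compensated. A normal form transformation removes that interaction: the phase ω(m+j) − ω(m) − ω(j) =
mj(m+j)(3 + 5(m² + mj + j²)) does not vanish for nonzero m, j, m+j. Adding a bilinear correction
that is smaller by N⁻³ leaves only terms of size N⁻ʳ, so the full rate is obtained.

Finally, Parseval's identity and differentiation under the integral translate between functions and
coefficient sequences. A uniqueness statement, `KawaharaFlow.unique`, allows the constant to be
chosen before the solution u. -/

open Set Filter Topology MeasureTheory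

noncomputable section

namespace Kawahara

/-! ### Finite frequency sets, ℓ² norms and Toeplitz kernels -/

/-- The frequencies `-N, …, N`. -/
def box (N : ℕ) : Finset ℤ := Finset.Icc (-(N : ℤ)) N

theorem mem_box {N : ℕ} {k : ℤ} : k ∈ box N ↔ |k| ≤ N := by
  rw [box, Finset.mem_Icc, abs_le]

theorem neg_mem_box {N : ℕ} {k : ℤ} : -k ∈ box N ↔ k ∈ box N := by
  rw [mem_box, mem_box, abs_neg]

theorem abs_cast_le_of_mem_box {N : ℕ} {k : ℤ} (h : k ∈ box N) : |(k : ℝ)| ≤ N := by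
  exact_mod_cast mem_box.1 h

theorem card_box (N : ℕ) : (box N).card = 2 * N + 1 := by
  rw [box, Int.card_Icc]; omega

/-- All finite partial sums of `a` are at most `A`. -/
def SumsLE (a : ℤ → ℝ) (A : ℝ) : Prop := ∀ s : Finset ℤ, ∑ n ∈ s, a n ≤ A

theorem SumsLE.nonneg {a : ℤ → ℝ} {A : ℝ} (h : SumsLE a A) : 0 ≤ A := by
  simpa using h ∅

theorem SumsLE.mono {a b : ℤ → ℝ} {A B : ℝ} (h : SumsLE a A) (hab : ∀ n, b n ≤ a n) (hAB : A ≤ B) :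
    SumsLE b B :=
  fun s => (Finset.sum_le_sum fun n _ => hab n).trans ((h s).trans hAB)

theorem SumsLE.add {a b : ℤ → ℝ} {A B : ℝ} (h : SumsLE a A) (h' : SumsLE b B) :
    SumsLE (fun n => a n + b n) (A + B) := fun s => by
  rw [Finset.sum_add_distrib]; exact add_le_add (h s) (h' s)

theorem SumsLE.const_mul {a : ℤ → ℝ} {A x : ℝ} (h : SumsLE a A) (hx : 0 ≤ x) :
    SumsLE (fun n => x * a n) (x * A) := fun s => by
  rw [← Finset.mul_sum]; exact mul_le_mul_of_nonneg_left (h s) hx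

theorem SumsLE.comp {a : ℤ → ℝ} {A : ℝ} (h : SumsLE a A) {e : ℤ → ℤ} (he : Function.Injective e) :
    SumsLE (fun n => a (e n)) A := fun s => by
  rw [← Finset.sum_image (f := a) (fun x _ y _ hxy => he hxy)]; exact h _

theorem SumsLE.le {a : ℤ → ℝ} {A : ℝ} (h : SumsLE a A) (n : ℤ) : a n ≤ A := by
  simpa using h {n}

theorem SumsLE.summable {a : ℤ → ℝ} {A : ℝ} (h : SumsLE a A) (ha : ∀ n, 0 ≤ a n) : Summable a :=
  summable_of_sum_le ha h

theorem SumsLE.of_box {a : ℤ → ℝ} {A : ℝ} {N : ℕ} (ha : ∀ n, 0 ≤ a n) (hN : ∀ n, n ∉ box N → a n = 0)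
    (h : ∑ n ∈ box N, a n ≤ A) : SumsLE a A := fun s => by
  refine le_trans ?_ h
  rw [← Finset.sum_filter_add_sum_filter_not s (fun n => n ∈ box N)]
  have : ∑ n ∈ s with n ∉ box N, a n = 0 :=
    Finset.sum_eq_zero fun n hn => hN n (Finset.mem_filter.1 hn).2
  rw [this, add_zero]
  exact Finset.sum_le_sum_of_subset_of_nonneg (fun n hn => (Finset.mem_filter.1 hn).2)
    fun n _ _ => ha n

/-- Restriction of a sequence to a finite set of frequencies, as a Euclidean vector. -/
def vec (F : Finset ℤ) (c : ℤ → ℂ) : EuclideanSpace ℂ F := WithLp.toLp 2 fun k => c k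

/-- The `ℓ²` norm of a sequence over a finite set of frequencies. -/
def l2 (F : Finset ℤ) (c : ℤ → ℂ) : ℝ := ‖vec F c‖

theorem vec_add (F : Finset ℤ) (c d : ℤ → ℂ) : vec F (fun k => c k + d k) = vec F c + vec F d := rfl
theorem vec_sub (F : Finset ℤ) (c d : ℤ → ℂ) : vec F (fun k => c k - d k) = vec F c - vec F d := rfl
theorem vec_smul (F : Finset ℤ) (x : ℂ) (c : ℤ → ℂ) : vec F (fun k => x * c k) = x • vec F c := rfl

theorem vec_congr {F : Finset ℤ} {c d : ℤ → ℂ} (h : ∀ k ∈ F, c k = d k) : vec F c = vec F d := by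
  ext k; exact h k k.2

theorem l2_congr {F : Finset ℤ} {c d : ℤ → ℂ} (h : ∀ k ∈ F, c k = d k) : l2 F c = l2 F d := by
  rw [l2, l2, vec_congr h]

theorem l2_nonneg (F : Finset ℤ) (c : ℤ → ℂ) : 0 ≤ l2 F c := norm_nonneg _

theorem l2_sq (F : Finset ℤ) (c : ℤ → ℂ) : l2 F c ^ 2 = ∑ k ∈ F, ‖c k‖ ^ 2 := by
  rw [l2, EuclideanSpace.norm_sq_eq, ← Finset.sum_coe_sort F]; rfl

theorem l2_eq_sqrt (F : Finset ℤ) (c : ℤ → ℂ) : l2 F c = √(∑ k ∈ F, ‖c k‖ ^ 2) := by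
  rw [← l2_sq, Real.sqrt_sq (l2_nonneg _ _)]

theorem inner_vec (F : Finset ℤ) (c d : ℤ → ℂ) :
    inner ℂ (vec F c) (vec F d) = ∑ k ∈ F, d k * (starRingEnd ℂ) (c k) := by
  rw [PiLp.inner_apply, ← Finset.sum_coe_sort F]; rfl

theorem l2_add_le (F : Finset ℤ) (c d : ℤ → ℂ) : l2 F (fun k => c k + d k) ≤ l2 F c + l2 F d := by
  rw [l2, vec_add]; exact norm_add_le _ _

theorem l2_sub_le (F : Finset ℤ) (c d : ℤ → ℂ) : l2 F (fun k => c k - d k) ≤ l2 F c + l2 F d := by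
  rw [l2, vec_sub]; exact norm_sub_le _ _

theorem l2_smul (F : Finset ℤ) (x : ℂ) (c : ℤ → ℂ) : l2 F (fun k => x * c k) = ‖x‖ * l2 F c := by
  rw [l2, vec_smul, norm_smul, l2]

theorem l2_le_of_sq {F : Finset ℤ} {c : ℤ → ℂ} {A : ℝ} (hA : 0 ≤ A)
    (h : ∑ k ∈ F, ‖c k‖ ^ 2 ≤ A ^ 2) : l2 F c ≤ A := by
  rw [← l2_sq] at h; exact (sq_le_sq₀ (l2_nonneg _ _) hA).1 h

theorem l2_le_of_le {F G : Finset ℤ} (hFG : F ⊆ G) {c d : ℤ → ℂ} {x : ℝ} (hx : 0 ≤ x)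
    (h : ∀ k ∈ F, ‖c k‖ ≤ x * ‖d k‖) : l2 F c ≤ x * l2 G d := by
  refine l2_le_of_sq (mul_nonneg hx (l2_nonneg _ _)) ?_
  rw [mul_pow, l2_sq, Finset.mul_sum]
  refine (Finset.sum_le_sum fun k hk => pow_le_pow_left₀ (norm_nonneg _) (h k hk) 2).trans ?_
  simp_rw [mul_pow]
  exact Finset.sum_le_sum_of_subset_of_nonneg hFG fun k _ _ => by positivity

theorem l2_le_sum (F : Finset ℤ) (c : ℤ → ℂ) : l2 F c ≤ ∑ k ∈ F, ‖c k‖ := by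
  refine l2_le_of_sq (Finset.sum_nonneg fun _ _ => norm_nonneg _) ?_
  exact Finset.sum_sq_le_sq_sum_of_nonneg fun _ _ => norm_nonneg _

theorem sum_le_sqrt_mul_l2 (F : Finset ℤ) (c : ℤ → ℂ) : ∑ k ∈ F, ‖c k‖ ≤ √F.card * l2 F c := by
  have := Real.sum_mul_le_sqrt_mul_sqrt F (fun _ => 1) (fun k => ‖c k‖)
  simpa [l2_eq_sqrt] using this

theorem norm_sum_mul_conj_le (F : Finset ℤ) (c d : ℤ → ℂ) :
    ‖∑ k ∈ F, d k * (starRingEnd ℂ) (c k)‖ ≤ l2 F c * l2 F d := by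
  rw [← inner_vec]; exact norm_inner_le_norm _ _

/-- The Schur test for Toeplitz matrices. -/
theorem sum_toeplitz_le {a f g : ℤ → ℝ} {A : ℝ} (ha : ∀ n, 0 ≤ a n) (hA : SumsLE a A)
    (F G : Finset ℤ) :
    ∑ k ∈ F, ∑ j ∈ G, a (k - j) * (f j * g k) ≤
      A * (√(∑ j ∈ G, f j ^ 2) * √(∑ k ∈ F, g k ^ 2)) := by
  -- Cauchy–Schwarz on pairs with the kernel split as √a · √a; each factor then sums `a` over one
  -- index only.
  have h := Real.sum_mul_le_sqrt_mul_sqrt (F ×ˢ G) (fun p => √(a (p.1 - p.2)) * f p.2)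
    (fun p => √(a (p.1 - p.2)) * g p.1)
  rw [← Finset.sum_product']
  have e : ∀ p : ℤ × ℤ, √(a (p.1 - p.2)) * f p.2 * (√(a (p.1 - p.2)) * g p.1) =
      a (p.1 - p.2) * (f p.2 * g p.1) := fun p => by
    calc _ = (√(a (p.1 - p.2)) * √(a (p.1 - p.2))) * (f p.2 * g p.1) := by ring
      _ = _ := by rw [Real.mul_self_sqrt (ha _)]
  simp_rw [e] at h
  refine h.trans ?_
  have h1 : ∑ p ∈ F ×ˢ G, (√(a (p.1 - p.2)) * f p.2) ^ 2 ≤ A * ∑ j ∈ G, f j ^ 2 := by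
    simp_rw [mul_pow, Real.sq_sqrt (ha _)]
    rw [Finset.sum_product_right, Finset.mul_sum]
    refine Finset.sum_le_sum fun j _ => ?_
    dsimp only
    rw [← Finset.sum_mul]
    exact mul_le_mul_of_nonneg_right (hA.comp (e := fun k => k - j)
      (fun x y h => by simpa using h) F) (sq_nonneg _)
  have h2 : ∑ p ∈ F ×ˢ G, (√(a (p.1 - p.2)) * g p.1) ^ 2 ≤ A * ∑ k ∈ F, g k ^ 2 := by
    simp_rw [mul_pow, Real.sq_sqrt (ha _)]
    rw [Finset.sum_product, Finset.mul_sum]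
    refine Finset.sum_le_sum fun k _ => ?_
    dsimp only
    rw [← Finset.sum_mul]
    exact mul_le_mul_of_nonneg_right (hA.comp (e := fun j => k - j)
      (fun x y h => by simpa using h) G) (sq_nonneg _)
  calc _ ≤ √(A * ∑ j ∈ G, f j ^ 2) * √(A * ∑ k ∈ F, g k ^ 2) := by gcongr
    _ = (√A * √A) * (√(∑ j ∈ G, f j ^ 2) * √(∑ k ∈ F, g k ^ 2)) := by
      rw [Real.sqrt_mul hA.nonneg, Real.sqrt_mul hA.nonneg]; ring
    _ = _ := by rw [Real.mul_self_sqrt hA.nonneg]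

theorem norm_form_le {a : ℤ → ℝ} {A : ℝ} (ha : ∀ n, 0 ≤ a n) (hA : SumsLE a A) {F G : Finset ℤ}
    {m : ℤ → ℤ → ℂ} (hm : ∀ k ∈ F, ∀ j ∈ G, ‖m k j‖ ≤ a (k - j)) (v w : ℤ → ℂ) :
    ‖∑ k ∈ F, ∑ j ∈ G, m k j * v j * (starRingEnd ℂ) (w k)‖ ≤ A * (l2 G v * l2 F w) := by
  rw [l2_eq_sqrt, l2_eq_sqrt]
  refine le_trans ?_ (sum_toeplitz_le (f := fun j => ‖v j‖) (g := fun k => ‖w k‖) ha hA F G)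
  refine (norm_sum_le _ _).trans (Finset.sum_le_sum fun k hk => ?_)
  refine (norm_sum_le _ _).trans (Finset.sum_le_sum fun j hj => ?_)
  rw [norm_mul, norm_mul, RCLike.norm_conj, mul_assoc]
  exact mul_le_mul_of_nonneg_right (hm k hk j hj) (by positivity)

/-- Young's inequality for kernels dominated by a Toeplitz matrix. -/
theorem l2_kernel_le {a : ℤ → ℝ} {A : ℝ} (ha : ∀ n, 0 ≤ a n) (hA : SumsLE a A) {F G : Finset ℤ}
    {m : ℤ → ℤ → ℂ} (hm : ∀ k ∈ F, ∀ j ∈ G, ‖m k j‖ ≤ a (k - j)) (v : ℤ → ℂ) :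
    l2 F (fun k => ∑ j ∈ G, m k j * v j) ≤ A * l2 G v := by
  -- Duality: the form is tested against its own output, which gives ‖out‖² ≤ A‖v‖‖out‖.
  have h := norm_form_le ha hA hm v (fun k => ∑ j ∈ G, m k j * v j)
  have e : ∑ k ∈ F, ∑ j ∈ G, m k j * v j * (starRingEnd ℂ) (∑ j ∈ G, m k j * v j) =
      ((l2 F (fun k => ∑ j ∈ G, m k j * v j) ^ 2 : ℝ) : ℂ) := by
    rw [l2_sq]; push_cast
    refine Finset.sum_congr rfl fun k _ => ?_
    rw [← Finset.sum_mul, Complex.mul_conj']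
  rw [e, Complex.norm_real, Real.norm_of_nonneg (sq_nonneg _)] at h
  rcases (l2_nonneg F (fun k => ∑ j ∈ G, m k j * v j)).eq_or_lt with h0 | h0
  · rw [← h0]; exact mul_nonneg hA.nonneg (l2_nonneg _ _)
  · refine le_of_mul_le_mul_right ?_ h0
    nlinarith

/-! ### Gronwall's inequality and the symmetric difference quotient -/

/-- Gronwall's inequality for `f' ≤ K f + ε`. -/
theorem gronwall {f f' : ℝ → ℝ} {T K ε : ℝ} (hK : 0 ≤ K) (hε : 0 ≤ ε)
    (hf : ContinuousOn f (Icc 0 T)) (hf' : ∀ t ∈ Ioo 0 T, HasDerivAt f (f' t) t)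
    (h : ∀ t ∈ Ioo 0 T, f' t ≤ K * f t + ε) {t : ℝ} (ht : t ∈ Icc 0 T) :
    f t ≤ Real.exp (K * t) * (f 0 + ε * t) := by
  -- The derivative of f(s)e^{−Ks} − εs is at most ε(e^{−Ks} − 1) ≤ 0.
  have hd : ∀ s ∈ Ioo 0 T, HasDerivAt (fun s => f s * Real.exp (-(K * s)) - ε * s)
      (f' s * Real.exp (-(K * s)) + f s * (Real.exp (-(K * s)) * -(K * 1)) - ε * 1) s := fun s hs =>
    ((hf' s hs).mul ((((hasDerivAt_id s).const_mul K).neg).exp)).sub ((hasDerivAt_id s).const_mul ε)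
  have hanti : AntitoneOn (fun s => f s * Real.exp (-(K * s)) - ε * s) (Icc 0 T) := by
    refine antitoneOn_of_deriv_nonpos (convex_Icc 0 T) ?_ ?_ ?_
    · exact (hf.mul (by fun_prop)).sub (by fun_prop)
    · rw [interior_Icc]; exact fun s hs => (hd s hs).differentiableAt.differentiableWithinAt
    · rw [interior_Icc]; intro s hs
      rw [(hd s hs).deriv]
      have h1 := h s hs
      have h2 : Real.exp (-(K * s)) ≤ 1 := Real.exp_le_one_iff.2 (by nlinarith [mul_nonneg hK hs.1.le])
      have h3 := Real.exp_pos (-(K * s))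
      nlinarith
  have := hanti (left_mem_Icc.2 (ht.1.trans ht.2)) ht ht.1
  simp only [mul_zero, neg_zero, Real.exp_zero, mul_one, sub_zero] at this
  have h4 : Real.exp (K * t) * Real.exp (-(K * t)) = 1 := by rw [← Real.exp_add]; simp
  calc f t = Real.exp (K * t) * (f t * Real.exp (-(K * t))) := by linear_combination (-f t) * h4
    _ ≤ _ := by gcongr; linarith

/-- The symmetric difference quotient is of second order. -/
theorem norm_symm_diff_le {E : Type*} [NormedAddCommGroup E] [NormedSpace ℝ E]
    {c c₁ c₂ c₃ : ℝ → E} {T C : ℝ}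
    (h0 : ∀ t ∈ Ici (0:ℝ), HasDerivWithinAt c (c₁ t) (Ici 0) t)
    (h1 : ∀ t ∈ Ici (0:ℝ), HasDerivWithinAt c₁ (c₂ t) (Ici 0) t)
    (h2 : ∀ t ∈ Ici (0:ℝ), HasDerivWithinAt c₂ (c₃ t) (Ici 0) t)
    (hC : ∀ t ∈ Icc 0 T, ‖c₃ t‖ ≤ C) {t h : ℝ} (hh : 0 < h) (hth : 0 ≤ t - h) (hT : t + h ≤ T) :
    ‖c (t + h) - c (t - h) - (2 * h) • c₁ t‖ ≤ C * h ^ 3 := by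
  have ht : 0 < t := by linarith
  have hC0 : 0 ≤ C := (norm_nonneg _).trans (hC t ⟨ht.le, by linarith⟩)
  have key : ∀ {f f' : ℝ → E}, (∀ t ∈ Ici (0:ℝ), HasDerivWithinAt f (f' t) (Ici 0) t) →
      ∀ s ∈ Ico 0 h, HasDerivAt (fun s => f (t + s)) (f' (t + s)) s ∧
        HasDerivAt (fun s => f (t - s)) (-f' (t - s)) s := by
    intro f f' hf s hs
    have a1 : 0 < t + s := by linarith [hs.1]
    have a2 : 0 < t - s := by linarith [hs.2]
    have b1 := (hf _ a1.le).hasDerivAt (Ici_mem_nhds a1)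
    have b2 := (hf _ a2.le).hasDerivAt (Ici_mem_nhds a2)
    exact ⟨b1.comp_const_add t s, b2.comp_const_sub t s⟩
  have kc : ∀ {f f' : ℝ → E}, (∀ t ∈ Ici (0:ℝ), HasDerivWithinAt f (f' t) (Ici 0) t) →
      ContinuousOn (fun s => f (t + s)) (Icc 0 h) ∧ ContinuousOn (fun s => f (t - s)) (Icc 0 h) := by
    intro f f' hf
    have hc : ContinuousOn f (Ici 0) := fun x hx => (hf x hx).continuousWithinAt
    refine ⟨hc.comp (by fun_prop) fun s hs => ?_, hc.comp (by fun_prop) fun s hs => ?_⟩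
    · simp only [mem_Ici]; linarith [hs.1]
    · simp only [mem_Ici]; linarith [hs.2]
  -- The half-width s is the variable. Three successive integrations from s = 0 give the bounds 2Cs,
  -- Cs² and Cs³ for the differences built on c₂, c₁ and c; the symmetry in ±s cancels the even
  -- Taylor terms.
  have s2 : ∀ s ∈ Icc 0 h, ‖c₂ (t + s) - c₂ (t - s)‖ ≤ 2 * C * s := by
    intro s hs
    refine image_norm_le_of_norm_deriv_right_le_deriv_boundary
      (f := fun s => c₂ (t + s) - c₂ (t - s)) (f' := fun s => c₃ (t + s) - -c₃ (t - s))
      (B := fun s => 2 * C * s) (B' := fun _ => 2 * C) ((kc h2).1.sub (kc h2).2)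
      (fun s hs => ((key h2 s hs).1.sub (key h2 s hs).2).hasDerivWithinAt) (by simp)
      (fun x => by simpa using (hasDerivAt_id x).const_mul (2 * C)) (fun s hs => ?_) hs
    have e1 := hC (t + s) ⟨by linarith [hs.1], by linarith [hs.2]⟩
    have e2 := hC (t - s) ⟨by linarith [hs.2], by linarith [hs.1]⟩
    refine (norm_sub_le _ _).trans ?_
    rw [norm_neg]; linarith
  have s1 : ∀ s ∈ Icc 0 h, ‖c₁ (t + s) + c₁ (t - s) - (2:ℝ) • c₁ t‖ ≤ C * s ^ 2 := by
    intro s hs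
    refine image_norm_le_of_norm_deriv_right_le_deriv_boundary
      (f := fun s => c₁ (t + s) + c₁ (t - s) - (2:ℝ) • c₁ t) (f' := fun s => c₂ (t + s) + -c₂ (t - s))
      (B := fun s => C * s ^ 2) (B' := fun s => C * (2 * s)) (((kc h1).1.add (kc h1).2).sub
        continuousOn_const)
      (fun s hs => (((key h1 s hs).1.add (key h1 s hs).2).sub_const _).hasDerivWithinAt)
      (by simp [two_smul])
      (fun x => by simpa using (hasDerivAt_pow 2 x).const_mul C) (fun s hs => ?_) hs
    have := s2 s ⟨hs.1, hs.2.le⟩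
    rw [← sub_eq_add_neg]; linarith
  have := image_norm_le_of_norm_deriv_right_le_deriv_boundary
      (f := fun s => c (t + s) - c (t - s) - (2 * s) • c₁ t)
      (f' := fun s => c₁ (t + s) - -c₁ (t - s) - (2:ℝ) • c₁ t) (a := 0) (b := h)
      (B := fun s => C * s ^ 3) (B' := fun s => C * (3 * s ^ 2)) (((kc h0).1.sub (kc h0).2).sub
        (by fun_prop))
      (fun s hs => (((key h0 s hs).1.sub (key h0 s hs).2).sub (by
        simpa using ((hasDerivAt_id s).const_mul 2).smul_const (c₁ t))).hasDerivWithinAt)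
      (by simp)
      (fun x => by simpa using (hasDerivAt_pow 3 x).const_mul C) (fun s hs => by
        have := s1 s ⟨hs.1, hs.2.le⟩
        rw [sub_neg_eq_add]
        nlinarith [mul_nonneg hC0 (sq_nonneg s)]) (right_mem_Icc.2 hh.le)
  exact this

/-! ### Stability of leap-frog recursions -/

/-- One step of the energy argument, with x, y, z the norms of e_{m+2}, e_{m+1}, e_m and S, S'
consecutive modified energies. With κ = 2(b + c + 1) the hypotheses give (1 − κdt)S' ≤ (1 + κdt)S +
dt·g², and κdt ≤ 1/2 permits division by 1 − κdt. -/
theorem leapfrog_increment {x y z S S' I J b c g dt : ℝ} (hdt : 0 < dt) (hc : 0 ≤ c) (hb : 0 ≤ b)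
    (hκ : 2 * (b + c + 1) * dt ≤ 1 / 2)
    (hI : I ≤ dt * (b * y + g) * (x + z)) (hJ : -(c * (y * z)) ≤ J) (hS : S' - S = I - 2 * dt * J)
    (E1 : y ^ 2 + z ^ 2 ≤ 2 * S) (E2 : x ^ 2 + y ^ 2 ≤ 2 * S') :
    S' ≤ (1 + 4 * (2 * (b + c + 1) * dt)) * S + 2 * dt * g ^ 2 := by
  have r1 : b * (y * (x + z)) ≤ b * (x ^ 2 + y ^ 2 + (y ^ 2 + z ^ 2)) :=
    mul_le_mul_of_nonneg_left (by nlinarith [sq_nonneg (x - y), sq_nonneg (y - z)]) hb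
  have r2 : c * (2 * (y * z)) ≤ c * (x ^ 2 + y ^ 2 + (y ^ 2 + z ^ 2)) :=
    mul_le_mul_of_nonneg_left (by nlinarith [sq_nonneg (y - z)]) hc
  have r3 : g * (x + z) ≤ (x ^ 2 + y ^ 2 + (y ^ 2 + z ^ 2)) + g ^ 2 := by
    nlinarith [sq_nonneg (g - (x + z)), sq_nonneg (x - z), sq_nonneg g, sq_nonneg y]
  have r4 := mul_le_mul_of_nonneg_left (add_le_add E2 E1) (by positivity : 0 ≤ b + c + 1)
  have q1 : (b * y + g) * (x + z) + 2 * (c * (y * z)) ≤ 2 * (b + c + 1) * (S' + S) + g ^ 2 := by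
    linarith
  have q2 := mul_le_mul_of_nonneg_left q1 hdt.le
  have q3 := mul_le_mul_of_nonneg_left hJ hdt.le
  have hS0 : 0 ≤ S := by linarith [sq_nonneg y, sq_nonneg z]
  have hκ0 : 0 ≤ 2 * (b + c + 1) * dt := by positivity
  generalize 2 * (b + c + 1) = κ at *
  -- With X = κdt the claim is 1 + X ≤ 1 + 3X − 4X², that is X ≤ 1/2.
  have t1 : (1 + κ * dt) ≤ (1 - κ * dt) * (1 + 4 * (κ * dt)) := by nlinarith
  have t2 := mul_le_mul_of_nonneg_right t1 hS0
  have t3 : 0 ≤ dt * g ^ 2 := by positivity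
  have t4 := mul_le_mul_of_nonneg_right hκ t3
  refine le_of_mul_le_mul_left (a := 1 - κ * dt) ?_ (by linarith)
  linarith

/-- Stability and convergence of the leap-frog scheme for almost skew-adjoint problems. -/
theorem leapfrog_stability {E : Type*} [NormedAddCommGroup E] [InnerProductSpace ℂ E]
    {e p f : ℕ → E} {M : ℕ} {dt T c b g δ : ℝ} (hdt : 0 < dt) (hc : 0 ≤ c) (hb : 0 ≤ b)
    (hMT : M * dt ≤ T) (hκ : 2 * (b + c + 1) * dt ≤ 1 / 2) (hδ0 : 0 ≤ δ) (he0 : e 0 = 0)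
    (hstep : ∀ m, m + 1 < M → e (m + 2) - e m = f (m + 1) - ((2 * dt : ℝ) : ℂ) • p (m + 1))
    (hskew : ∀ m, m + 1 < M →
      |RCLike.re (inner ℂ (p (m + 1)) (e m)) + RCLike.re (inner ℂ (p m) (e (m + 1)))| ≤
        c * (‖e (m + 1)‖ * ‖e m‖))
    (hp : ∀ m, m < M → dt * ‖p m‖ ≤ 1 / 4 * ‖e m‖)
    (hf : ∀ m, m + 1 < M → ‖e (m + 1)‖ ≤ δ → ‖f (m + 1)‖ ≤ dt * (b * ‖e (m + 1)‖ + g))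
    (hδ : 2 * Real.exp (8 * (b + c + 1) * T) * (‖e 1‖ ^ 2 + 2 * T * g ^ 2) ≤ δ ^ 2) :
    ∀ m, m ≤ M → ‖e m‖ ^ 2 ≤ 2 * Real.exp (8 * (b + c + 1) * T) * (‖e 1‖ ^ 2 + 2 * T * g ^ 2) := by
  set κ := 2 * (b + c + 1) with hκdef
  have hκ0 : 0 < κ := by positivity
  have hT0 : 0 ≤ T := le_trans (by positivity) hMT
  -- The modified energy: the cross term makes its increment contain only the symmetrised products
  -- of p_{m+1} with e_m and of p_m with e_{m+1}, which almost cancel by skewness.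
  set S : ℕ → ℝ := fun m => ‖e (m + 1)‖ ^ 2 + ‖e m‖ ^ 2 + 2 * dt * RCLike.re (inner ℂ (p m) (e (m + 1)))
    with hS
  -- Coercivity: `hp` makes the cross term at most half of the sum of squares.
  have hSE : ∀ m, m < M → ‖e (m + 1)‖ ^ 2 + ‖e m‖ ^ 2 ≤ 2 * S m := by
    intro m hm
    have h1 : |RCLike.re (inner ℂ (p m) (e (m + 1)))| ≤ ‖p m‖ * ‖e (m + 1)‖ :=
      (RCLike.abs_re_le_norm _).trans (norm_inner_le_norm _ _)
    have h2 := mul_le_mul_of_nonneg_right (hp m hm) (norm_nonneg (e (m + 1)))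
    have h3 := mul_le_mul_of_nonneg_left (neg_le_of_abs_le h1) hdt.le
    simp only [hS]
    nlinarith [sq_nonneg (‖e (m + 1)‖ - ‖e m‖), sq_nonneg (‖e (m + 1)‖), sq_nonneg (‖e m‖)]
  have hS0 : 0 < M → S 0 = ‖e 1‖ ^ 2 := by
    intro hM
    have h1 := hp 0 hM
    rw [he0, norm_zero, mul_zero] at h1
    have h2 : ‖p 0‖ = 0 := le_antisymm (by
      by_contra h; push Not at h; nlinarith) (norm_nonneg _)
    simp [hS, he0, norm_eq_zero.1 h2]
  have hrec : ∀ m, m + 1 < M → ‖e (m + 1)‖ ≤ δ → S (m + 1) ≤ (1 + 4 * (κ * dt)) * S m + 2 * dt * g ^ 2 := by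
    intro m hm hδm
    have E1 := hSE m (by omega)
    have E2 := hSE (m + 1) hm
    have hfm := hf m hm hδm
    have hsk := hskew m hm
    have hid : S (m + 1) - S m = RCLike.re (inner ℂ (f (m + 1)) (e (m + 2) + e m)) -
        2 * dt * (RCLike.re (inner ℂ (p (m + 1)) (e m)) + RCLike.re (inner ℂ (p m) (e (m + 1)))) := by
      have h1 : RCLike.re (inner ℂ (e (m + 2) - e m) (e (m + 2) + e m)) =
          ‖e (m + 2)‖ ^ 2 - ‖e m‖ ^ 2 := by
        rw [inner_sub_left, inner_add_right, inner_add_right, map_sub, map_add, map_add,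
          inner_self_eq_norm_sq, inner_self_eq_norm_sq, inner_re_symm (e m)]
        ring
      rw [hstep m hm, inner_sub_left, inner_smul_left, map_sub, Complex.conj_ofReal] at h1
      have h2 : RCLike.re (((2 * dt : ℝ) : ℂ) * inner ℂ (p (m + 1)) (e (m + 2) + e m)) =
          2 * dt * RCLike.re (inner ℂ (p (m + 1)) (e (m + 2) + e m)) := by
        exact Complex.re_ofReal_mul _ _
      have h3 : RCLike.re (inner ℂ (p (m + 1)) (e (m + 2) + e m)) =
        RCLike.re (inner ℂ (p (m + 1)) (e (m + 2))) + RCLike.re (inner ℂ (p (m + 1)) (e m)) := by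
        rw [inner_add_right, map_add]
      rw [h2, h3] at h1
      simp only [hS]
      linear_combination -h1
    have hb1 : RCLike.re (inner ℂ (f (m + 1)) (e (m + 2) + e m)) ≤
        dt * (b * ‖e (m + 1)‖ + g) * (‖e (m + 2)‖ + ‖e m‖) := by
      refine (RCLike.re_le_norm _).trans ((norm_inner_le_norm _ _).trans ?_)
      exact mul_le_mul hfm (norm_add_le _ _) (norm_nonneg _) ((norm_nonneg _).trans hfm)
    have hb2 := neg_le_of_abs_le hsk
    exact leapfrog_increment hdt hc hb hκ hb1 hb2 hid E1 E2
  set D := ‖e 1‖ ^ 2 + 2 * T * g ^ 2 with hD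
  have hD0 : 0 ≤ D := by positivity
  have hmT : ∀ m, m ≤ M → (m : ℝ) * dt ≤ T := fun m hm =>
    (mul_le_mul_of_nonneg_right (Nat.cast_le.2 hm) hdt.le).trans hMT
  have hexpm : ∀ m, m ≤ M → Real.exp (4 * (κ * dt) * m) ≤ Real.exp (8 * (b + c + 1) * T) := by
    intro m hm
    refine Real.exp_le_exp.2 ?_
    have := mul_le_mul_of_nonneg_left (hmT m hm) hκ0.le
    rw [hκdef] at this ⊢; nlinarith
  have hmain : ∀ m, m < M → S m ≤ Real.exp (4 * (κ * dt) * m) * (‖e 1‖ ^ 2 + 2 * (m * dt) * g ^ 2) := by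
    intro m
    induction m with
    | zero => intro hM; rw [hS0 hM]; simp
    | succ m ih =>
      intro hm
      have h1 := ih (by omega)
      have hpos : 0 ≤ ‖e 1‖ ^ 2 + 2 * (m * dt) * g ^ 2 := by positivity
      -- Bootstrap: the bound already known for S m, together with `hδ`, supplies the smallness
      -- needed to use `hf` in the next step.
      have hle : ‖e (m + 1)‖ ≤ δ := by
        refine (sq_le_sq₀ (norm_nonneg _) hδ0).1 (le_trans ?_ hδ)
        have h2 := hSE m (by omega)
        have h3 : S m ≤ Real.exp (8 * (b + c + 1) * T) * D := by
          refine h1.trans (mul_le_mul (hexpm m (by omega)) ?_ hpos (Real.exp_pos _).le)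
          rw [hD]; gcongr; exact hmT m (by omega)
        nlinarith [sq_nonneg ‖e m‖]
      refine (hrec m hm hle).trans ?_
      have hx0 : 0 < κ * dt := by positivity
      have e1 : Real.exp (4 * (κ * dt) * (m + 1 : ℕ)) =
          Real.exp (4 * (κ * dt)) * Real.exp (4 * (κ * dt) * m) := by
        rw [← Real.exp_add]; push_cast; ring_nf
      have e2 : 1 + 4 * (κ * dt) ≤ Real.exp (4 * (κ * dt)) := by
        linarith [Real.add_one_le_exp (4 * (κ * dt))]
      have e3 : 1 ≤ Real.exp (4 * (κ * dt) * (m + 1 : ℕ)) := Real.one_le_exp (by positivity)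
      calc _ ≤ Real.exp (4 * (κ * dt)) * (Real.exp (4 * (κ * dt) * m) *
            (‖e 1‖ ^ 2 + 2 * (m * dt) * g ^ 2)) + Real.exp (4 * (κ * dt) * (m + 1 : ℕ)) * (2 * dt * g ^ 2) := by
            refine add_le_add ?_ (le_mul_of_one_le_left (by positivity) e3)
            refine (mul_le_mul_of_nonneg_left h1 (by positivity)).trans ?_
            exact mul_le_mul_of_nonneg_right e2 (by positivity)
        _ = _ := by rw [e1]; push_cast; ring
  intro m hm
  rcases m with _ | m
  · rw [he0, norm_zero, zero_pow two_ne_zero]; positivity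
  · have h1 := hmain m (by omega)
    have h2 := hSE m (by omega)
    have hpos : 0 ≤ ‖e 1‖ ^ 2 + 2 * (m * dt) * g ^ 2 := by positivity
    have h3 : S m ≤ Real.exp (8 * (b + c + 1) * T) * D := by
      refine h1.trans (mul_le_mul (hexpm m (by omega)) ?_ hpos (Real.exp_pos _).le)
      rw [hD]; gcongr; exact hmT m (by omega)
    nlinarith [sq_nonneg ‖e m‖]

/-! ### The Galerkin equations in Fourier coefficients and their conservation laws -/

/-- The convolution of two sequences, summed over the frequencies `-N, …, N` of the second. -/
def conv (N : ℕ) (a b : ℤ → ℂ) (k : ℤ) : ℂ := ∑ j ∈ box N, a (k - j) * b j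

/-- The dispersion relation `k³ + k⁵`. -/
def freq (k : ℤ) : ℝ := (k : ℝ) ^ 3 + (k : ℝ) ^ 5

/-- The frequencies of `c` lie in `-N, …, N`. -/
def BandLimited (N : ℕ) (c : ℤ → ℂ) : Prop := ∀ k, k ∉ box N → c k = 0

/-- The sequence is the sequence of Fourier coefficients of a real function. -/
def Hermitian (c : ℤ → ℂ) : Prop := ∀ k, c (-k) = (starRingEnd ℂ) (c k)

theorem Hermitian.norm_neg {c : ℤ → ℂ} (h : Hermitian c) (k : ℤ) : ‖c (-k)‖ = ‖c k‖ := by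
  rw [h, RCLike.norm_conj]

/-- The box is not invariant under j ↦ k − j. The sums are therefore extended to all of ℤ, using
that both sequences vanish outside the box, and reflected there. -/
theorem sum_box_comm {R : Type*} [NormedCommRing R] {N : ℕ} {a b : ℤ → R}
    (ha : ∀ k, k ∉ box N → a k = 0) (hb : ∀ k, k ∉ box N → b k = 0) (k : ℤ) :
    ∑ j ∈ box N, a (k - j) * b j = ∑ j ∈ box N, b (k - j) * a j := by
  have h : ∀ a b : ℤ → R, (∀ k, k ∉ box N → b k = 0) →
      ∑' j, a (k - j) * b j = ∑ j ∈ box N, a (k - j) * b j := fun a b hb =>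
    tsum_eq_sum fun j hj => by rw [hb j hj, mul_zero]
  rw [← h a b hb, ← h b a ha, ← (Equiv.subLeft k).tsum_eq]
  simp [mul_comm]

theorem conv_comm {N : ℕ} {a b : ℤ → ℂ} (ha : BandLimited N a) (hb : BandLimited N b) (k : ℤ) :
    conv N a b k = conv N b a k := sum_box_comm ha hb k

theorem conj_form (F G : Finset ℤ) (m : ℤ → ℤ → ℂ) (v w : ℤ → ℂ) :
    (starRingEnd ℂ) (∑ k ∈ F, ∑ j ∈ G, m k j * v j * (starRingEnd ℂ) (w k)) =
      ∑ k ∈ G, ∑ j ∈ F, (starRingEnd ℂ) (m j k) * w j * (starRingEnd ℂ) (v k) := by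
  rw [Finset.sum_comm, map_sum]
  refine Finset.sum_congr rfl fun j _ => ?_
  rw [map_sum]
  refine Finset.sum_congr rfl fun k _ => ?_
  simp only [map_mul, Complex.conj_conj]; ring

theorem Hermitian.conj_sub {c : ℤ → ℂ} (h : Hermitian c) (k j : ℤ) :
    (starRingEnd ℂ) (c (j - k)) = c (k - j) := by rw [← h, neg_sub]

/-- Symmetrisation of the weighted cubic form. -/
theorem weighted_form_eq {N : ℕ} {c : ℤ → ℂ} (hb : BandLimited N c) (w : ℤ → ℝ) :
    ∑ k ∈ box N, ∑ j ∈ box N, ((w k * k : ℝ) * c (k - j)) * c j * (starRingEnd ℂ) (c k) =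
    2 * ∑ k ∈ box N, ∑ j ∈ box N, ((w k * j : ℝ) * c (k - j)) * c j * (starRingEnd ℂ) (c k) := by
  rw [Finset.mul_sum]
  refine Finset.sum_congr rfl fun k _ => ?_
  have h := conv_comm (a := c) (b := fun j => (j : ℂ) * c j) hb
    (fun j hj => by simp [hb j hj]) k
  simp only [conv] at h
  have e1 : ∑ j ∈ box N, ((w k * k : ℝ) * c (k - j)) * c j * (starRingEnd ℂ) (c k) =
      -- Write k = j + (k − j); by commutativity of convolution the two halves are equal.
      (w k * (starRingEnd ℂ) (c k)) * (∑ j ∈ box N, c (k - j) * ((j : ℂ) * c j) +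
        ∑ j ∈ box N, ((k - j : ℤ) : ℂ) * c (k - j) * c j) := by
    rw [← Finset.sum_add_distrib, Finset.mul_sum]
    exact Finset.sum_congr rfl fun j _ => by push_cast; ring
  rw [e1, ← h, ← two_mul, Finset.mul_sum, Finset.mul_sum, Finset.mul_sum]
  exact Finset.sum_congr rfl fun j _ => by push_cast; ring

/-- For Hermitian c the kernel c(k − j) is self-adjoint. Hence twice the imaginary part of the form
with weight w(k)j is that of the form minus its conjugate transpose, whose weight is the commutator
w(k)j − w(j)k. -/
theorem im_weighted_form_eq {N : ℕ} {c : ℤ → ℂ} (hb : BandLimited N c) (hc : Hermitian c)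
    (w : ℤ → ℝ) :
    (∑ k ∈ box N, ∑ j ∈ box N,
      ((w k * k : ℝ) * c (k - j)) * c j * (starRingEnd ℂ) (c k)).im =
    (∑ k ∈ box N, ∑ j ∈ box N,
      ((w k * j - w j * k : ℝ) * c (k - j)) * c j * (starRingEnd ℂ) (c k)).im := by
  rw [weighted_form_eq hb]
  have h := conj_form (box N) (box N) (fun k j => (w k * j : ℝ) * c (k - j)) c c
  have e : ∑ k ∈ box N, ∑ j ∈ box N,
      ((w k * j - w j * k : ℝ) * c (k - j)) * c j * (starRingEnd ℂ) (c k) =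
      ∑ k ∈ box N, ∑ j ∈ box N, ((w k * j : ℝ) * c (k - j)) * c j * (starRingEnd ℂ) (c k) -
      (starRingEnd ℂ) (∑ k ∈ box N, ∑ j ∈ box N,
        ((w k * j : ℝ) * c (k - j)) * c j * (starRingEnd ℂ) (c k)) := by
    rw [h, ← Finset.sum_sub_distrib]
    refine Finset.sum_congr rfl fun k _ => ?_
    rw [← Finset.sum_sub_distrib]
    refine Finset.sum_congr rfl fun j _ => ?_
    rw [map_mul, Complex.conj_ofReal, hc.conj_sub]
    push_cast; ring
  rw [e, Complex.sub_im, Complex.conj_im, Complex.mul_im]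
  simp; ring

/-- Conservation of the L² norm. For w = 1, with X and Y the forms with weights k and j, X = 2Y and
Im X = Im(Y − X), so that Im X = −½ Im X. -/
theorem im_form_eq_zero {N : ℕ} {c : ℤ → ℂ} (hb : BandLimited N c) (hc : Hermitian c) :
    (∑ k ∈ box N, ∑ j ∈ box N, (((1 : ℝ) * k : ℝ) * c (k - j)) * c j * (starRingEnd ℂ) (c k)).im = 0 := by
  have h1 := im_weighted_form_eq hb hc (fun _ => 1)
  have h2 := weighted_form_eq hb (fun _ => 1)
  set X := ∑ k ∈ box N, ∑ j ∈ box N, (((1 : ℝ) * k : ℝ) * c (k - j)) * c j * (starRingEnd ℂ) (c k)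
  set Y := ∑ k ∈ box N, ∑ j ∈ box N, (((1 : ℝ) * j : ℝ) * c (k - j)) * c j * (starRingEnd ℂ) (c k)
  have h3 : ∑ k ∈ box N, ∑ j ∈ box N,
      (((1 : ℝ) * j - 1 * k : ℝ) * c (k - j)) * c j * (starRingEnd ℂ) (c k) = Y - X := by
    rw [← Finset.sum_sub_distrib]
    refine Finset.sum_congr rfl fun k _ => ?_
    rw [← Finset.sum_sub_distrib]
    refine Finset.sum_congr rfl fun j _ => ?_
    push_cast; ring
  rw [h3] at h1
  have h4 := congrArg Complex.im h2
  simp at h4 h1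
  linarith

theorem hasDerivAt_norm_sq {f : ℝ → ℂ} {f' : ℂ} {t : ℝ} (h : HasDerivAt f f' t) :
    HasDerivAt (fun s => ‖f s‖ ^ 2) (2 * (f' * (starRingEnd ℂ) (f t)).re) t := by
  have := h.norm_sq
  rwa [Complex.inner] at this

theorem hasDerivAt_sum_norm_sq {F : Finset ℤ} {c : ℝ → ℤ → ℂ} {c' : ℤ → ℂ} {t : ℝ} (w : ℤ → ℝ)
    (h : ∀ k ∈ F, HasDerivAt (fun s => c s k) (c' k) t) :
    HasDerivAt (fun s => ∑ k ∈ F, w k * ‖c s k‖ ^ 2)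
      (2 * (∑ k ∈ F, w k * (c' k * (starRingEnd ℂ) (c t k))).re) t := by
  have := HasDerivAt.fun_sum fun k hk => (hasDerivAt_norm_sq (h k hk)).const_mul (w k)
  refine this.congr_deriv ?_
  rw [Complex.re_sum, Finset.mul_sum]
  exact Finset.sum_congr rfl fun k _ => by rw [Complex.re_ofReal_mul]; ring

/-- The operator `d ↦ P_N(iω d - (i k / 2) e)`. -/
def galerkinOp (N : ℕ) (d e : ℤ → ℂ) (k : ℤ) : ℂ :=
  if k ∈ box N then Complex.I * freq k * d k - Complex.I * (k / 2) * e k else 0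

theorem galerkinOp_bandLimited (N : ℕ) (d e : ℤ → ℂ) : BandLimited N (galerkinOp N d e) :=
  fun _ hk => if_neg hk

/-- A solution of the Fourier-Galerkin equations, in Fourier coefficients. -/
structure GalerkinFlow (N : ℕ) (c : ℝ → ℤ → ℂ) : Prop where
  band : ∀ t, BandLimited N (c t)
  herm : ∀ t, 0 ≤ t → Hermitian (c t)
  deriv : ∀ t, 0 ≤ t → ∀ k ∈ box N, HasDerivWithinAt (fun s => c s k)
    (Complex.I * freq k * c t k - Complex.I * (k / 2) * conv N (c t) (c t) k) (Ici 0) t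

namespace GalerkinFlow

variable {N : ℕ} {c : ℝ → ℤ → ℂ}

/-- The first time derivative. -/
def d1 (N : ℕ) (c : ℝ → ℤ → ℂ) (t : ℝ) : ℤ → ℂ := galerkinOp N (c t) (conv N (c t) (c t))

/-- The second time derivative. -/
def d2 (N : ℕ) (c : ℝ → ℤ → ℂ) (t : ℝ) : ℤ → ℂ :=
  galerkinOp N (d1 N c t) fun k => conv N (d1 N c t) (c t) k + conv N (c t) (d1 N c t) k

/-- The third time derivative. -/
def d3 (N : ℕ) (c : ℝ → ℤ → ℂ) (t : ℝ) : ℤ → ℂ :=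
  galerkinOp N (d2 N c t) fun k => (conv N (d2 N c t) (c t) k + conv N (d1 N c t) (d1 N c t) k) +
    (conv N (d1 N c t) (d1 N c t) k + conv N (c t) (d2 N c t) k)

theorem hasDerivWithinAt_conv {a b : ℝ → ℤ → ℂ} {a' b' : ℤ → ℂ} {s : Set ℝ} {t : ℝ}
    (ha : ∀ k, HasDerivWithinAt (fun s => a s k) (a' k) s t)
    (hb : ∀ k, HasDerivWithinAt (fun s => b s k) (b' k) s t) (k : ℤ) :
    HasDerivWithinAt (fun s => conv N (a s) (b s) k) (conv N a' (b t) k + conv N (a t) b' k) s t := by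
  simp only [conv, ← Finset.sum_add_distrib]
  exact HasDerivWithinAt.fun_sum fun j _ => (ha (k - j)).mul (hb j)

theorem hasDerivWithinAt_galerkinOp {a b : ℝ → ℤ → ℂ} {a' b' : ℤ → ℂ} {s : Set ℝ} {t : ℝ}
    (ha : ∀ k, HasDerivWithinAt (fun s => a s k) (a' k) s t)
    (hb : ∀ k, HasDerivWithinAt (fun s => b s k) (b' k) s t) (k : ℤ) :
    HasDerivWithinAt (fun s => galerkinOp N (a s) (b s) k) (galerkinOp N a' b' k) s t := by
  by_cases hk : k ∈ box N
  · simp only [galerkinOp, if_pos hk]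
    exact ((ha k).const_mul _).sub ((hb k).const_mul _)
  · simp only [galerkinOp, if_neg hk]
    exact hasDerivWithinAt_const _ _ _

variable (h : GalerkinFlow N c)
include h

theorem hasDeriv0 {t : ℝ} (ht : 0 ≤ t) (k : ℤ) :
    HasDerivWithinAt (fun s => c s k) (d1 N c t k) (Ici 0) t := by
  by_cases hk : k ∈ box N
  · simp only [d1, galerkinOp, if_pos hk]; exact h.deriv t ht k hk
  · simp only [d1, galerkinOp, if_neg hk]
    refine (hasDerivWithinAt_const t _ (0 : ℂ)).congr (fun s _ => h.band s k hk) (h.band t k hk)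

theorem hasDeriv1 {t : ℝ} (ht : 0 ≤ t) (k : ℤ) :
    HasDerivWithinAt (fun s => d1 N c s k) (d2 N c t k) (Ici 0) t :=
  hasDerivWithinAt_galerkinOp (h.hasDeriv0 ht)
    (hasDerivWithinAt_conv (h.hasDeriv0 ht) (h.hasDeriv0 ht)) k

theorem hasDeriv2 {t : ℝ} (ht : 0 ≤ t) (k : ℤ) :
    HasDerivWithinAt (fun s => d2 N c s k) (d3 N c t k) (Ici 0) t :=
  hasDerivWithinAt_galerkinOp (h.hasDeriv1 ht) (fun k =>
    (hasDerivWithinAt_conv (h.hasDeriv1 ht) (h.hasDeriv0 ht) k).add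
      (hasDerivWithinAt_conv (h.hasDeriv0 ht) (h.hasDeriv1 ht) k)) k

theorem hasDerivAt {t : ℝ} (ht : 0 < t) (k : ℤ) : HasDerivAt (fun s => c s k) (d1 N c t k) t :=
  (h.hasDeriv0 ht.le k).hasDerivAt (Ici_mem_nhds ht)

theorem continuousOn (k : ℤ) : ContinuousOn (fun s => c s k) (Ici 0) :=
  fun _ ht => (h.hasDeriv0 ht k).continuousWithinAt

/-- The dispersive term contributes iω|c_k|², which is purely imaginary; only the nonlinearity
changes a weighted ℓ² norm. -/
theorem hasDerivAt_weighted {t : ℝ} (ht : 0 < t) (w : ℤ → ℝ) :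
    HasDerivAt (fun s => ∑ k ∈ box N, w k * ‖c s k‖ ^ 2)
      (∑ k ∈ box N, ∑ j ∈ box N, ((w k * k : ℝ) * c t (k - j)) * c t j *
        (starRingEnd ℂ) (c t k)).im t := by
  refine (hasDerivAt_sum_norm_sq w fun k _ => h.hasDerivAt ht k).congr_deriv ?_
  rw [Complex.re_sum, Complex.im_sum, Finset.mul_sum]
  refine Finset.sum_congr rfl fun k hk => ?_
  have e : ∑ j ∈ box N, ((w k * k : ℝ) * c t (k - j)) * c t j * (starRingEnd ℂ) (c t k) =
      ((w k * k : ℝ) : ℂ) * (conv N (c t) (c t) k * (starRingEnd ℂ) (c t k)) := by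
    rw [conv, Finset.sum_mul, Finset.mul_sum]
    exact Finset.sum_congr rfl fun j _ => by ring
  have e2 : d1 N c t k * (starRingEnd ℂ) (c t k) = Complex.I * ((freq k * ‖c t k‖ ^ 2 : ℝ) : ℂ) -
      Complex.I * (((k : ℝ) / 2 : ℝ) * (conv N (c t) (c t) k * (starRingEnd ℂ) (c t k))) := by
    simp only [d1, galerkinOp, if_pos hk]
    push_cast
    rw [← Complex.mul_conj']; ring
  rw [e, e2, Complex.im_ofReal_mul, Complex.re_ofReal_mul]
  simp only [Complex.sub_re, Complex.I_mul_re, Complex.ofReal_im, Complex.im_ofReal_mul]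
  ring

theorem continuousOn_weighted (w : ℤ → ℝ) :
    ContinuousOn (fun s => ∑ k ∈ box N, w k * ‖c s k‖ ^ 2) (Ici 0) :=
  continuousOn_finsetSum _ fun k _ => ((h.continuousOn k).norm.pow 2).const_smul (w k)

theorem l2_sq_le {t : ℝ} (ht : 0 ≤ t) : l2 (box N) (c t) ^ 2 ≤ l2 (box N) (c 0) ^ 2 := by
  have := gronwall (f := fun s => ∑ k ∈ box N, 1 * ‖c s k‖ ^ 2) (T := t) le_rfl le_rfl
    ((h.continuousOn_weighted fun _ => 1).mono Icc_subset_Ici_self)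
    (fun s hs => h.hasDerivAt_weighted hs.1 fun _ => 1)
    (fun s hs => by rw [im_form_eq_zero (h.band s) (h.herm s hs.1.le)]; simp) (right_mem_Icc.2 ht)
  simpa [l2_sq] using this

/-- The cubic part of the Hamiltonian. -/
theorem hasDerivAt_cubic {t : ℝ} (ht : 0 < t) :
    HasDerivAt (fun s => (∑ k ∈ box N, conv N (c s) (c s) k * (starRingEnd ℂ) (c s k)).re)
      (3 * (∑ k ∈ box N, conv N (c t) (c t) k * (starRingEnd ℂ) (d1 N c t k)).re) t := by
  have hd := fun k => (h.hasDerivAt ht k).hasDerivWithinAt (s := univ)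
  have h1 : HasDerivAt (fun s => ∑ k ∈ box N, conv N (c s) (c s) k * (starRingEnd ℂ) (c s k))
      (∑ k ∈ box N, ((conv N (d1 N c t) (c t) k + conv N (c t) (d1 N c t) k) *
        (starRingEnd ℂ) (c t k) + conv N (c t) (c t) k * (starRingEnd ℂ) (d1 N c t k))) t :=
    HasDerivAt.fun_sum fun k _ =>
      ((hasDerivWithinAt_conv hd hd k).hasDerivAt univ_mem).mul (h.hasDerivAt ht k).star
  have h2 := (Complex.reCLM.hasFDerivAt.comp_hasDerivAt t h1)
  refine h2.congr_deriv ?_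
  rw [Complex.reCLM_apply]
  -- Differentiating either factor of the convolution gives the same term; by `e2` and `e3` its real
  -- part equals that from the conjugated factor, so the total is three times the latter.
  have e1 : ∑ k ∈ box N, ((conv N (d1 N c t) (c t) k + conv N (c t) (d1 N c t) k) *
        (starRingEnd ℂ) (c t k) + conv N (c t) (c t) k * (starRingEnd ℂ) (d1 N c t k)) =
      2 * ∑ k ∈ box N, ∑ j ∈ box N, c t (k - j) * d1 N c t j * (starRingEnd ℂ) (c t k) +
      ∑ k ∈ box N, conv N (c t) (c t) k * (starRingEnd ℂ) (d1 N c t k) := by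
    rw [Finset.sum_add_distrib, Finset.mul_sum]
    congr 1
    refine Finset.sum_congr rfl fun k _ => ?_
    rw [conv_comm (a := d1 N c t) (galerkinOp_bandLimited _ _ _) (h.band t), ← two_mul, mul_assoc]
    simp only [conv, Finset.sum_mul]
  have e2 := congrArg Complex.re (conj_form (box N) (box N) (fun k j => c t (k - j)) (d1 N c t) (c t))
  have e3 : ∑ k ∈ box N, ∑ j ∈ box N, (starRingEnd ℂ) (c t (j - k)) * c t j *
      (starRingEnd ℂ) (d1 N c t k) =
      ∑ k ∈ box N, conv N (c t) (c t) k * (starRingEnd ℂ) (d1 N c t k) := by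
    refine Finset.sum_congr rfl fun k _ => ?_
    rw [conv, Finset.sum_mul]
    exact Finset.sum_congr rfl fun j _ => by rw [(h.herm t ht.le).conj_sub]
  rw [e3, Complex.conj_re] at e2
  rw [e1, Complex.add_re, Complex.mul_re, e2]
  simp; ring

/-- The energy is conserved because ω(k) = k(k² + k⁴). Both the quadratic part and one third of the
cubic part have derivative Im ∑ ω(k)(c∗c)_k c̄_k; the remaining term (ik/2)|(c∗c)_k|² is purely
imaginary. The inequality is all that is needed. -/
theorem hamiltonian_le {t : ℝ} (ht : 0 ≤ t) :
    ∑ k ∈ box N, ((k : ℝ) ^ 2 + (k : ℝ) ^ 4) * ‖c t k‖ ^ 2 -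
      1 / 3 * (∑ k ∈ box N, conv N (c t) (c t) k * (starRingEnd ℂ) (c t k)).re ≤
    ∑ k ∈ box N, ((k : ℝ) ^ 2 + (k : ℝ) ^ 4) * ‖c 0 k‖ ^ 2 -
      1 / 3 * (∑ k ∈ box N, conv N (c 0) (c 0) k * (starRingEnd ℂ) (c 0 k)).re := by
  have hcv : ∀ k, ContinuousOn (fun s => conv N (c s) (c s) k) (Ici 0) := fun k s hs =>
    (hasDerivWithinAt_conv (h.hasDeriv0 hs) (h.hasDeriv0 hs) k).continuousWithinAt
  have hc : ContinuousOn (fun s => (∑ k ∈ box N, conv N (c s) (c s) k *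
      (starRingEnd ℂ) (c s k)).re) (Ici 0) :=
    Complex.continuous_re.comp_continuousOn (continuousOn_finsetSum _ fun k _ =>
      (hcv k).mul (Complex.continuous_conj.comp_continuousOn (h.continuousOn k)))
  have := gronwall (T := t) le_rfl le_rfl
    (((h.continuousOn_weighted fun k => (k : ℝ) ^ 2 + (k : ℝ) ^ 4).sub (hc.const_smul (1 / 3 : ℝ))).mono
      Icc_subset_Ici_self)
    (fun s hs => (h.hasDerivAt_weighted hs.1 _).sub ((h.hasDerivAt_cubic hs.1).const_mul (1 / 3 : ℝ)))
    (fun s hs => ?_) (right_mem_Icc.2 ht)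
  · simpa using this
  · rw [zero_mul, zero_add, sub_nonpos, Complex.im_sum, ← mul_assoc, Complex.re_sum]
    norm_num
    refine Finset.sum_le_sum fun k hk => le_of_eq ?_
    have e : ∑ j ∈ box N, (((k ^ 2 + k ^ 4) * k : ℝ) * c s (k - j)) * c s j * (starRingEnd ℂ) (c s k) =
        ((freq k : ℝ) : ℂ) * (conv N (c s) (c s) k * (starRingEnd ℂ) (c s k)) := by
      rw [conv, Finset.sum_mul, Finset.mul_sum]
      exact Finset.sum_congr rfl fun j _ => by simp only [freq]; push_cast; ring
    have e2 : conv N (c s) (c s) k * (starRingEnd ℂ) (d1 N c s k) =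
        Complex.I * ((k / 2 * ‖conv N (c s) (c s) k‖ ^ 2 : ℝ) : ℂ) -
        Complex.I * (freq k * (conv N (c s) (c s) k * (starRingEnd ℂ) (c s k))) := by
      simp only [d1, galerkinOp, if_pos hk]
      push_cast
      rw [← Complex.mul_conj']
      simp only [map_sub, map_mul, map_div₀, Complex.conj_I, Complex.conj_ofReal, Complex.conj_ofNat]
      simp; ring
    have e3 := congrArg Complex.im e
    have e4 := congrArg Complex.re e2
    rw [Complex.im_ofReal_mul] at e3
    rw [Complex.sub_re, Complex.I_mul_re, Complex.I_mul_re, Complex.ofReal_im,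
      Complex.im_ofReal_mul] at e4
    simp at e3 e4
    linarith

end GalerkinFlow

/-! ### Weighted Wiener algebras -/

/-- The embedding constant `∑ 1 / (1 + n²)`. -/
def embConst : ℝ := ∑' n : ℤ, 1 / (1 + (n : ℝ) ^ 2)

theorem summable_embConst : Summable fun n : ℤ => 1 / (1 + (n : ℝ) ^ 2) := by
  refine Summable.of_norm_bounded_eventually (g := fun n : ℤ => 1 / (n : ℝ) ^ 2)
    (Real.summable_one_div_int_pow.2 one_lt_two) ?_
  filter_upwards [(Set.finite_singleton (0 : ℤ)).compl_mem_cofinite] with n hn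
  have hn' : (n : ℝ) ≠ 0 := by exact_mod_cast hn
  rw [Real.norm_of_nonneg (by positivity)]
  have : 0 < (n : ℝ) ^ 2 := by positivity
  gcongr; linarith

theorem sumsLE_embConst : SumsLE (fun n : ℤ => 1 / (1 + (n : ℝ) ^ 2)) embConst := fun s =>
  summable_embConst.sum_le_tsum s fun n _ => by positivity

theorem embConst_nonneg : 0 ≤ embConst := sumsLE_embConst.nonneg

/-- Embedding of H¹ into the Wiener algebra: Cauchy–Schwarz against the weight 1/(1 + n²). -/
theorem sumsLE_sqrt {b : ℤ → ℝ} {B : ℝ} (h : SumsLE (fun n => (1 + (n : ℝ) ^ 2) * b n ^ 2) B) :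
    SumsLE b √(embConst * B) := fun s => by
  have hcs := Real.sum_mul_le_sqrt_mul_sqrt s (fun n : ℤ => √(1 / (1 + (n : ℝ) ^ 2)))
    (fun n => √(1 + (n : ℝ) ^ 2) * b n)
  have e1 : ∀ n : ℤ, √(1 / (1 + (n : ℝ) ^ 2)) * (√(1 + (n : ℝ) ^ 2) * b n) = b n := fun n => by
    have : 0 < 1 + (n : ℝ) ^ 2 := by positivity
    rw [← mul_assoc, ← Real.sqrt_mul (by positivity), one_div_mul_cancel this.ne', Real.sqrt_one, one_mul]
  have e2 : ∀ n : ℤ, √(1 / (1 + (n : ℝ) ^ 2)) ^ 2 = 1 / (1 + (n : ℝ) ^ 2) := fun n =>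
    Real.sq_sqrt (by positivity)
  have e3 : ∀ n : ℤ, (√(1 + (n : ℝ) ^ 2) * b n) ^ 2 = (1 + (n : ℝ) ^ 2) * b n ^ 2 := fun n => by
    rw [mul_pow, Real.sq_sqrt (by positivity)]
  simp_rw [e1, e2, e3] at hcs
  refine hcs.trans ?_
  rw [Real.sqrt_mul embConst_nonneg]
  exact mul_le_mul (Real.sqrt_le_sqrt (sumsLE_embConst s)) (Real.sqrt_le_sqrt (h s))
    (Real.sqrt_nonneg _) (Real.sqrt_nonneg _)

/-- The weighted `ℓ¹` norm with weight `(1 + |n|)^q` is at most `A`. -/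
def WBound (q : ℕ) (c : ℤ → ℂ) (A : ℝ) : Prop := SumsLE (fun n => (1 + |(n : ℝ)|) ^ q * ‖c n‖) A

theorem WBound.mono {p q : ℕ} {c : ℤ → ℂ} {A : ℝ} (h : WBound q c A) (hpq : p ≤ q) : WBound p c A :=
  SumsLE.mono h (fun n => mul_le_mul_of_nonneg_right
    (pow_le_pow_right₀ (by linarith [abs_nonneg (n : ℝ)]) hpq) (norm_nonneg _)) le_rfl

theorem WBound.add {q : ℕ} {c d : ℤ → ℂ} {A B : ℝ} (h : WBound q c A) (h' : WBound q d B) :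
    WBound q (fun k => c k + d k) (A + B) :=
  SumsLE.mono (SumsLE.add h h') (fun n => by
    rw [← mul_add]; exact mul_le_mul_of_nonneg_left (norm_add_le _ _) (by positivity)) le_rfl

theorem WBound.sumsLE_norm {q : ℕ} {c : ℤ → ℂ} {A : ℝ} (h : WBound q c A) :
    SumsLE (fun n => ‖c n‖) A := by simpa [WBound] using h.mono (Nat.zero_le q)

theorem WBound.sumsLE_abs_mul {q : ℕ} {c : ℤ → ℂ} {A : ℝ} (h : WBound q c A) (hq : 1 ≤ q) :
    SumsLE (fun n => |(n : ℝ)| * ‖c n‖) A :=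
  SumsLE.mono (h.mono hq) (fun n => mul_le_mul_of_nonneg_right (by simp) (norm_nonneg _)) le_rfl

theorem WBound.l2_le {q : ℕ} {c : ℤ → ℂ} {A : ℝ} (h : WBound q c A) (F : Finset ℤ) : l2 F c ≤ A :=
  (l2_le_sum F c).trans (h.sumsLE_norm F)

theorem one_add_abs_le (k j : ℤ) : 1 + |(k : ℝ)| ≤ (1 + |((k - j : ℤ) : ℝ)|) * (1 + |(j : ℝ)|) := by
  have : |(k : ℝ)| ≤ |((k - j : ℤ) : ℝ)| + |(j : ℝ)| := by
    simpa using abs_add_le ((k : ℝ) - j) j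
  nlinarith [abs_nonneg ((k - j : ℤ) : ℝ), abs_nonneg (j : ℝ)]

/-- The weight 1 + |k| is submultiplicative along k = (k − j) + j, so the weighted ℓ¹ spaces are
algebras under convolution. -/
theorem WBound.conv {q N : ℕ} {a b : ℤ → ℂ} {A B : ℝ} (ha : WBound q a A) (hb : WBound q b B) :
    WBound q (Kawahara.conv N a b) (A * B) := fun s => by
  calc ∑ k ∈ s, (1 + |(k : ℝ)|) ^ q * ‖Kawahara.conv N a b k‖
      ≤ ∑ k ∈ s, ∑ j ∈ box N, ((1 + |((k - j : ℤ) : ℝ)|) ^ q * ‖a (k - j)‖) *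
          ((1 + |(j : ℝ)|) ^ q * ‖b j‖) := by
        refine Finset.sum_le_sum fun k _ => ?_
        refine (mul_le_mul_of_nonneg_left (norm_sum_le _ _) (by positivity)).trans ?_
        rw [Finset.mul_sum]
        refine Finset.sum_le_sum fun j _ => ?_
        have := pow_le_pow_left₀ (by positivity) (one_add_abs_le k j) q
        rw [norm_mul]
        calc _ ≤ ((1 + |((k - j : ℤ) : ℝ)|) * (1 + |(j : ℝ)|)) ^ q * (‖a (k - j)‖ * ‖b j‖) := by gcongr
          _ = _ := by rw [mul_pow]; ring
    _ = ∑ j ∈ box N, (∑ k ∈ s, (1 + |((k - j : ℤ) : ℝ)|) ^ q * ‖a (k - j)‖) *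
          ((1 + |(j : ℝ)|) ^ q * ‖b j‖) := by
        rw [Finset.sum_comm]; simp_rw [Finset.sum_mul]
    _ ≤ ∑ j ∈ box N, A * ((1 + |(j : ℝ)|) ^ q * ‖b j‖) := by
        refine Finset.sum_le_sum fun j _ => mul_le_mul_of_nonneg_right ?_ (by positivity)
        exact SumsLE.comp ha (e := fun k => k - j) (fun x y h => by simpa using h) s
    _ ≤ A * B := by
        rw [← Finset.mul_sum]; exact mul_le_mul_of_nonneg_left (hb _) (SumsLE.nonneg ha)

theorem abs_freq_le (k : ℤ) : |freq k| ≤ 2 * (1 + |(k : ℝ)|) ^ 5 := by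
  have h0 := abs_nonneg (k : ℝ)
  have h1 : |(k : ℝ)| ^ 3 ≤ (1 + |(k : ℝ)|) ^ 5 :=
    (pow_le_pow_left₀ h0 (by linarith) 3).trans (pow_le_pow_right₀ (by linarith) (by norm_num))
  have h2 : |(k : ℝ)| ^ 5 ≤ (1 + |(k : ℝ)|) ^ 5 := pow_le_pow_left₀ h0 (by linarith) 5
  refine (abs_add_le _ _).trans ?_
  rw [abs_pow, abs_pow]; linarith

/-- Dispersion costs five powers of the weight and the derivative in the nonlinearity costs one.
Thus weight 15 suffices for three time derivatives. -/
theorem WBound.galerkinOp {q N : ℕ} {d e : ℤ → ℂ} {A B : ℝ} (hd : WBound (q + 5) d A)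
    (he : WBound (q + 1) e B) : WBound q (Kawahara.galerkinOp N d e) (2 * A + B) := by
  refine SumsLE.mono (SumsLE.add (SumsLE.const_mul hd (by norm_num : (0 : ℝ) ≤ 2)) he) (fun k => ?_) le_rfl
  have h0 := abs_nonneg (k : ℝ)
  rw [Kawahara.galerkinOp]
  split_ifs with hk
  · have h1 : ‖Complex.I * freq k * d k - Complex.I * (k / 2) * e k‖ ≤
        2 * (1 + |(k : ℝ)|) ^ 5 * ‖d k‖ + (1 + |(k : ℝ)|) * ‖e k‖ := by
      refine (norm_sub_le _ _).trans (add_le_add ?_ ?_)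
      · rw [norm_mul, norm_mul, Complex.norm_I, one_mul, Complex.norm_real]
        exact mul_le_mul_of_nonneg_right (abs_freq_le k) (norm_nonneg _)
      · rw [norm_mul, norm_mul, Complex.norm_I, one_mul, norm_div, Complex.norm_intCast]
        refine mul_le_mul_of_nonneg_right ?_ (norm_nonneg _)
        rw [Complex.norm_ofNat]; linarith
    refine (mul_le_mul_of_nonneg_left h1 (by positivity)).trans (le_of_eq ?_)
    ring
  · rw [norm_zero, mul_zero]; positivity

/-- The embedding of `H^16` into the weighted Wiener algebra. -/
theorem wBound_of_sobolev {r : ℕ} (hr : 16 ≤ r) {c : ℤ → ℂ} {A B : ℝ}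
    (hA : SumsLE (fun n => ‖c n‖ ^ 2) A) (hB : SumsLE (fun n => (n : ℝ) ^ (2 * r) * ‖c n‖ ^ 2) B) :
    WBound 15 c √(embConst * (2 ^ 31 * (A + B))) := by
  refine sumsLE_sqrt (SumsLE.mono (SumsLE.const_mul (SumsLE.add hA hB)
    -- Squaring the weight (1 + |n|)^15 and adding the factor 1 + n² of the embedding gives exponent
    -- 32 = 2 · 16; the constant comes from (1 + x)^32 ≤ 2^31 (1 + x^32).
    (by norm_num : (0 : ℝ) ≤ 2 ^ 31)) (fun n => ?_) le_rfl)
  have h0 := abs_nonneg (n : ℝ)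
  have h1 : (1 + (n : ℝ) ^ 2) ≤ (1 + |(n : ℝ)|) ^ 2 := by rw [← sq_abs]; nlinarith
  have h2 : (1 + |(n : ℝ)|) ^ 32 ≤ 2 ^ 31 * (1 + |(n : ℝ)| ^ 32) := by
    simpa using add_pow_le zero_le_one h0 32
  have h3 : |(n : ℝ)| ^ 32 ≤ (n : ℝ) ^ (2 * r) := by
    have : (n : ℝ) ^ (2 * r) = |(n : ℝ)| ^ (2 * r) := by rw [pow_mul, pow_mul, sq_abs]
    rw [this]
    rcases eq_or_ne n 0 with rfl | hn
    · simp
    · exact pow_le_pow_right₀ (by exact_mod_cast Int.one_le_abs hn) (by omega)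
  calc (1 + (n : ℝ) ^ 2) * ((1 + |(n : ℝ)|) ^ 15 * ‖c n‖) ^ 2
      ≤ (1 + |(n : ℝ)|) ^ 2 * ((1 + |(n : ℝ)|) ^ 15 * ‖c n‖) ^ 2 := by gcongr
    _ = (1 + |(n : ℝ)|) ^ 32 * ‖c n‖ ^ 2 := by ring
    _ ≤ (2 ^ 31 * (1 + (n : ℝ) ^ (2 * r))) * ‖c n‖ ^ 2 := by gcongr; linarith
    _ = _ := by ring

/-! ### Sobolev bounds uniform in N -/

/-- The commutator estimate behind the `H^r` energy bound. -/
theorem abs_weight_sub_le (r : ℕ) (hr : 1 ≤ r) (k j : ℝ) :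
    |k ^ (2 * r) * j - j ^ (2 * r) * k| ≤ (2 * r) * 2 ^ r *
      (|k - j| * (|j| ^ r * |k| ^ r) + |k - j| ^ r * |j| * |k| ^ r + |k - j| ^ r * |k| * |j| ^ r) := by
  have main : ∀ k j : ℝ, |j| ≤ |k| → |k ^ (2 * r) * j - j ^ (2 * r) * k| ≤ (2 * r) * 2 ^ r *
      (|k - j| * (|j| ^ r * |k| ^ r) + |k - j| ^ r * |j| * |k| ^ r) := by
    intro k j hjk
    obtain ⟨s, rfl⟩ : ∃ s, r = s + 1 := ⟨r - 1, by omega⟩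
    -- Factoring out kj leaves a difference of odd powers, which yields one factor k − j. The
    -- surplus |k|^s is then distributed between k − j and j, so that no frequency carries more than
    -- r powers.
    have h1 : k ^ (2 * (s + 1)) * j - j ^ (2 * (s + 1)) * k =
      k * j * (k ^ (2 * s + 1) - j ^ (2 * s + 1)) := by ring
    have h2 := abs_pow_sub_pow_le k j (2 * s + 1)
    rw [max_eq_left hjk, Nat.add_sub_cancel] at h2
    have h3 : |k| ^ s ≤ 2 ^ s * (|k - j| ^ s + |j| ^ s) := by
      have : |k| ≤ |k - j| + |j| := by simpa using abs_add_le (k - j) j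
      refine (pow_le_pow_left₀ (abs_nonneg _) this s).trans ?_
      refine (add_pow_le (abs_nonneg _) (abs_nonneg _) s).trans ?_
      gcongr <;> norm_num
    rw [h1, abs_mul, abs_mul]
    have h4 := abs_nonneg (k - j)
    have h5 := abs_nonneg k
    have h6 := abs_nonneg j
    calc |k| * |j| * |k ^ (2 * s + 1) - j ^ (2 * s + 1)|
        ≤ |k| * |j| * (|k - j| * ((2 * s + 1 : ℕ) : ℝ) * |k| ^ (2 * s)) := by gcongr
      _ = ((2 * s + 1 : ℕ) : ℝ) * (|k - j| * |j| * |k| ^ (s + 1)) * |k| ^ s := by ring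
      _ ≤ ((2 * s + 1 : ℕ) : ℝ) * (|k - j| * |j| * |k| ^ (s + 1)) *
          (2 ^ s * (|k - j| ^ s + |j| ^ s)) := by gcongr
      _ = ((2 * s + 1 : ℕ) : ℝ) * 2 ^ s * (|k - j| * (|j| ^ (s + 1) * |k| ^ (s + 1)) +
          |k - j| ^ (s + 1) * |j| * |k| ^ (s + 1)) := by ring
      _ ≤ _ := by
        gcongr
        · push_cast; linarith
        · norm_num
        · omega
  rcases le_total |j| |k| with h | h
  · refine (main k j h).trans ?_
    exact mul_le_mul_of_nonneg_left (le_add_of_nonneg_right (by positivity)) (by positivity)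
  · have := main j k h
    rw [abs_sub_comm, abs_sub_comm j k] at this
    refine this.trans (mul_le_mul_of_nonneg_left ?_ (by positivity))
    have : 0 ≤ |k - j| ^ r * |j| * |k| ^ r := by positivity
    linarith

namespace GalerkinFlow

variable {N : ℕ} {c : ℝ → ℤ → ℂ} (h : GalerkinFlow N c)
include h

theorem sumsLE_of_box {t : ℝ} {w : ℤ → ℝ} (hw : ∀ n, 0 ≤ w n) {A : ℝ} {p : ℕ} (hp : p ≠ 0)
    (hA : ∑ k ∈ box N, w k * ‖c t k‖ ^ p ≤ A) : SumsLE (fun k => w k * ‖c t k‖ ^ p) A :=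
  SumsLE.of_box (fun n => mul_nonneg (hw n) (by positivity))
    (fun n hn => by rw [h.band t n hn]; simp [hp]) hA

/-- The cubic part is controlled by the ℓ¹ norm of c times its squared ℓ² norm, and the ℓ¹ norm
involves only the square root of the H² energy. This makes it subcritical in `energy_le`. -/
theorem cubic_le {t L Z : ℝ} (hL : ∑ k ∈ box N, ‖c t k‖ ^ 2 ≤ L)
    (hZ : ∑ k ∈ box N, ((k : ℝ) ^ 2 + (k : ℝ) ^ 4) * ‖c t k‖ ^ 2 ≤ Z) :
    |(∑ k ∈ box N, conv N (c t) (c t) k * (starRingEnd ℂ) (c t k)).re| ≤ √(embConst * (L + Z)) * L := by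
  have hL0 : 0 ≤ L := (Finset.sum_nonneg fun _ _ => by positivity).trans hL
  have h1 : SumsLE (fun n => ‖c t n‖) √(embConst * (L + Z)) := by
    refine sumsLE_sqrt (SumsLE.mono (h.sumsLE_of_box (w := fun n => 1 + (n : ℝ) ^ 2 + (n : ℝ) ^ 4)
      (t := t) (fun n => by positivity) two_ne_zero (A := L + Z) ?_) (fun n => ?_) le_rfl)
    · refine le_trans (le_of_eq ?_) (add_le_add hL hZ)
      rw [← Finset.sum_add_distrib]
      exact Finset.sum_congr rfl fun k _ => by ring
    · refine mul_le_mul_of_nonneg_right ?_ (by positivity)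
      have : 0 ≤ (n : ℝ) ^ 4 := by positivity
      linarith
  have h2 := norm_form_le (F := box N) (G := box N) (m := fun k j => c t (k - j))
    (fun n => norm_nonneg (c t n)) h1 (fun k _ j _ => le_rfl) (c t) (c t)
  have e : ∑ k ∈ box N, conv N (c t) (c t) k * (starRingEnd ℂ) (c t k) =
      ∑ k ∈ box N, ∑ j ∈ box N, c t (k - j) * c t j * (starRingEnd ℂ) (c t k) := by
    simp only [conv, Finset.sum_mul]
  rw [e]
  refine (Complex.abs_re_le_norm _).trans (h2.trans ?_)
  rw [← sq, l2_sq]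
  exact mul_le_mul_of_nonneg_left hL (Real.sqrt_nonneg _)

/-- The `H²` bound from the conservation laws. -/
theorem energy_le {t L Z : ℝ} (ht : 0 ≤ t) (hL : ∑ k ∈ box N, ‖c 0 k‖ ^ 2 ≤ L)
    (hZ : ∑ k ∈ box N, ((k : ℝ) ^ 2 + (k : ℝ) ^ 4) * ‖c 0 k‖ ^ 2 ≤ Z) :
    ∑ k ∈ box N, ((k : ℝ) ^ 2 + (k : ℝ) ^ 4) * ‖c t k‖ ^ 2 ≤ 4 * Z + 4 * embConst * L ^ 2 + 4 * L := by
  have hLt : ∑ k ∈ box N, ‖c t k‖ ^ 2 ≤ L := by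
    have := h.l2_sq_le ht
    rw [l2_sq, l2_sq] at this; exact this.trans hL
  have h1 := h.cubic_le hL hZ
  have h2 := h.cubic_le hLt le_rfl
  have h3 := h.hamiltonian_le ht
  set Y := ∑ k ∈ box N, ((k : ℝ) ^ 2 + (k : ℝ) ^ 4) * ‖c t k‖ ^ 2
  have hL0 : 0 ≤ L := (Finset.sum_nonneg fun _ _ => by positivity).trans hL
  have hZ0 : 0 ≤ Z := (Finset.sum_nonneg fun _ _ => by positivity).trans hZ
  have hY0 : 0 ≤ Y := Finset.sum_nonneg fun _ _ => by positivity
  -- By the arithmetic–geometric mean inequality the cubic part is linear in the energy X; after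
  -- multiplication by 1/3 it can be absorbed on the left.
  have key : ∀ X, 0 ≤ X → √(embConst * (L + X)) * L ≤ embConst * L ^ 2 + (L + X) := by
    intro X hX
    rw [Real.sqrt_mul embConst_nonneg]
    have a1 := Real.sq_sqrt embConst_nonneg
    have a2 := Real.sq_sqrt (add_nonneg hL0 hX)
    nlinarith [sq_nonneg (√embConst * L - √(L + X)), Real.sqrt_nonneg embConst,
      Real.sqrt_nonneg (L + X), mul_nonneg (Real.sqrt_nonneg embConst) (Real.sqrt_nonneg (L + X))]
  have k1 := key Z hZ0
  have k2 := key Y hY0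
  have l1 := abs_le.1 h1
  have l2 := abs_le.1 h2
  nlinarith [mul_nonneg embConst_nonneg (sq_nonneg L)]

theorem sumsLE_abs_mul {t Z : ℝ} 
    (hZ : ∑ k ∈ box N, ((k : ℝ) ^ 2 + (k : ℝ) ^ 4) * ‖c t k‖ ^ 2 ≤ Z) :
    SumsLE (fun n => |(n : ℝ)| * ‖c t n‖) √(embConst * Z) := by
  refine sumsLE_sqrt (SumsLE.mono (h.sumsLE_of_box (w := fun n => (n : ℝ) ^ 2 + (n : ℝ) ^ 4)
      (t := t) (fun n => by positivity) two_ne_zero hZ) (fun n => le_of_eq ?_) le_rfl)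
  rw [mul_pow, sq_abs]; ring

/-- The commutator puts at most r powers on two of the three factors and one power on the third. The
third is measured in ℓ¹ by D, so the growth rate of the H^r energy depends only on the H² bound. -/
theorem im_weighted_le {t D : ℝ} (ht : 0 ≤ t) {r : ℕ} (hr : 1 ≤ r)
    (hD : SumsLE (fun n => |(n : ℝ)| * ‖c t n‖) D) :
    (∑ k ∈ box N, ∑ j ∈ box N, (((k : ℝ) ^ (2 * r) * k : ℝ) * c t (k - j)) * c t j *
        (starRingEnd ℂ) (c t k)).im ≤
      3 * ((2 * r) * 2 ^ r) * D * ∑ k ∈ box N, (k : ℝ) ^ (2 * r) * ‖c t k‖ ^ 2 := by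
  rw [im_weighted_form_eq (h.band t) (h.herm t ht) fun k => (k : ℝ) ^ (2 * r)]
  set g : ℤ → ℝ := fun k => |(k : ℝ)| ^ r * ‖c t k‖ with hg
  set a : ℤ → ℝ := fun n => |(n : ℝ)| * ‖c t n‖ with ha
  have hg2 : ∑ k ∈ box N, (k : ℝ) ^ (2 * r) * ‖c t k‖ ^ 2 = ∑ k ∈ box N, g k ^ 2 :=
    Finset.sum_congr rfl fun k _ => by
      simp only [hg]; rw [mul_pow, ← pow_mul, mul_comm r 2, pow_mul |(k : ℝ)|, sq_abs, pow_mul]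
  have hgN : ∀ k, k ∉ box N → g k = 0 := fun k hk => by simp [hg, h.band t k hk]
  have haN : ∀ k, k ∉ box N → a k = 0 := fun k hk => by simp [ha, h.band t k hk]
  have hgneg : ∀ k, g (-k) = g k := fun k => by
    simp only [hg]; rw [(h.herm t ht).norm_neg]; simp
  have T := sum_toeplitz_le (a := a) (f := g) (g := g) (fun n => by positivity) hD (box N) (box N)
  rw [Real.mul_self_sqrt (Finset.sum_nonneg fun _ _ => sq_nonneg _), ← hg2] at T
  -- Commuting the convolution here, and exchanging k and j in `T3` with g even, brings all three
  -- terms of the commutator bound to the same Toeplitz form with kernel a.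
  have T2 : ∑ k ∈ box N, ∑ j ∈ box N, g (k - j) * a j * g k =
      ∑ k ∈ box N, ∑ j ∈ box N, a (k - j) * (g j * g k) := by
    refine Finset.sum_congr rfl fun k _ => ?_
    simp_rw [← mul_assoc, ← Finset.sum_mul]
    rw [sum_box_comm hgN haN]
  have T3 : ∑ k ∈ box N, ∑ j ∈ box N, g (k - j) * a k * g j =
      ∑ k ∈ box N, ∑ j ∈ box N, a (k - j) * (g j * g k) := by
    rw [← T2, Finset.sum_comm]
    refine Finset.sum_congr rfl fun k _ => Finset.sum_congr rfl fun j _ => ?_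
    rw [← hgneg, neg_sub]
  calc _ ≤ ‖∑ k ∈ box N, ∑ j ∈ box N, (((k : ℝ) ^ (2 * r) * j - (j : ℝ) ^ (2 * r) * k : ℝ) *
        c t (k - j)) * c t j * (starRingEnd ℂ) (c t k)‖ := Complex.im_le_norm _
    _ ≤ ∑ k ∈ box N, ∑ j ∈ box N, (2 * r) * 2 ^ r * (a (k - j) * (g j * g k) + g (k - j) * a j * g k +
          g (k - j) * a k * g j) := by
      refine (norm_sum_le _ _).trans (Finset.sum_le_sum fun k _ => ?_)
      refine (norm_sum_le _ _).trans (Finset.sum_le_sum fun j _ => ?_)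
      rw [norm_mul, norm_mul, norm_mul, RCLike.norm_conj, Complex.norm_real]
      refine (mul_le_mul_of_nonneg_right (mul_le_mul_of_nonneg_right (mul_le_mul_of_nonneg_right
        (abs_weight_sub_le r hr k j) (norm_nonneg _)) (norm_nonneg _)) (norm_nonneg _)).trans (le_of_eq ?_)
      simp only [ha, hg]; push_cast; ring
    _ = (2 * r) * 2 ^ r * (3 * ∑ k ∈ box N, ∑ j ∈ box N, a (k - j) * (g j * g k)) := by
      simp_rw [← Finset.mul_sum, Finset.sum_add_distrib]
      rw [T2, T3]; ring
    _ ≤ (2 * r) * 2 ^ r * (3 * (D * ∑ k ∈ box N, (k : ℝ) ^ (2 * r) * ‖c t k‖ ^ 2)) := by gcongr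
    _ = _ := by ring

theorem sobolev_le {T D Q : ℝ} {r : ℕ} (hr : 1 ≤ r)
    (hD : ∀ t, 0 ≤ t → SumsLE (fun n => |(n : ℝ)| * ‖c t n‖) D)
    (hQ : ∑ k ∈ box N, (k : ℝ) ^ (2 * r) * ‖c 0 k‖ ^ 2 ≤ Q) {t : ℝ} (ht : t ∈ Icc 0 T) :
    ∑ k ∈ box N, (k : ℝ) ^ (2 * r) * ‖c t k‖ ^ 2 ≤ Real.exp (3 * ((2 * r) * 2 ^ r) * D * T) * Q := by
  have hD0 : 0 ≤ D := (hD 0 le_rfl).nonneg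
  have h1 := gronwall (f := fun s => ∑ k ∈ box N, (k : ℝ) ^ (2 * r) * ‖c s k‖ ^ 2) (T := T)
    (K := 3 * ((2 * r) * 2 ^ r) * D) (ε := 0) (by positivity) le_rfl
    ((h.continuousOn_weighted _).mono Icc_subset_Ici_self)
    (fun s hs => h.hasDerivAt_weighted hs.1 fun k => (k : ℝ) ^ (2 * r))
    (fun s hs => by rw [add_zero]; exact h.im_weighted_le hs.1.le hr (hD s hs.1.le)) ht
  refine h1.trans ?_
  rw [zero_mul, add_zero]
  have h0 : 0 ≤ ∑ k ∈ box N, (k : ℝ) ^ (2 * r) * ‖c 0 k‖ ^ 2 :=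
    Finset.sum_nonneg fun k _ => by rw [pow_mul]; positivity
  refine mul_le_mul (Real.exp_le_exp.2 ?_) hQ h0 (Real.exp_pos _).le
  exact mul_le_mul_of_nonneg_left ht.2 (by positivity)

end GalerkinFlow

/-- Bounds for Fourier-Galerkin solutions that are uniform in the dimension. -/
theorem exists_galerkin_bound {r : ℕ} (hr : 16 ≤ r) (T R : ℝ) :
    ∃ S, 1 ≤ S ∧ ∀ (N : ℕ) (c : ℝ → ℤ → ℂ), GalerkinFlow N c →
      SumsLE (fun k => (1 + (k : ℝ) ^ 2) ^ r * ‖c 0 k‖ ^ 2) R → ∀ t ∈ Icc 0 T,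
      WBound 15 (c t) S ∧ WBound 10 (GalerkinFlow.d1 N c t) S ∧ WBound 5 (GalerkinFlow.d2 N c t) S ∧
        WBound 0 (GalerkinFlow.d3 N c t) S := by
  -- Z bounds the H² energy for all times, D the ℓ¹ norm of k c_k, Q the H^r energy up to T. S0
  -- bounds c with weight 15; S1, S2, S3 bound its time derivatives with weights 10, 5, 0.
  set Z := 4 * R + 4 * embConst * R ^ 2 + 4 * R
  set D := √(embConst * Z)
  set Q := Real.exp (3 * ((2 * r) * 2 ^ r) * D * T) * R
  set S0 := √(embConst * (2 ^ 31 * (R + Q)))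
  set S1 := 2 * S0 + S0 * S0
  set S2 := 2 * S1 + (S1 * S0 + S0 * S1)
  set S3 := 2 * S2 + ((S2 * S0 + S1 * S1) + (S1 * S1 + S0 * S2))
  refine ⟨max 1 (max (max S0 S1) (max S2 S3)), le_max_left _ _, fun N c h hR t ht => ?_⟩
  have hw : ∀ w : ℤ → ℝ, (∀ k, w k ≤ (1 + (k : ℝ) ^ 2) ^ r) →
      ∑ k ∈ box N, w k * ‖c 0 k‖ ^ 2 ≤ R := fun w hw =>
    (Finset.sum_le_sum fun k _ => mul_le_mul_of_nonneg_right (hw k) (by positivity)).trans (hR _)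
  have one_le : ∀ k : ℤ, 1 ≤ 1 + (k : ℝ) ^ 2 := fun k => by linarith [sq_nonneg (k : ℝ)]
  have hL : ∑ k ∈ box N, ‖c 0 k‖ ^ 2 ≤ R := by
    simpa using hw (fun _ => 1) fun k => one_le_pow₀ (one_le k)
  have hZ : ∑ k ∈ box N, ((k : ℝ) ^ 2 + (k : ℝ) ^ 4) * ‖c 0 k‖ ^ 2 ≤ R := hw _ fun k => by
    refine le_trans ?_ (pow_le_pow_right₀ (one_le k) (by omega : 2 ≤ r))
    nlinarith [sq_nonneg (k : ℝ)]
  have hQ : ∑ k ∈ box N, (k : ℝ) ^ (2 * r) * ‖c 0 k‖ ^ 2 ≤ R := hw _ fun k => by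
    rw [pow_mul]; exact pow_le_pow_left₀ (sq_nonneg _) (by linarith) r
  have hD : ∀ t, 0 ≤ t → SumsLE (fun n => |(n : ℝ)| * ‖c t n‖) D := fun t ht =>
    h.sumsLE_abs_mul (h.energy_le ht hL hZ)
  have hLt : ∑ k ∈ box N, ‖c t k‖ ^ 2 ≤ R := by
    have := h.l2_sq_le ht.1
    rw [l2_sq, l2_sq] at this; exact this.trans hL
  have w0 : WBound 15 (c t) S0 := by
    refine wBound_of_sobolev hr ?_ (h.sumsLE_of_box (fun n => ?_) two_ne_zero
      (h.sobolev_le (by omega) hD hQ ht))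
    · simpa using h.sumsLE_of_box (w := fun _ => 1) (t := t) (fun _ => zero_le_one) two_ne_zero
        (A := R) (by simpa using hLt)
    · rw [pow_mul]; positivity
  have w1 : WBound 10 (GalerkinFlow.d1 N c t) S1 :=
    w0.galerkinOp ((w0.mono (by norm_num)).conv (w0.mono (by norm_num)))
  have w2 : WBound 5 (GalerkinFlow.d2 N c t) S2 :=
    w1.galerkinOp (((w1.mono (by norm_num)).conv (w0.mono (by norm_num))).add
      ((w0.mono (by norm_num)).conv (w1.mono (by norm_num))))
  have w3 : WBound 0 (GalerkinFlow.d3 N c t) S3 :=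
    w2.galerkinOp ((((w2.mono (by norm_num)).conv (w0.mono (by norm_num))).add
      ((w1.mono (by norm_num)).conv (w1.mono (by norm_num)))).add
      (((w1.mono (by norm_num)).conv (w1.mono (by norm_num))).add
      ((w0.mono (by norm_num)).conv (w2.mono (by norm_num)))))
  refine ⟨SumsLE.mono w0 (fun _ => le_rfl) ?_, SumsLE.mono w1 (fun _ => le_rfl) ?_,
    SumsLE.mono w2 (fun _ => le_rfl) ?_, SumsLE.mono w3 (fun _ => le_rfl) ?_⟩ <;> simp

/-! ### The leap-frog error -/

/-- The linearised spatial operator `-iω d + i k (c * d)`. -/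
def linOp (N : ℕ) (c d : ℤ → ℂ) (k : ℤ) : ℂ :=
  -(Complex.I * freq k * d k) + Complex.I * k * conv N c d k

theorem re_inner_vec (F : Finset ℤ) (c d : ℤ → ℂ) :
    RCLike.re (inner ℂ (vec F c) (vec F d)) = (∑ k ∈ F, c k * (starRingEnd ℂ) (d k)).re := by
  rw [inner_re_symm, inner_vec]; rfl

/-- The linearised spatial operator is skew-adjoint up to a bounded operator. -/
theorem abs_re_linOp_le {N : ℕ} {a b c c' : ℤ → ℂ} {D : ℝ} (hc' : Hermitian c')
    (hD : SumsLE (fun n => |(n : ℝ)| * ‖c n‖ + N * ‖c n - c' n‖) D) :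
    |(∑ k ∈ box N, linOp N c a k * (starRingEnd ℂ) (b k)).re +
      (∑ k ∈ box N, linOp N c' b k * (starRingEnd ℂ) (a k)).re| ≤ D * (l2 (box N) a * l2 (box N) b) := by
  have h1 := congrArg Complex.re (conj_form (box N) (box N) (fun k j => Complex.I * k * c' (k - j)) b a)
  rw [Complex.conj_re] at h1
  have e1 : ∀ (c a b : ℤ → ℂ), ∑ k ∈ box N, linOp N c a k * (starRingEnd ℂ) (b k) =
      ∑ k ∈ box N, -(Complex.I * freq k * a k) * (starRingEnd ℂ) (b k) +
      ∑ k ∈ box N, ∑ j ∈ box N, Complex.I * k * c (k - j) * a j * (starRingEnd ℂ) (b k) := by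
    intro c a b
    rw [← Finset.sum_add_distrib]
    refine Finset.sum_congr rfl fun k _ => ?_
    rw [linOp, add_mul, conv, Finset.mul_sum, Finset.sum_mul]
    congr 1
    exact Finset.sum_congr rfl fun j _ => by ring
  have e2 : (∑ k ∈ box N, -(Complex.I * freq k * a k) * (starRingEnd ℂ) (b k)).re +
      (∑ k ∈ box N, -(Complex.I * freq k * b k) * (starRingEnd ℂ) (a k)).re = 0 := by
    rw [Complex.re_sum, Complex.re_sum, ← Finset.sum_add_distrib]
    refine Finset.sum_eq_zero fun k _ => ?_
    simp; ring
  rw [e1, e1, Complex.add_re, Complex.add_re, h1]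
  have e3 : (∑ k ∈ box N, ∑ j ∈ box N, (Complex.I * k * c (k - j) - Complex.I * j * c' (k - j)) *
      a j * (starRingEnd ℂ) (b k)).re =
      (∑ k ∈ box N, ∑ j ∈ box N, Complex.I * k * c (k - j) * a j * (starRingEnd ℂ) (b k)).re +
      (∑ k ∈ box N, ∑ j ∈ box N, (starRingEnd ℂ) (Complex.I * j * c' (j - k)) * a j *
        (starRingEnd ℂ) (b k)).re := by
    rw [← Complex.add_re, ← Finset.sum_add_distrib]
    congr 1
    refine Finset.sum_congr rfl fun k _ => ?_
    rw [← Finset.sum_add_distrib]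
    refine Finset.sum_congr rfl fun j _ => ?_
    rw [map_mul, map_mul, hc'.conj_sub, Complex.conj_I]
    simp; ring
  have h2 := norm_form_le (F := box N) (G := box N)
    (m := fun k j => Complex.I * k * c (k - j) - Complex.I * j * c' (k - j))
    (fun n => by positivity) hD (fun k _ j hj => ?_) a b
  · refine le_trans (le_of_eq ?_) ((Complex.abs_re_le_norm _).trans h2)
    rw [e3]; congr 1; linarith
  -- Besides the commutator, which moves the derivative onto the coefficient, there is the mismatch
  -- c − c' between consecutive time levels. It is paid for with a factor |j| ≤ N.
  · have e4 : Complex.I * k * c (k - j) - Complex.I * j * c' (k - j) =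
        Complex.I * ((k - j : ℤ) : ℂ) * c (k - j) + Complex.I * j * (c (k - j) - c' (k - j)) := by
      push_cast; ring
    rw [e4]
    refine (norm_add_le _ _).trans (add_le_add ?_ ?_)
    · simp only [norm_mul, Complex.norm_I, one_mul, Complex.norm_intCast, le_refl]
    · rw [norm_mul, norm_mul, Complex.norm_I, one_mul, Complex.norm_intCast]
      exact mul_le_mul_of_nonneg_right (abs_cast_le_of_mem_box hj) (norm_nonneg _)

theorem l2_conv_le {N : ℕ} {a b : ℤ → ℂ} {A : ℝ} (hA : SumsLE (fun n => ‖a n‖) A) (F : Finset ℤ) :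
    l2 F (conv N a b) ≤ A * l2 (box N) b :=
  l2_kernel_le (fun n => norm_nonneg (a n)) hA (fun _ _ _ _ => le_rfl) b

theorem sqrt_card_box_le {N : ℕ} (hN : 1 ≤ N) : √((box N).card : ℝ) ≤ 2 * N := by
  rw [card_box]
  refine Real.sqrt_le_iff.2 ⟨by positivity, ?_⟩
  have : (1 : ℝ) ≤ N := by exact_mod_cast hN
  push_cast; nlinarith

/-- An inverse inequality by Cauchy–Schwarz over the 2N + 1 frequencies; the crude factor 2N in
place of √(2N + 1) is enough. -/
theorem sumsLE_norm_of_band {N : ℕ} (hN : 1 ≤ N) {a : ℤ → ℂ} (ha : BandLimited N a) :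
    SumsLE (fun n => ‖a n‖) (2 * N * l2 (box N) a) := by
  refine SumsLE.of_box (fun n => norm_nonneg _) (fun n hn => by rw [ha n hn, norm_zero]) ?_
  exact (sum_le_sqrt_mul_l2 _ _).trans
    (mul_le_mul_of_nonneg_right (sqrt_card_box_le hN) (l2_nonneg _ _))

theorem abs_freq_le_of_mem_box {N : ℕ} (hN : 1 ≤ N) {k : ℤ} (hk : k ∈ box N) :
    |freq k| ≤ 2 * (N : ℝ) ^ 5 := by
  have h0 := abs_cast_le_of_mem_box hk
  have hN' : (1 : ℝ) ≤ N := by exact_mod_cast hN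
  have h1 : |(k : ℝ)| ^ 3 ≤ (N : ℝ) ^ 5 :=
    (pow_le_pow_left₀ (abs_nonneg _) h0 3).trans (pow_le_pow_right₀ hN' (by norm_num))
  have h2 : |(k : ℝ)| ^ 5 ≤ (N : ℝ) ^ 5 := pow_le_pow_left₀ (abs_nonneg _) h0 5
  refine (abs_add_le _ _).trans ?_
  rw [abs_pow, abs_pow]; linarith

/-- The source of the condition on N⁵dt: it makes dt times the linearised operator small. -/
theorem l2_linOp_le {N : ℕ} (hN : 1 ≤ N) {c d : ℤ → ℂ} {A : ℝ} (hA : SumsLE (fun n => ‖c n‖) A) :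
    l2 (box N) (linOp N c d) ≤ (N : ℝ) ^ 5 * (2 + A) * l2 (box N) d := by
  have hN' : (1 : ℝ) ≤ N := by exact_mod_cast hN
  have h1 : l2 (box N) (fun k => -(Complex.I * freq k * d k)) ≤ 2 * (N : ℝ) ^ 5 * l2 (box N) d :=
    l2_le_of_le subset_rfl (by positivity) fun k hk => by
      rw [norm_neg, norm_mul, norm_mul, Complex.norm_I, one_mul, Complex.norm_real]
      exact mul_le_mul_of_nonneg_right (abs_freq_le_of_mem_box hN hk) (norm_nonneg _)
  have h2 : l2 (box N) (fun k => Complex.I * k * conv N c d k) ≤ N * l2 (box N) (conv N c d) :=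
    l2_le_of_le subset_rfl (by positivity) fun k hk => by
      rw [norm_mul, norm_mul, Complex.norm_I, one_mul, Complex.norm_intCast]
      exact mul_le_mul_of_nonneg_right (abs_cast_le_of_mem_box hk) (norm_nonneg _)
  refine (l2_add_le _ _ _).trans ((add_le_add h1 (h2.trans (mul_le_mul_of_nonneg_left
    (l2_conv_le hA _) (by positivity)))).trans ?_)
  have h3 : (N : ℝ) ≤ (N : ℝ) ^ 5 := le_self_pow₀ hN' (by norm_num)
  have h4 := mul_le_mul_of_nonneg_right h3 (mul_nonneg hA.nonneg (l2_nonneg (box N) d))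
  linarith

theorem hasDerivWithinAt_vec {F : Finset ℤ} {c : ℝ → ℤ → ℂ} {c' : ℤ → ℂ} {s : Set ℝ} {t : ℝ}
    (h : ∀ k, HasDerivWithinAt (fun s => c s k) (c' k) s t) :
    HasDerivWithinAt (fun s => vec F (c s)) (vec F c') s t := by
  rw [hasDerivWithinAt_iff_hasFDerivWithinAt, hasFDerivWithinAt_piLp]
  intro i
  exact (h i).hasFDerivWithinAt.congr_fderiv (by ext; simp [vec])

/-- A solution of the leap-frog scheme, in Fourier coefficients. -/
structure LeapFrogFlow (N : ℕ) (dt : ℝ) (M : ℕ) (w : ℕ → ℤ → ℂ) : Prop where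
  band : ∀ m, m ≤ M → BandLimited N (w m)
  step : ∀ m, m + 1 < M → ∀ k ∈ box N, w (m + 2) k - w m k = 2 * dt *
    (Complex.I * freq k * w (m + 1) k - Complex.I * (k / 2) * conv N (w (m + 1)) (w (m + 1)) k)

theorem conv_add_left (N : ℕ) (a b d : ℤ → ℂ) (k : ℤ) :
    conv N (fun k => a k + b k) d k = conv N a d k + conv N b d k := by
  simp only [conv, add_mul, Finset.sum_add_distrib]

theorem conv_add_right (N : ℕ) (a b d : ℤ → ℂ) (k : ℤ) :
    conv N a (fun k => b k + d k) k = conv N a b k + conv N a d k := by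
  simp only [conv, mul_add, Finset.sum_add_distrib]

theorem conv_self_add {N : ℕ} {a b : ℤ → ℂ} (ha : BandLimited N a) (hb : BandLimited N b) (k : ℤ) :
    conv N (fun k => a k + b k) (fun k => a k + b k) k =
      conv N a a k + 2 * conv N a b k + conv N b b k := by
  rw [conv_add_left, conv_add_right, conv_add_right, conv_comm hb ha]; ring

/-- With e the error and c the Galerkin solution at t_m, expanding the square about c gives e_{m+2}
− e_m = −2dt·linOp(c, e) − dt·ik(e∗e) − τ, where τ is the defect of the symmetric difference
quotient. This has the form treated by `leapfrog_stability`. -/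
theorem exists_leapfrog_bound {S : ℝ} (hS : 1 ≤ S) {T : ℝ} (hT : 0 < T) (K : ℝ) :
    ∃ C₁ : ℝ, 0 < C₁ ∧ ∃ C : ℝ, ∀ (N : ℕ) (dt : ℝ) (M : ℕ), 1 ≤ N → 0 < dt → (M : ℝ) * dt = T →
      (N : ℝ) ^ 5 * dt ≤ C₁ → ∀ (c : ℝ → ℤ → ℂ) (w : ℕ → ℤ → ℂ), GalerkinFlow N c →
      (∀ t ∈ Icc 0 T, WBound 1 (c t) S ∧ WBound 0 (GalerkinFlow.d1 N c t) S ∧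
        WBound 0 (GalerkinFlow.d3 N c t) S) →
      LeapFrogFlow N dt M w → (∀ k, w 0 k = c 0 k) →
      l2 (box N) (fun k => w 1 k - c dt k) ≤ K * dt ^ 2 →
      ∀ m, m ≤ M → l2 (box N) (fun k => w m k - c (m * dt) k) ≤ C * dt ^ 2 := by
  set B := 2 * Real.exp (8 * (2 + 3 * S + 1) * T) * (K ^ 2 + 2 * T * S ^ 2) with hB
  have hB0 : 0 ≤ B := by positivity
  -- B dt⁴ is the bound of `leapfrog_stability` for ‖e 1‖ ≤ K dt² and g = S dt². The summand 12(1 +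
  -- S) yields the step size conditions, and B yields the smallness ‖e‖ ≤ 1/N².
  refine ⟨1 / (B + 12 * (1 + S)), by positivity, √B, ?_⟩
  intro N dt M hN hdt hM hC c w hc hb hw h0 h1 m hm
  have hN' : (1 : ℝ) ≤ N := by exact_mod_cast hN
  have hN0 : (0 : ℝ) < N := by linarith
  rw [le_div_iff₀ (by positivity)] at hC
  set x := (N : ℝ) ^ 5 * dt with hx
  have hx0 : 0 < x := by positivity
  have hxS : x * (12 * (1 + S)) ≤ 1 := by nlinarith
  have hxB : x * B ≤ 1 := by nlinarith
  have hx1 : x ≤ 1 := by nlinarith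
  have hdtx : dt ≤ x := le_mul_of_one_le_left hdt.le (one_le_pow₀ hN')
  have hN2x : (N : ℝ) ^ 2 * dt ≤ x :=
    mul_le_mul_of_nonneg_right (pow_le_pow_right₀ hN' (by norm_num)) hdt.le
  have hNx : (N : ℝ) * dt ≤ x :=
    mul_le_mul_of_nonneg_right (le_self_pow₀ hN' (by norm_num)) hdt.le
  have htime : ∀ m, m ≤ M → ((m : ℝ) * dt) ∈ Icc 0 T := fun m hm =>
    ⟨by positivity, by rw [← hM]; exact mul_le_mul_of_nonneg_right (Nat.cast_le.2 hm) hdt.le⟩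
  set e : ℕ → ℤ → ℂ := fun m k => w m k - c (m * dt) k with he
  have heb : ∀ m, m ≤ M → BandLimited N (e m) := fun m hm k hk => by
    simp only [he]; rw [hw.band m hm k hk, hc.band _ k hk, sub_zero]
  set τ : ℕ → ℤ → ℂ := fun m k => c (m * dt + dt) k - c (m * dt - dt) k -
    ((2 * dt : ℝ) : ℂ) * GalerkinFlow.d1 N c (m * dt) k with hτ
  set p : ℕ → ℤ → ℂ := fun m => linOp N (c (m * dt)) (e m) with hp
  set f : ℕ → ℤ → ℂ := fun m k => -(dt * Complex.I * k * conv N (e m) (e m) k) - τ m k with hf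
  have hτl : ∀ m, m + 1 < M → l2 (box N) (τ (m + 1)) ≤ S * dt ^ 3 := by
    intro m hm
    have := norm_symm_diff_le (E := EuclideanSpace ℂ (box N)) (c := fun t => vec (box N) (c t))
      (T := T) (C := S) (fun t ht => hasDerivWithinAt_vec (hc.hasDeriv0 ht))
      (fun t ht => hasDerivWithinAt_vec (hc.hasDeriv1 ht))
      (fun t ht => hasDerivWithinAt_vec (hc.hasDeriv2 ht))
      (fun t ht => (hb t ht).2.2.l2_le (box N)) (t := (m + 1 : ℕ) * dt) hdt
      (by have := (htime m (by omega)).1; push_cast; linarith)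
      (by have := (htime (m + 2) (by omega)).2; push_cast at this ⊢; linarith)
    refine le_trans (le_of_eq ?_) this
    rw [l2]
    congr 1
  -- c = 3S: S from the commutator and N · 2N · S dt ≤ 2S from the time lag. b = 2: the factor N ·
  -- 2N‖e‖ of the quadratic term is at most 2 when ‖e‖ ≤ δ = 1/N². g: the defect is at most S dt³.
  have hstep := leapfrog_stability (E := EuclideanSpace ℂ (box N)) (e := fun m => vec (box N) (e m))
    (p := fun m => vec (box N) (p m)) (f := fun m => vec (box N) (f m)) (M := M) (dt := dt) (T := T)
    (c := 3 * S) (b := 2) (g := S * dt ^ 2) (δ := 1 / (N : ℝ) ^ 2) hdt (by positivity) (by norm_num)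
    hM.le ?_ (by positivity) ?_ ?_ ?_ ?_ ?_ ?_ m hm
  · have h2 : ‖vec (box N) (e 1)‖ ^ 2 ≤ (K * dt ^ 2) ^ 2 := by
      refine pow_le_pow_left₀ (norm_nonneg _) (le_trans (le_of_eq ?_) h1) 2
      simp only [he, l2, Nat.cast_one, one_mul]
    have h3 : l2 (box N) (e m) ^ 2 ≤ B * dt ^ 4 := by
      refine hstep.trans ?_
      calc _ ≤ 2 * Real.exp (8 * (2 + 3 * S + 1) * T) * ((K * dt ^ 2) ^ 2 + 2 * T * (S * dt ^ 2) ^ 2) := by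
            gcongr
        _ = B * dt ^ 4 := by rw [hB]; ring
    refine (sq_le_sq₀ (l2_nonneg _ _) (by positivity)).1 (h3.trans (le_of_eq ?_))
    rw [mul_pow, Real.sq_sqrt hB0]; ring
  · nlinarith
  · ext k; simp [vec, he, h0]
  · intro m hm
    rw [← vec_smul, ← vec_sub, ← vec_sub]
    refine vec_congr fun k hk => ?_
    have hcb := hc.band (((m + 1 : ℕ) : ℝ) * dt)
    have hq := conv_self_add hcb (heb (m + 1) (by omega)) k
    have hsum : (fun k => c (((m + 1 : ℕ) : ℝ) * dt) k + e (m + 1) k) = w (m + 1) := by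
      funext k; simp only [he]; ring
    rw [hsum] at hq
    have hws := hw.step m hm k hk
    have t1 : ((m + 1 : ℕ) : ℝ) * dt + dt = ((m + 2 : ℕ) : ℝ) * dt := by push_cast; ring
    have t2 : ((m + 1 : ℕ) : ℝ) * dt - dt = (m : ℝ) * dt := by push_cast; ring
    have hd : GalerkinFlow.d1 N c (((m + 1 : ℕ) : ℝ) * dt) k = Complex.I * freq k *
        c (((m + 1 : ℕ) : ℝ) * dt) k - Complex.I * (k / 2) *
          conv N (c (((m + 1 : ℕ) : ℝ) * dt)) (c (((m + 1 : ℕ) : ℝ) * dt)) k := if_pos hk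
    have hek : w (m + 1) k = c (((m + 1 : ℕ) : ℝ) * dt) k + e (m + 1) k := by simp only [he]; ring
    rw [hq, hek] at hws
    simp only [hf, hτ, hp, linOp, t1, t2, hd]
    have : e (m + 2) k - e m k = (w (m + 2) k - w m k) -
      (c (((m + 2 : ℕ) : ℝ) * dt) k - c ((m : ℝ) * dt) k) := by simp only [he]; ring
    rw [this, hws]; push_cast; ring
  · intro m hm
    rw [re_inner_vec, re_inner_vec]
    have hbm := hb _ (htime m (by omega))
    have hbm1 := hb _ (htime (m + 1) (by omega))
    refine abs_re_linOp_le (hc.herm _ (htime m (by omega)).1) ?_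
    have hdiff : l2 (box N) (fun k => c (((m + 1 : ℕ) : ℝ) * dt) k - c ((m : ℝ) * dt) k) ≤ S * dt := by
      have hle : (m : ℝ) * dt ≤ ((m + 1 : ℕ) : ℝ) * dt := by push_cast; nlinarith
      have := norm_image_sub_le_of_norm_deriv_le_segment' (f := fun t => vec (box N) (c t))
        (f' := fun t => vec (box N) (GalerkinFlow.d1 N c t)) (a := m * dt) (b := ((m + 1 : ℕ) : ℝ) * dt)
        (C := S)
        (fun t ht => (hasDerivWithinAt_vec (hc.hasDeriv0 ((htime m (by omega)).1.trans ht.1))).mono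
          fun s hs => (htime m (by omega)).1.trans hs.1)
        (fun t ht => (hb t ⟨(htime m (by omega)).1.trans ht.1,
          ht.2.le.trans (htime (m + 1) (by omega)).2⟩).2.1.l2_le (box N)) _ (right_mem_Icc.2 hle)
      rw [l2, vec_sub]
      refine this.trans (le_of_eq ?_)
      push_cast; ring
    have hs := sumsLE_norm_of_band hN (a := fun k => c (((m + 1 : ℕ) : ℝ) * dt) k - c ((m : ℝ) * dt) k)
      (fun k hk => by simp [hc.band _ k hk])
    refine SumsLE.mono ((hbm1.1.sumsLE_abs_mul le_rfl).add (hs.const_mul hN0.le)) (fun n => le_rfl) ?_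
    have h5 := mul_le_mul_of_nonneg_left hdiff (by positivity : 0 ≤ (N : ℝ) * (2 * N))
    have h6 := mul_le_mul_of_nonneg_right (hN2x.trans hx1) (by positivity : 0 ≤ 2 * S)
    nlinarith
  · intro m hm
    have h5 := l2_linOp_le hN (d := e m) ((hb _ (htime m hm.le)).1.sumsLE_norm)
    have h6 := mul_le_mul_of_nonneg_left h5 hdt.le
    have h7 : x * (2 + S) ≤ 1 / 4 := by nlinarith
    have h8 := mul_le_mul_of_nonneg_right h7 (l2_nonneg (box N) (e m))
    change dt * l2 (box N) (p m) ≤ 1 / 4 * l2 (box N) (e m)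
    rw [hx] at h8
    linarith
  · intro m hm hsm
    change l2 (box N) (f (m + 1)) ≤ dt * (2 * l2 (box N) (e (m + 1)) + S * dt ^ 2)
    change l2 (box N) (e (m + 1)) ≤ 1 / (N : ℝ) ^ 2 at hsm
    have q1 : l2 (box N) (fun k => -(dt * Complex.I * k * conv N (e (m + 1)) (e (m + 1)) k)) ≤
        dt * N * l2 (box N) (conv N (e (m + 1)) (e (m + 1))) :=
      l2_le_of_le subset_rfl (by positivity) fun k hk => by
        rw [norm_neg, norm_mul, norm_mul, norm_mul, Complex.norm_I, mul_one, Complex.norm_intCast,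
          Complex.norm_real, Real.norm_of_nonneg hdt.le]
        have := abs_cast_le_of_mem_box hk
        gcongr
    have q2 := l2_conv_le (N := N) (b := e (m + 1)) (sumsLE_norm_of_band hN (heb (m + 1) (by omega))) (box N)
    have q3 := hτl m hm
    refine (l2_sub_le _ _ _).trans ((add_le_add (q1.trans (mul_le_mul_of_nonneg_left q2
      (by positivity))) q3).trans ?_)
    rw [le_div_iff₀ (by positivity)] at hsm
    have q4 := mul_le_mul_of_nonneg_right hsm (mul_nonneg hdt.le (l2_nonneg (box N) (e (m + 1))))
    nlinarith
  · have h2 : ‖vec (box N) (e 1)‖ ^ 2 ≤ (K * dt ^ 2) ^ 2 := by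
      refine pow_le_pow_left₀ (norm_nonneg _) (le_trans (le_of_eq ?_) h1) 2
      simp only [he, l2, Nat.cast_one, one_mul]
    calc _ ≤ 2 * Real.exp (8 * (2 + 3 * S + 1) * T) * ((K * dt ^ 2) ^ 2 + 2 * T * (S * dt ^ 2) ^ 2) := by
          gcongr
      _ = B * dt ^ 4 := by rw [hB]; ring
      _ ≤ (1 / (N : ℝ) ^ 2) ^ 2 := by
        rw [one_div, inv_pow, ← one_div, le_div_iff₀ (by positivity)]
        have r1 : (N * dt) ^ 4 ≤ x ^ 4 := pow_le_pow_left₀ (by positivity) hNx 4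
        have r2 : x ^ 4 ≤ x := pow_le_of_le_one hx0.le hx1 (by norm_num)
        calc B * dt ^ 4 * ((N : ℝ) ^ 2) ^ 2 = B * (N * dt) ^ 4 := by ring
          _ ≤ B * x := mul_le_mul_of_nonneg_left (r1.trans r2) hB0
          _ ≤ 1 := by linarith

/-! ### Splitting into low and high frequencies; uniqueness for the Kawahara equation -/

/-- The convolution of two sequences. -/
def tconv (a b : ℤ → ℂ) (k : ℤ) : ℂ := ∑' j, a (k - j) * b j

/-- The low frequencies of a sequence. -/
def low (N : ℕ) (u : ℤ → ℂ) (k : ℤ) : ℂ := if k ∈ box N then u k else 0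

/-- The high frequencies of a sequence. -/
def high (N : ℕ) (u : ℤ → ℂ) (k : ℤ) : ℂ := if k ∈ box N then 0 else u k

theorem low_bandLimited (N : ℕ) (u : ℤ → ℂ) : BandLimited N (low N u) := fun _ hk => if_neg hk

theorem low_of_mem {N : ℕ} (u : ℤ → ℂ) {k : ℤ} (hk : k ∈ box N) : low N u k = u k := if_pos hk

theorem low_add_high (N : ℕ) (u : ℤ → ℂ) (k : ℤ) : low N u k + high N u k = u k := by
  unfold low high; split_ifs <;> simp

theorem norm_low_le (N : ℕ) (u : ℤ → ℂ) (k : ℤ) : ‖low N u k‖ ≤ ‖u k‖ := by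
  unfold low; split_ifs <;> simp

theorem norm_high_le (N : ℕ) (u : ℤ → ℂ) (k : ℤ) : ‖high N u k‖ ≤ ‖u k‖ := by
  unfold high; split_ifs <;> simp

theorem Hermitian.low {u : ℤ → ℂ} (h : Hermitian u) (N : ℕ) : Hermitian (Kawahara.low N u) := fun k => by
  unfold Kawahara.low
  simp only [neg_mem_box, h k]
  split_ifs <;> simp

theorem WBound.low {q : ℕ} {u : ℤ → ℂ} {A : ℝ} (h : WBound q u A) (N : ℕ) :
    WBound q (Kawahara.low N u) A :=
  SumsLE.mono h (fun n => mul_le_mul_of_nonneg_left (norm_low_le N u n) (by positivity)) le_rfl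

theorem sumsLE_high {N : ℕ} {u : ℤ → ℂ} {A : ℝ} (h : SumsLE (fun n => ‖u n‖) A) :
    SumsLE (fun n => ‖high N u n‖) A :=
  SumsLE.mono h (norm_high_le N u) le_rfl

theorem natCast_lt_abs {N : ℕ} {k : ℤ} (hk : k ∉ box N) : (N : ℝ) + 1 ≤ |(k : ℝ)| := by
  rw [mem_box, not_le] at hk
  exact_mod_cast hk

theorem sumsLE_high_of_wBound {N : ℕ} (hN : 1 ≤ N) {u : ℤ → ℂ} {A : ℝ} (h : WBound 15 u A) :
    SumsLE (fun n => ‖high N u n‖) (A / (N : ℝ) ^ 2) := by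
  have hN' : (1 : ℝ) ≤ N := by exact_mod_cast hN
  refine SumsLE.mono (SumsLE.const_mul (h.mono (by norm_num : 2 ≤ 15))
    (by positivity : 0 ≤ 1 / (N : ℝ) ^ 2)) (fun n => ?_) (le_of_eq (by ring))
  unfold high
  split_ifs with hn
  · rw [norm_zero]; positivity
  · have h1 := natCast_lt_abs hn
    have h2 : (N : ℝ) ^ 2 ≤ (1 + |(n : ℝ)|) ^ 2 := pow_le_pow_left₀ (by positivity) (by linarith) 2
    rw [one_div, ← mul_assoc, inv_mul_eq_div]
    exact le_mul_of_one_le_left (norm_nonneg _) ((one_le_div (by positivity)).2 h2)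

/-- Outside the box |n| ≥ M + 1. Keeping M + 1 instead of M makes the bound usable at M = N/2 with
integer division, including M = 0. -/
theorem l2_high_le {M r : ℕ} {u : ℤ → ℂ} {R : ℝ} (hR : 0 ≤ R)
    (h : SumsLE (fun n => (n : ℝ) ^ (2 * r) * ‖u n‖ ^ 2) (R ^ 2)) (F : Finset ℤ) :
    l2 F (high M u) ≤ R / ((M : ℝ) + 1) ^ r := by
  refine l2_le_of_sq (by positivity) ?_
  rw [div_pow, le_div_iff₀ (by positivity), Finset.sum_mul]
  refine (Finset.sum_le_sum fun n _ => ?_).trans (h F)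
  unfold high
  split_ifs with hn
  · rw [norm_zero]; simp only [ne_eq, OfNat.ofNat_ne_zero, not_false_eq_true, zero_pow, zero_mul]
    rw [pow_mul]; positivity
  · rw [mul_comm, pow_mul (n : ℝ), ← sq_abs (n : ℝ), ← pow_mul, ← pow_mul, mul_comm r 2]
    exact mul_le_mul_of_nonneg_right (pow_le_pow_left₀ (by positivity) (natCast_lt_abs hn) _)
      (by positivity)

theorem summable_tconv {a b : ℤ → ℂ} {A B : ℝ} (ha : SumsLE (fun n => ‖a n‖) A)
    (hb : SumsLE (fun n => ‖b n‖) B) (k : ℤ) : Summable fun j => a (k - j) * b j := by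
  refine Summable.of_norm_bounded (g := fun j => A * ‖b j‖)
    ((hb.summable fun _ => norm_nonneg _).mul_left A) fun j => ?_
  rw [norm_mul]
  exact mul_le_mul_of_nonneg_right (ha.le _) (norm_nonneg _)

theorem l2_tconv_le {a b : ℤ → ℂ} {A B B' : ℝ} (ha : SumsLE (fun n => ‖a n‖) A)
    (hb : SumsLE (fun n => ‖b n‖) B) (hb' : ∀ G, l2 G b ≤ B') (F : Finset ℤ) :
    l2 F (tconv a b) ≤ A * B' := by
  have ht : Tendsto (fun G : Finset ℤ => l2 F (fun k => ∑ j ∈ G, a (k - j) * b j)) atTop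
      (𝓝 (l2 F (tconv a b))) := by
    simp only [l2_eq_sqrt]
    refine (Real.continuous_sqrt.tendsto _).comp (tendsto_finsetSum _ fun k _ => ?_)
    exact ((summable_tconv ha hb k).hasSum.norm).pow 2
  refine le_of_tendsto' ht fun G => ?_
  exact (l2_kernel_le (fun n => norm_nonneg (a n)) ha (fun _ _ _ _ => le_rfl) b).trans
    (mul_le_mul_of_nonneg_left (hb' G) ha.nonneg)

theorem tconv_self_eq {u : ℤ → ℂ} {A : ℝ} (hu : SumsLE (fun n => ‖u n‖) A) (N : ℕ) (k : ℤ) :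
    tconv u u k = conv N (low N u) (low N u) k + 2 * tconv (low N u) (high N u) k +
      tconv (high N u) (high N u) k := by
  have hl : SumsLE (fun n => ‖low N u n‖) A := SumsLE.mono hu (norm_low_le N u) le_rfl
  have hh : SumsLE (fun n => ‖high N u n‖) A := sumsLE_high hu
  have e1 : conv N (low N u) (low N u) k = ∑' j, low N u (k - j) * low N u j :=
    (tsum_eq_sum fun j hj => by rw [low_bandLimited N u j hj, mul_zero]).symm
  have e2 : tconv (low N u) (high N u) k = ∑' j, high N u (k - j) * low N u j := by
    rw [tconv, ← (Equiv.subLeft k).tsum_eq]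
    simp [mul_comm]
  have h1 := (summable_tconv hl hl k).hasSum
  have h2 := (summable_tconv hl hh k).hasSum
  have h3 := (summable_tconv hh hl k).hasSum
  have h4 := (summable_tconv hh hh k).hasSum
  have h5 := (((h1.add h2).add h3).add h4).tsum_eq
  rw [two_mul]
  nth_rewrite 2 [e2]
  rw [e1]
  unfold tconv
  rw [← add_assoc, ← h5]
  refine tsum_congr fun j => ?_
  rw [← low_add_high N u (k - j), ← low_add_high N u j]; ring

/-- If |k| ≤ N and |k − j| ≤ N then |j| ≤ 2N. -/
theorem tconv_low_eq {N : ℕ} (u d : ℤ → ℂ) {k : ℤ} (hk : k ∈ box N) :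
    tconv (low N u) d k = conv (2 * N) (low N u) d k := by
  refine tsum_eq_sum fun j hj => ?_
  have : k - j ∉ box N := fun h => hj (by
    rw [mem_box] at *
    push_cast
    have := abs_sub_abs_le_abs_sub j k
    rw [abs_sub_comm] at this
    omega)
  rw [low_bandLimited N u _ this, zero_mul]

/-- Energy estimate for the linearised Galerkin equation. -/
theorem energy_estimate {N : ℕ} {θ a G : ℝ → ℤ → ℂ} {T D ε : ℝ}
    (hcont : ∀ k ∈ box N, ContinuousOn (fun t => θ t k) (Icc 0 T))
    (hderiv : ∀ t ∈ Ioo 0 T, ∀ k ∈ box N,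
      HasDerivAt (fun s => θ s k) (-linOp N (a t) (θ t) k + G t k) t)
    (ha : ∀ t ∈ Icc 0 T, Hermitian (a t))
    (hD0 : 0 ≤ D) (hD : ∀ t ∈ Icc 0 T, SumsLE (fun n => |(n : ℝ)| * ‖a t n‖) D)
    (hG : ∀ t ∈ Icc 0 T, l2 (box N) (G t) ≤ ε) {t : ℝ} (ht : t ∈ Icc 0 T) :
    l2 (box N) (θ t) ^ 2 ≤ Real.exp ((D + 1) * t) * (l2 (box N) (θ 0) ^ 2 + ε ^ 2 * t) := by
  refine gronwall (f := fun t => l2 (box N) (θ t) ^ 2) (T := T) (by positivity) (sq_nonneg ε) ?_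
    (fun t ht => (hasDerivAt_sum_norm_sq (F := box N) (fun _ => 1) (hderiv t ht)).congr_of_eventuallyEq
      (Eventually.of_forall fun s => by simp [l2_sq])) (fun t ht => ?_) ht
  · simp only [l2_sq]
    exact continuousOn_finsetSum _ fun k hk => (hcont k hk).norm.pow 2
  · have ht' := Ioo_subset_Icc_self ht
    -- With both arguments equal to θ the skewness estimate bounds twice the real part of the
    -- quadratic form, with no time-lag term.
    have h1 := abs_re_linOp_le (a := θ t) (b := θ t) (ha t ht') (N := N) (D := D) (c := a t)
      (by simpa using hD t ht')
    have h2 := norm_sum_mul_conj_le (box N) (θ t) (G t)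
    have h3 : ∑ k ∈ box N, ((1 : ℝ) : ℂ) * ((-linOp N (a t) (θ t) k + G t k) * (starRingEnd ℂ) (θ t k)) =
        -∑ k ∈ box N, linOp N (a t) (θ t) k * (starRingEnd ℂ) (θ t k) +
        ∑ k ∈ box N, G t k * (starRingEnd ℂ) (θ t k) := by
      rw [← Finset.sum_neg_distrib, ← Finset.sum_add_distrib]
      exact Finset.sum_congr rfl fun k _ => by push_cast; ring
    rw [h3, Complex.add_re, Complex.neg_re]
    have h4 := Complex.re_le_norm (∑ k ∈ box N, G t k * (starRingEnd ℂ) (θ t k))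
    have h5 := mul_le_mul_of_nonneg_left (hG t ht') (l2_nonneg (box N) (θ t))
    have h6 := (abs_le.1 h1).1
    nlinarith [sq_nonneg (l2 (box N) (θ t) - ε)]

/-- A solution of the Kawahara equation on `[0, T]`, in Fourier coefficients. -/
structure KawaharaFlow (T : ℝ) (u : ℝ → ℤ → ℂ) : Prop where
  herm : ∀ t ∈ Icc 0 T, Hermitian (u t)
  cont : ∀ k, ContinuousOn (fun t => u t k) (Icc 0 T)
  deriv : ∀ t ∈ Ioo 0 T, ∀ k, HasDerivAt (fun s => u s k)
    (Complex.I * freq k * u t k - Complex.I * (k / 2) * tconv (u t) (u t) k) t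

theorem conv_sub_conv {N : ℕ} {v c : ℤ → ℂ} (hv : BandLimited N v) (hc : BandLimited N c) (k : ℤ) :
    conv N v v k - conv N c c k = conv N (fun k => v k + c k) (fun k => v k - c k) k := by
  rw [conv_add_left]
  have h : ∀ a, conv N a (fun k => v k - c k) k = conv N a v k - conv N a c k := fun a => by
    simp only [conv, mul_sub, Finset.sum_sub_distrib]
  rw [h, h, conv_comm hc hv]; ring

/-- Combined with `conv_sub_conv` this puts the difference of two quadratic equations exactly in
linearised form, with the mean of the two solutions as coefficient. -/
theorem neg_linOp_half (N : ℕ) (a d : ℤ → ℂ) (k : ℤ) :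
    -linOp N (fun k => (1 / 2 : ℝ) * a k) d k =
      Complex.I * freq k * d k - Complex.I * (k / 2) * conv N a d k := by
  simp only [linOp, conv, Finset.mul_sum]
  rw [neg_add, neg_neg, sub_eq_add_neg, ← Finset.sum_neg_distrib, ← Finset.sum_neg_distrib]
  congr 1
  exact Finset.sum_congr rfl fun j _ => by push_cast; ring

theorem Hermitian.half_add {a b : ℤ → ℂ} (ha : Hermitian a) (hb : Hermitian b) :
    Hermitian fun k => (1 / 2 : ℝ) * (a k + b k) := fun k => by
  simp only [ha k, hb k, map_mul, map_add, Complex.conj_ofReal]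

theorem sumsLE_half_add {a b : ℤ → ℂ} {A B : ℝ} (ha : WBound 15 a A) (hb : WBound 15 b B) :
    SumsLE (fun n => |(n : ℝ)| * ‖((1 / 2 : ℝ) : ℂ) * (a n + b n)‖) (A + B) := by
  refine SumsLE.mono ((ha.add hb).sumsLE_abs_mul (by norm_num)) (fun n => ?_) le_rfl
  refine mul_le_mul_of_nonneg_left ?_ (abs_nonneg _)
  rw [norm_mul, Complex.norm_real]
  exact mul_le_of_le_one_left (norm_nonneg _) (by norm_num)

theorem l2_freq_mul_le {N : ℕ} (F : Finset ℤ) (hF : F ⊆ box N) (d : ℤ → ℂ) :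
    l2 F (fun k => Complex.I * (k / 2) * d k) ≤ N / 2 * l2 F d :=
  l2_le_of_le subset_rfl (by positivity) fun k hk => by
    rw [norm_mul, norm_mul, Complex.norm_I, one_mul, norm_div, Complex.norm_intCast, Complex.norm_ofNat]
    have := abs_cast_le_of_mem_box (hF hk)
    gcongr

/-- Solutions of the Kawahara equation are determined by their initial values. -/
theorem KawaharaFlow.unique {T A : ℝ} {u v : ℝ → ℤ → ℂ} (hu : KawaharaFlow T u)
    (hv : KawaharaFlow T v) (hu' : ∀ t ∈ Icc 0 T, WBound 15 (u t) A)
    (hv' : ∀ t ∈ Icc 0 T, WBound 15 (v t) A) (h0 : ∀ k, u 0 k = v 0 k) {t : ℝ} (ht : t ∈ Icc 0 T) (k : ℤ) :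
    u t k = v t k := by
  have hA0 : 0 ≤ A := SumsLE.nonneg (hu' t ht)
  -- The truncated difference solves a linear equation whose forcing involves the high frequencies:
  -- their ℓ¹ norm O(N⁻²) beats the derivative factor N/2, so N → ∞ gives equality.
  have hbd : ∀ N : ℕ, 1 ≤ N → k ∈ box N →
      ‖u t k - v t k‖ ^ 2 ≤ Real.exp ((A + A + 1) * t) * (((3 * A ^ 2) / N) ^ 2 * t) := by
    intro N hN hk
    have hN' : (1 : ℝ) ≤ N := by exact_mod_cast hN
    set Gu : (ℝ → ℤ → ℂ) → ℝ → ℤ → ℂ := fun u t k => Complex.I * (k / 2) *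
      (2 * tconv (low N (u t)) (high N (u t)) k + tconv (high N (u t)) (high N (u t)) k) with hGu
    have hG : ∀ u : ℝ → ℤ → ℂ, (∀ t ∈ Icc 0 T, WBound 15 (u t) A) → ∀ t ∈ Icc 0 T,
        l2 (box N) (Gu u t) ≤ (3 * A ^ 2) / N / 2 := by
      intro u hu' t ht
      have hs := sumsLE_high_of_wBound hN (hu' t ht)
      have hl : ∀ F, l2 F (high N (u t)) ≤ A / (N : ℝ) ^ 2 := fun F => (l2_le_sum F _).trans (hs F)
      have h1 := l2_tconv_le ((hu' t ht).low N).sumsLE_norm hs hl (box N)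
      have h2 := l2_tconv_le (sumsLE_high (N := N) (hu' t ht).sumsLE_norm) hs hl (box N)
      have h3 := l2_smul (box N) 2 (tconv (low N (u t)) (high N (u t)))
      rw [Complex.norm_ofNat] at h3
      refine (l2_freq_mul_le _ subset_rfl _).trans ((mul_le_mul_of_nonneg_left
        ((l2_add_le _ _ _).trans (add_le_add (h3.le.trans (mul_le_mul_of_nonneg_left h1 (by norm_num)))
          h2)) (by positivity)).trans (le_of_eq ?_))
      field_simp; ring
    have h1 := energy_estimate (N := N) (T := T) (θ := fun t k => low N (u t) k - low N (v t) k)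
      (a := fun t k => (1 / 2 : ℝ) * (low N (u t) k + low N (v t) k))
      (G := fun t k => Gu v t k - Gu u t k) (D := A + A) (ε := (3 * A ^ 2) / N) ?_ ?_
      (fun t ht => ((hu.herm t ht).low N).half_add ((hv.herm t ht).low N)) (by positivity)
      (fun t ht => sumsLE_half_add ((hu' t ht).low N) ((hv' t ht).low N)) ?_ ht
    · have h00 : l2 (box N) (fun k => low N (u 0) k - low N (v 0) k) ^ 2 = 0 := by
        rw [l2_sq]; refine Finset.sum_eq_zero fun k _ => ?_
        unfold low; simp [h0]
      rw [h00, zero_add] at h1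
      refine le_trans ?_ h1
      rw [l2_sq]
      refine le_trans (le_of_eq ?_) (Finset.single_le_sum (fun _ _ => by positivity) hk)
      rw [low_of_mem _ hk, low_of_mem _ hk]
    · intro k hk
      simp only [low, if_pos hk]
      exact (hu.cont k).sub (hv.cont k)
    · intro t ht k hk
      have ht' := Ioo_subset_Icc_self ht
      have hd := (hu.deriv t ht k).sub (hv.deriv t ht k)
      have e : (fun s => low N (u s) k - low N (v s) k) = fun s => u s k - v s k := by
        simp only [low, if_pos hk]
      rw [e]
      refine hd.congr_deriv ?_
      rw [neg_linOp_half, tconv_self_eq (hu' t ht').sumsLE_norm N,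
        tconv_self_eq (hv' t ht').sumsLE_norm N, ← conv_sub_conv (low_bandLimited N _) (low_bandLimited N _),
        low_of_mem _ hk, low_of_mem _ hk]
      simp only [hGu]; ring
    · intro t ht
      refine (l2_sub_le _ _ _).trans ((add_le_add (hG v hv' t ht) (hG u hu' t ht)).trans (le_of_eq ?_))
      ring
  have hlim : Tendsto (fun N : ℕ => Real.exp ((A + A + 1) * t) * (((3 * A ^ 2) / (N : ℝ)) ^ 2 * t))
      atTop (𝓝 0) := by
    have := (((tendsto_const_div_atTop_nhds_zero_nat (3 * A ^ 2)).pow 2).mul_const t).const_mul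
      (Real.exp ((A + A + 1) * t))
    simpa using this
  have h1 : ‖u t k - v t k‖ ^ 2 ≤ 0 := by
    refine ge_of_tendsto hlim ?_
    filter_upwards [eventually_ge_atTop (max 1 k.natAbs)] with N hN
    refine hbd N (le_of_max_le_left hN) (mem_box.2 ?_)
    rw [Int.abs_eq_natAbs]
    exact_mod_cast le_of_max_le_right hN
  have h2 : ‖u t k - v t k‖ = 0 := by nlinarith [norm_nonneg (u t k - v t k)]
  exact sub_eq_zero.1 (norm_eq_zero.1 h2)

/-! ### Normal form transformation and the spatial error of order N⁻ʳ -/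

/-- The symbol of the normal form transformation. -/
def nfSymbol (m j : ℤ) : ℝ :=
  -1 / (m * j * (3 + 5 * ((m : ℝ) ^ 2 + m * j + (j : ℝ) ^ 2)))

/-- The resonance identity ω(m+j) − ω(m) − ω(j) = mj(m+j)(3 + 5(m² + mj + j²)). The quadratic factor
is at least 3, so only m = 0 or j = 0 obstruct the division. -/
theorem nfSymbol_mul {m j : ℤ} (hm : m ≠ 0) (hj : j ≠ 0) :
    nfSymbol m j * (freq j + freq m) = nfSymbol m j * freq (m + j) + (m + j : ℤ) := by
  have hm' : (m : ℝ) ≠ 0 := by exact_mod_cast hm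
  have hj' : (j : ℝ) ≠ 0 := by exact_mod_cast hj
  have hq : (3 + 5 * ((m : ℝ) ^ 2 + m * j + (j : ℝ) ^ 2)) ≠ 0 := by
    nlinarith [sq_nonneg ((m : ℝ) + j), sq_nonneg (m : ℝ), sq_nonneg (j : ℝ)]
  have h : nfSymbol m j * (m * j * (3 + 5 * ((m : ℝ) ^ 2 + m * j + (j : ℝ) ^ 2))) = -1 :=
    div_mul_cancel₀ _ (mul_ne_zero (mul_ne_zero hm' hj') hq)
  simp only [freq]
  push_cast
  linear_combination (-((m : ℝ) + j)) * h

/-- One factor N comes from m and two from the quadratic form, which dominates m². At j = 0 division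
by zero makes the symbol 0. -/
theorem abs_nfSymbol_le {N : ℕ} (hN : 1 ≤ N) {m : ℤ} (hm : m ∉ box N) (j : ℤ) :
    |nfSymbol m j| ≤ 1 / (N : ℝ) ^ 3 := by
  have hN' : (1 : ℝ) ≤ N := by exact_mod_cast hN
  rcases eq_or_ne j 0 with rfl | hj
  · simp [nfSymbol]
  have h1 := natCast_lt_abs hm
  have h2 : (1 : ℝ) ≤ |(j : ℝ)| := by exact_mod_cast Int.one_le_abs hj
  have h3 : (N : ℝ) ^ 2 ≤ 3 + 5 * ((m : ℝ) ^ 2 + m * j + (j : ℝ) ^ 2) := by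
    have : (N : ℝ) ^ 2 ≤ (m : ℝ) ^ 2 := by
      rw [← sq_abs (m : ℝ)]; exact pow_le_pow_left₀ (by positivity) (by linarith) 2
    nlinarith [sq_nonneg ((m : ℝ) + 2 * j)]
  have h0 : 0 < 3 + 5 * ((m : ℝ) ^ 2 + m * j + (j : ℝ) ^ 2) := lt_of_lt_of_le (by positivity) h3
  rw [nfSymbol, abs_div, abs_neg, abs_one, abs_mul, abs_mul, abs_of_pos h0]
  refine one_div_le_one_div_of_le (by positivity) ?_
  calc (N : ℝ) ^ 3 = N * 1 * (N : ℝ) ^ 2 := by ring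
    _ ≤ _ := by
      refine mul_le_mul (mul_le_mul (by linarith) h2 zero_le_one (abs_nonneg _)) h3 (by positivity)
        (by positivity)

/-- The frequencies `N < |m| ≤ 2N`. -/
def shell (N : ℕ) : Finset ℤ := box (2 * N) \ box N

theorem not_mem_box_of_mem_shell {N : ℕ} {m : ℤ} (hm : m ∈ shell N) : m ∉ box N :=
  (Finset.mem_sdiff.1 hm).2

/-- The bilinear normal form with low-frequency factor `a` and high-frequency factor `b`. -/
def normalForm (N : ℕ) (a b : ℤ → ℂ) (k : ℤ) : ℂ :=
  ∑ m ∈ shell N, (nfSymbol m (k - m) * a (k - m)) * b m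

theorem l2_normalForm_le {N : ℕ} (hN : 1 ≤ N) {a b : ℤ → ℂ} {A : ℝ} (ha : SumsLE (fun n => ‖a n‖) A) :
    l2 (box N) (normalForm N a b) ≤ A / (N : ℝ) ^ 3 * l2 (shell N) b := by
  refine l2_kernel_le (a := fun n => 1 / (N : ℝ) ^ 3 * ‖a n‖) (fun n => by positivity)
    (SumsLE.mono (ha.const_mul (by positivity : 0 ≤ 1 / (N : ℝ) ^ 3)) (fun _ => le_rfl)
      (le_of_eq (by ring))) (fun k _ m hm => ?_) b
  rw [norm_mul, Complex.norm_real]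
  exact mul_le_mul_of_nonneg_right (abs_nfSymbol_le hN (not_mem_box_of_mem_shell hm) _) (norm_nonneg _)

theorem conv_low_high_eq {N : ℕ} (a u : ℤ → ℂ) (k : ℤ) :
    conv (2 * N) a (high N u) k = ∑ m ∈ shell N, a (k - m) * u m := by
  rw [conv]
  have hsub : shell N ⊆ box (2 * N) := Finset.sdiff_subset
  rw [← Finset.sum_subset hsub (f := fun j => a (k - j) * high N u j)]
  · exact Finset.sum_congr rfl fun m hm => by rw [high, if_neg (not_mem_box_of_mem_shell hm)]
  · intro m hm hm'
    have : m ∈ box N := by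
      by_contra h; exact hm' (Finset.mem_sdiff.2 ⟨hm, h⟩)
    rw [high, if_pos this, mul_zero]

theorem hasDerivAt_low {N : ℕ} {u : ℝ → ℤ → ℂ} {u' : ℤ → ℂ} {t : ℝ}
    (h : ∀ k, HasDerivAt (fun s => u s k) (u' k) t) (k : ℤ) :
    HasDerivAt (fun s => low N (u s) k) (low N u' k) t := by
  by_cases hk : k ∈ box N
  · simp only [low, if_pos hk]; exact h k
  · simp only [low, if_neg hk]; exact hasDerivAt_const _ _

theorem hasDerivAt_normalForm {N : ℕ} {a b : ℝ → ℤ → ℂ} {a' b' : ℤ → ℂ} {t : ℝ}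
    (ha : ∀ k, HasDerivAt (fun s => a s k) (a' k) t) (hb : ∀ k, HasDerivAt (fun s => b s k) (b' k) t)
    (k : ℤ) : HasDerivAt (fun s => normalForm N (a s) (b s) k)
      (normalForm N a' (b t) k + normalForm N (a t) b' k) t := by
  simp only [normalForm, ← Finset.sum_add_distrib]
  exact HasDerivAt.fun_sum fun m _ => ((ha (k - m)).const_mul _).mul (hb m)

/-- The normal form removes the interaction of low and high frequencies. -/
theorem normalForm_eq {N : ℕ} (u n : ℤ → ℂ) {k : ℤ} (hk : k ∈ box N) :
    normalForm N (low N fun k => Complex.I * freq k * u k - n k) u k +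
      normalForm N (low N u) (fun k => Complex.I * freq k * u k - n k) k =
    Complex.I * freq k * normalForm N (low N u) u k +
      Complex.I * k * conv (2 * N) (low N u) (high N u) k -
      (normalForm N (low N n) u k + normalForm N (low N u) n k) := by
  rw [conv_low_high_eq]
  simp only [normalForm, ← Finset.sum_add_distrib, Finset.mul_sum, ← Finset.sum_sub_distrib]
  refine Finset.sum_congr rfl fun m hm => ?_
  have hmN := not_mem_box_of_mem_shell hm
  -- The resonances m = 0 and m = k do not occur, since m lies outside the box and both 0 and k
  -- inside.
  have hm0 : m ≠ 0 := fun h => hmN (by rw [h, mem_box]; simp)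
  have hkm : k - m ≠ 0 := fun h => hmN (by rwa [← sub_eq_zero.1 h])
  have h := nfSymbol_mul hm0 hkm
  rw [add_sub_cancel] at h
  have h' : (nfSymbol m (k - m) : ℂ) * (freq (k - m) + freq m) = nfSymbol m (k - m) * freq k + k := by
    exact_mod_cast congrArg (fun x : ℝ => (x : ℂ)) h
  have hlow : low N (fun k => Complex.I * freq k * u k - n k) (k - m) =
      Complex.I * freq (k - m) * low N u (k - m) - low N n (k - m) := by
    unfold low; split_ifs <;> simp
  rw [hlow]
  linear_combination (Complex.I * low N u (k - m) * u m) * h'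

/-- Two frequencies of size at most N/2 add up to at most N. Hence on the shell the square u∗u
always has a factor of frequency above N/2, which makes it of size N⁻ʳ there. -/
theorem conv_half_low_eq_zero {N : ℕ} (u : ℤ → ℂ) {k : ℤ} (hk : k ∉ box N) :
    conv (N / 2) (low (N / 2) u) (low (N / 2) u) k = 0 := by
  refine Finset.sum_eq_zero fun j hj => ?_
  have : k - j ∉ box (N / 2) := fun h => hk (by
    rw [mem_box] at *
    have := abs_sub_abs_le_abs_sub k j
    omega)
  rw [low_bandLimited _ u _ this, zero_mul]

/-- Without correction the forcing ik(low ∗ high) is only O(N^{1−r}). The corrected error θ = u − c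
+ β, with β the normal form, satisfies the linearised Galerkin equation with a forcing of order N⁻ʳ;
β itself is of that order too. -/
theorem exists_galerkin_error (r : ℕ) {A R S T : ℝ} (hA : 0 ≤ A) (hR : 0 ≤ R) (hS : 0 ≤ S) :
    ∃ C, ∀ N : ℕ, 1 ≤ N → ∀ u c : ℝ → ℤ → ℂ, KawaharaFlow T u → GalerkinFlow N c →
      (∀ t ∈ Icc 0 T, WBound 15 (u t) A) →
      (∀ t ∈ Icc 0 T, SumsLE (fun n => (n : ℝ) ^ (2 * r) * ‖u t n‖ ^ 2) (R ^ 2)) →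
      (∀ t ∈ Icc 0 T, WBound 15 (c t) S) → (∀ k ∈ box N, u 0 k = c 0 k) →
      ∀ t ∈ Icc 0 T, l2 (box N) (fun k => u t k - c t k) ≤ C / (N : ℝ) ^ r := by
  -- The four summands bound the four parts of G: convolution with β, the high–high interaction, and
  -- the normal form with the nonlinearity in its low and in its high slot.
  set E := (A + S) * A * R + A * R + 2 * A ^ 2 * R + 3 * A ^ 2 * R * 2 ^ r with hE
  have hE0 : 0 ≤ E := by positivity
  refine ⟨√(Real.exp ((A + S + 1) * T) * ((A * R) ^ 2 + E ^ 2 * T)) + A * R, ?_⟩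
  intro N hN u c hu hc huA huR hcS h0 t ht
  have hT0 : 0 ≤ T := ht.1.trans ht.2
  have hN' : (1 : ℝ) ≤ N := by exact_mod_cast hN
  have hN0 : (0 : ℝ) < N := by linarith
  set ε : ℝ := 1 / (N : ℝ) ^ r with hε
  have hε0 : 0 ≤ ε := by positivity
  set β : ℝ → ℤ → ℂ := fun t => normalForm N (low N (u t)) (u t) with hβ
  set n : ℝ → ℤ → ℂ := fun t k => Complex.I * (k / 2) * tconv (u t) (u t) k with hn
  set θ : ℝ → ℤ → ℂ := fun t k => u t k - c t k + β t k with hθ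
  set G : ℝ → ℤ → ℂ := fun t k => Complex.I * (k / 2) * conv N (fun k => low N (u t) k + c t k) (β t) k -
    Complex.I * (k / 2) * tconv (high N (u t)) (high N (u t)) k -
    (normalForm N (low N (n t)) (u t) k + normalForm N (low N (u t)) (n t) k) with hG
  have hhigh : ∀ t ∈ Icc 0 T, ∀ F, l2 F (high N (u t)) ≤ R * ε := fun t ht F => by
    refine (l2_high_le hR (huR t ht) F).trans ?_
    rw [hε, mul_one_div]
    gcongr; linarith
  have hhalf : ∀ t ∈ Icc 0 T, ∀ F, l2 F (high (N / 2) (u t)) ≤ 2 ^ r * R * ε := fun t ht F => by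
    refine (l2_high_le hR (huR t ht) F).trans ?_
    have h1 : (N : ℝ) ≤ 2 * (((N / 2 : ℕ) : ℝ) + 1) := by
      have : N ≤ 2 * (N / 2 + 1) := by omega
      exact_mod_cast this
    have h2 : (N : ℝ) ^ r ≤ 2 ^ r * (((N / 2 : ℕ) : ℝ) + 1) ^ r := by
      rw [← mul_pow]; exact pow_le_pow_left₀ hN0.le h1 r
    rw [hε, mul_one_div, div_le_div_iff₀ (by positivity) (by positivity)]
    nlinarith
  have hshell : ∀ t ∈ Icc 0 T, l2 (shell N) (u t) ≤ R * ε := fun t ht => by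
    refine le_trans (le_of_eq (l2_congr fun k hk => ?_)) (hhigh t ht (shell N))
    rw [high, if_neg (not_mem_box_of_mem_shell hk)]
  have hβl : ∀ t ∈ Icc 0 T, l2 (box N) (β t) ≤ A / (N : ℝ) ^ 3 * (R * ε) := fun t ht =>
    (l2_normalForm_le hN ((huA t ht).low N).sumsLE_norm).trans
      (mul_le_mul_of_nonneg_left (hshell t ht) (by positivity))
  have hAN : A / (N : ℝ) ^ 3 ≤ A := div_le_self hA (one_le_pow₀ hN')
  have hβl' : ∀ t ∈ Icc 0 T, l2 (box N) (β t) ≤ A * R * ε := fun t ht =>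
    (hβl t ht).trans (by
      rw [mul_assoc]; exact mul_le_mul_of_nonneg_right hAN (by positivity))
  have hGl : ∀ t ∈ Icc 0 T, l2 (box N) (G t) ≤ E * ε := by
    intro t ht
    have hu1 := (huA t ht).sumsLE_norm
    have hul : ∀ F, l2 F (u t) ≤ A := fun F => (huA t ht).l2_le F
    have a1 : l2 (box N) (fun k => Complex.I * (k / 2) *
        conv N (fun k => low N (u t) k + c t k) (β t) k) ≤ (A + S) * A * R * ε := by
      refine (l2_freq_mul_le _ subset_rfl _).trans ?_
      have := (l2_conv_le (N := N) (b := β t)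
        (((huA t ht).low N).add (hcS t ht)).sumsLE_norm (box N)).trans
        (mul_le_mul_of_nonneg_left (hβl t ht) (by positivity))
      refine (mul_le_mul_of_nonneg_left this (by positivity)).trans ?_
      have e : (N : ℝ) / 2 * ((A + S) * (A / (N : ℝ) ^ 3 * (R * ε))) =
        ((A + S) * A * R * ε) * (1 / (2 * (N : ℝ) ^ 2)) := by field_simp
      rw [e]
      refine mul_le_of_le_one_right (by positivity) ?_
      rw [div_le_one (by positivity)]; nlinarith
    have a2 : l2 (box N) (fun k => Complex.I * (k / 2) *
        tconv (high N (u t)) (high N (u t)) k) ≤ A * R * ε := by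
      refine (l2_freq_mul_le _ subset_rfl _).trans ?_
      refine (mul_le_mul_of_nonneg_left (l2_tconv_le (sumsLE_high_of_wBound hN (huA t ht))
        (sumsLE_high hu1) (hhigh t ht) (box N)) (by positivity)).trans ?_
      have e : (N : ℝ) / 2 * (A / (N : ℝ) ^ 2 * (R * ε)) = (A * R * ε) * (1 / (2 * (N : ℝ))) := by
        field_simp
      rw [e]
      refine mul_le_of_le_one_right (by positivity) ?_
      rw [div_le_one (by positivity)]; linarith
    have a3 : l2 (box N) (normalForm N (low N (n t)) (u t)) ≤ 2 * A ^ 2 * R * ε := by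
      -- A crude count, 2N + 1 frequencies of size at most N A²/2, suffices because the normal form
      -- gains N⁻³.
      have hsum : SumsLE (fun k => ‖low N (n t) k‖) (2 * (N : ℝ) ^ 2 * A ^ 2) := by
        refine SumsLE.of_box (fun _ => norm_nonneg _)
          (fun k hk => by rw [low_bandLimited N _ k hk, norm_zero]) ?_
        have hpt : ∀ k ∈ box N, ‖low N (n t) k‖ ≤ N / 2 * A ^ 2 := fun k hk => by
          have h1 := l2_tconv_le hu1 hu1 hul {k}
          rw [l2_eq_sqrt, Finset.sum_singleton, Real.sqrt_sq (norm_nonneg _)] at h1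
          rw [low_of_mem _ hk, hn, norm_mul, norm_mul, Complex.norm_I, one_mul, norm_div,
            Complex.norm_intCast, Complex.norm_ofNat]
          have := abs_cast_le_of_mem_box hk
          rw [sq]; gcongr
        refine (Finset.sum_le_sum hpt).trans ?_
        rw [Finset.sum_const, card_box, nsmul_eq_mul]
        push_cast
        have : (2 * (N : ℝ) + 1) * (N / 2) ≤ 2 * (N : ℝ) ^ 2 := by nlinarith
        have := mul_le_mul_of_nonneg_right this (sq_nonneg A)
        linarith
      refine (l2_normalForm_le hN hsum).trans ((mul_le_mul_of_nonneg_left (hshell t ht)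
        (by positivity)).trans ?_)
      have e : 2 * (N : ℝ) ^ 2 * A ^ 2 / (N : ℝ) ^ 3 * (R * ε) = (2 * A ^ 2 * R * ε) * (1 / N) := by
        field_simp
      rw [e]
      refine mul_le_of_le_one_right (by positivity) ?_
      rwa [div_le_one hN0]
    have a4 : l2 (box N) (normalForm N (low N (u t)) (n t)) ≤ 3 * A ^ 2 * R * 2 ^ r * ε := by
      have b1 : l2 (shell N) (tconv (u t) (u t)) ≤ 3 * A * (2 ^ r * R * ε) := by
        have e : l2 (shell N) (tconv (u t) (u t)) = l2 (shell N) (fun k =>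
            2 * tconv (low (N / 2) (u t)) (high (N / 2) (u t)) k +
            tconv (high (N / 2) (u t)) (high (N / 2) (u t)) k) := l2_congr fun k hk => by
          rw [tconv_self_eq hu1 (N / 2), conv_half_low_eq_zero _ (not_mem_box_of_mem_shell hk), zero_add]
        have h1 := l2_tconv_le ((huA t ht).low (N / 2)).sumsLE_norm (sumsLE_high (N := N / 2) hu1)
          (hhalf t ht) (shell N)
        have h2 := l2_tconv_le (sumsLE_high (N := N / 2) hu1) (sumsLE_high (N := N / 2) hu1)
          (hhalf t ht) (shell N)
        have h3 := l2_smul (shell N) 2 (tconv (low (N / 2) (u t)) (high (N / 2) (u t)))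
        rw [Complex.norm_ofNat] at h3
        rw [e]
        refine (l2_add_le _ _ _).trans ?_
        rw [h3]; linarith
      have b2 : l2 (shell N) (n t) ≤ N * (3 * A * (2 ^ r * R * ε)) := by
        refine (l2_freq_mul_le (N := 2 * N) _ Finset.sdiff_subset _).trans ?_
        have : ((2 * N : ℕ) : ℝ) / 2 = N := by push_cast; ring
        rw [this]
        exact mul_le_mul_of_nonneg_left b1 hN0.le
      refine (l2_normalForm_le hN ((huA t ht).low N).sumsLE_norm).trans
        ((mul_le_mul_of_nonneg_left b2 (by positivity)).trans ?_)
      have e : A / (N : ℝ) ^ 3 * (N * (3 * A * (2 ^ r * R * ε))) =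
          (3 * A ^ 2 * R * 2 ^ r * ε) * (1 / (N : ℝ) ^ 2) := by field_simp
      rw [e]
      refine mul_le_of_le_one_right (by positivity) ?_
      rw [div_le_one (by positivity)]; exact one_le_pow₀ hN'
    refine (l2_sub_le _ _ _).trans ((add_le_add ((l2_sub_le _ _ _).trans (add_le_add a1 a2))
      ((l2_add_le _ _ _).trans (add_le_add a3 a4))).trans (le_of_eq ?_))
    rw [hE]; ring
  have hcontlow : ∀ k, ContinuousOn (fun t => low N (u t) k) (Icc 0 T) := fun k => by
    by_cases hk : k ∈ box N
    · simp only [low, if_pos hk]; exact hu.cont k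
    · simp only [low, if_neg hk]; exact continuousOn_const
  have main := energy_estimate (N := N) (T := T) (θ := θ) (G := G)
    (a := fun t k => (1 / 2 : ℝ) * (low N (u t) k + c t k)) (D := A + S) (ε := E * ε) ?_ ?_
    (fun t ht => ((hu.herm t ht).low N).half_add (hc.herm t ht.1)) (by positivity)
    (fun t ht => sumsLE_half_add ((huA t ht).low N) (hcS t ht)) hGl ht
  -- At time 0 the low frequencies of u and c agree, so θ reduces to β.
  · have hθ0 : l2 (box N) (θ 0) ≤ A * R * ε := by
      refine le_trans (le_of_eq (l2_congr fun k hk => ?_)) (hβl' 0 ⟨le_rfl, hT0⟩)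
      simp only [hθ]; rw [h0 k hk, sub_self, zero_add]
    have h1 : l2 (box N) (θ t) ^ 2 ≤ (√(Real.exp ((A + S + 1) * T) * ((A * R) ^ 2 + E ^ 2 * T)) * ε) ^ 2 := by
      refine main.trans ?_
      rw [mul_pow √_, Real.sq_sqrt (by positivity)]
      calc _ ≤ Real.exp ((A + S + 1) * T) * ((A * R * ε) ^ 2 + (E * ε) ^ 2 * T) := by
            have := l2_nonneg (box N) (θ 0)
            have ht0 := ht.1
            have htT := ht.2
            gcongr
        _ = _ := by ring
    have h2 := (sq_le_sq₀ (l2_nonneg _ _) (by positivity)).1 h1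
    have h3 := l2_sub_le (box N) (θ t) (β t)
    have h4 : l2 (box N) (fun k => u t k - c t k) = l2 (box N) (fun k => θ t k - β t k) :=
      l2_congr fun k _ => by simp only [hθ]; ring
    rw [h4]
    refine h3.trans ((add_le_add h2 (hβl' t ht)).trans (le_of_eq ?_))
    rw [hε]; ring
  · intro k _
    refine ((hu.cont k).sub ((hc.continuousOn k).mono Icc_subset_Ici_self)).add ?_
    exact continuousOn_finsetSum _ fun m _ =>
      ((hcontlow (k - m)).const_smul (nfSymbol m (k - m) : ℂ)).mul (hu.cont m)
  · intro t ht k hk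
    have ht' := Ioo_subset_Icc_self ht
    have hdu := hu.deriv t ht
    have hd := ((hdu k).sub (hc.hasDerivAt ht.1 k)).add
      (hasDerivAt_normalForm (N := N) (hasDerivAt_low (N := N) hdu) hdu k)
    refine hd.congr_deriv ?_
    rw [normalForm_eq (u t) (n t) hk, neg_linOp_half, tconv_self_eq (huA t ht').sumsLE_norm N,
      tconv_low_eq _ _ hk, GalerkinFlow.d1, galerkinOp, if_pos hk]
    have h1 := conv_sub_conv (low_bandLimited N (u t)) (hc.band t) k
    have h2 : conv N (fun k => low N (u t) k + c t k) (fun k => low N (u t) k - c t k) k =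
        conv N (fun k => low N (u t) k + c t k) (θ t) k -
          conv N (fun k => low N (u t) k + c t k) (β t) k := by
      simp only [conv, ← Finset.sum_sub_distrib]
      refine Finset.sum_congr rfl fun j hj => ?_
      rw [← mul_sub]; congr 1
      simp only [hθ]; rw [low_of_mem _ hj]; ring
    rw [h2] at h1
    simp only [hG]
    have h3 : θ t k = u t k - c t k + normalForm N (low N (u t)) (u t) k := rfl
    rw [h3]
    linear_combination (-(Complex.I * (k / 2))) * h1

/-! ### Fourier coefficients on [−π, π] -/

/-- The Fourier coefficients of a complex function on `[-π, π]`. -/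
def coef (f : ℝ → ℂ) (k : ℤ) : ℂ := fourierCoeffOn (neg_lt_self Real.pi_pos) f k

theorem fhat_eq_coef (f : ℝ → ℝ) (k : ℤ) : fhat f k = coef (fun x => (f x : ℂ)) k := rfl

/-- The exponential `x ↦ e^{ikx}`. -/
def ek (k : ℤ) (x : ℝ) : ℂ := Complex.exp (Complex.I * k * x)

theorem ek_zero (x : ℝ) : ek 0 x = 1 := by simp [ek]

theorem ek_add (j k : ℤ) (x : ℝ) : ek (j + k) x = ek j x * ek k x := by
  rw [ek, ek, ek, ← Complex.exp_add]; congr 1; push_cast; ring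

theorem conj_ek (k : ℤ) (x : ℝ) : (starRingEnd ℂ) (ek k x) = ek (-k) x := by
  rw [ek, ek, ← Complex.exp_conj]; congr 1; simp

theorem norm_ek (k : ℤ) (x : ℝ) : ‖ek k x‖ = 1 := by
  have : Complex.I * k * x = ((k * x : ℝ) : ℂ) * Complex.I := by push_cast; ring
  rw [ek, this, Complex.norm_exp_ofReal_mul_I]

theorem hasDerivAt_ek (k : ℤ) (x : ℝ) : HasDerivAt (ek k) (Complex.I * k * ek k x) x := by
  have h : HasDerivAt (fun x : ℝ => Complex.I * k * (x : ℂ)) (Complex.I * k) x := by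
    simpa using (Complex.ofRealCLM.hasDerivAt (x := x)).const_mul (Complex.I * (k : ℂ))
  exact h.cexp.congr_deriv (mul_comm _ _)

theorem contDiff_ek (k : ℤ) {n : WithTop ℕ∞} : ContDiff ℝ n (ek k) :=
  (contDiff_const.mul Complex.ofRealCLM.contDiff).cexp

theorem continuous_ek (k : ℤ) : Continuous (ek k) := (contDiff_ek k (n := 0)).continuous

theorem ek_periodic (k : ℤ) : Function.Periodic (ek k) (2 * Real.pi) := fun x => by
  rw [ek, ek]
  have : Complex.I * k * ((x + 2 * Real.pi : ℝ) : ℂ) =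
      Complex.I * k * x + k * (2 * Real.pi * Complex.I) := by push_cast; ring
  rw [this, Complex.exp_periodic.int_mul k]

theorem two_pi_ne : ((2 * Real.pi : ℝ) : ℂ) ≠ 0 := by exact_mod_cast Real.two_pi_pos.ne'

theorem coef_eq (f : ℝ → ℂ) (k : ℤ) :
    coef f k = ((2 * Real.pi : ℝ) : ℂ)⁻¹ * ∫ x in (-Real.pi)..Real.pi, ek (-k) x * f x := by
  rw [coef, fourierCoeffOn_eq_integral, Complex.real_smul]
  have hpi : (Real.pi : ℂ) ≠ 0 := by exact_mod_cast Real.pi_ne_zero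
  congr 1
  · rw [← Complex.ofReal_inv]; congr 1; rw [one_div]; congr 1; ring
  · refine intervalIntegral.integral_congr fun x _ => ?_
    simp only [fourier_coe_apply, smul_eq_mul, ek]
    congr 2
    push_cast
    field_simp
    ring

theorem integral_ek (k : ℤ) :
    ∫ x in (-Real.pi)..Real.pi, ek k x = if k = 0 then ((2 * Real.pi : ℝ) : ℂ) else 0 := by
  split_ifs with hk
  · simp only [hk, ek_zero]
    rw [intervalIntegral.integral_const, Complex.real_smul]; push_cast; ring
  · have hk' : Complex.I * (k : ℂ) ≠ 0 := mul_ne_zero Complex.I_ne_zero (by exact_mod_cast hk)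
    have h := intervalIntegral.integral_eq_sub_of_hasDerivAt (a := -Real.pi) (b := Real.pi)
      (fun x _ => hasDerivAt_ek k x) ((continuous_const.mul (continuous_ek k)).intervalIntegrable _ _)
    rw [intervalIntegral.integral_const_mul] at h
    have e : ek k Real.pi = ek k (-Real.pi) := by
      rw [← ek_periodic k (-Real.pi)]; congr 1; ring
    rw [e, sub_self] at h
    exact (mul_eq_zero.1 h).resolve_left hk'

theorem coef_add {f g : ℝ → ℂ} (hf : IntervalIntegrable f volume (-Real.pi) Real.pi)
    (hg : IntervalIntegrable g volume (-Real.pi) Real.pi) (k : ℤ) :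
    coef (fun x => f x + g x) k = coef f k + coef g k := by
  simp only [coef_eq, mul_add]
  rw [intervalIntegral.integral_add (hf.continuousOn_mul (continuous_ek _).continuousOn)
    (hg.continuousOn_mul (continuous_ek _).continuousOn), mul_add]

theorem coef_const_mul (f : ℝ → ℂ) (c : ℂ) (k : ℤ) : coef (fun x => c * f x) k = c * coef f k :=
  fourierCoeffOn.const_mul _ _ _ _

theorem coef_sub {f g : ℝ → ℂ} (hf : IntervalIntegrable f volume (-Real.pi) Real.pi)
    (hg : IntervalIntegrable g volume (-Real.pi) Real.pi) (k : ℤ) :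
    coef (fun x => f x - g x) k = coef f k - coef g k := by
  simp only [coef_eq, mul_sub]
  rw [intervalIntegral.integral_sub (hf.continuousOn_mul (continuous_ek _).continuousOn)
    (hg.continuousOn_mul (continuous_ek _).continuousOn), mul_sub]

theorem coef_ek (j k : ℤ) : coef (ek j) k = if j = k then 1 else 0 := by
  rw [coef_eq]
  simp_rw [← ek_add]
  rw [integral_ek]
  by_cases h : j = k
  · rw [if_pos h, if_pos (by omega), inv_mul_cancel₀ two_pi_ne]
  · rw [if_neg h, if_neg (by omega), mul_zero]

theorem ip_ek (f : ℝ → ℂ) (k : ℤ) : ip f (ek k) = ((2 * Real.pi : ℝ) : ℂ) * coef f k := by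
  rw [coef_eq, ← mul_assoc, mul_inv_cancel₀ two_pi_ne, one_mul, ip]
  exact intervalIntegral.integral_congr fun x _ => by simp only [conj_ek]; ring

theorem hermitian_fhat (f : ℝ → ℝ) : Hermitian (fhat f) := fun k => by
  rw [fhat_eq_coef, fhat_eq_coef, coef_eq, coef_eq, map_mul, map_inv₀, Complex.conj_ofReal,
    intervalIntegral.integral_of_le (by linarith [Real.pi_pos]),
    intervalIntegral.integral_of_le (by linarith [Real.pi_pos]), ← integral_conj]
  simp [conj_ek]

/-! ### Trigonometric polynomials -/

/-- The trigonometric polynomial with coefficients `c`. -/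
def trigPoly (N : ℕ) (c : ℤ → ℂ) (x : ℝ) : ℂ := ∑ k ∈ box N, c k * ek k x

theorem contDiff_trigPoly (N : ℕ) (c : ℤ → ℂ) {n : WithTop ℕ∞} : ContDiff ℝ n (trigPoly N c) :=
  ContDiff.sum fun k _ => contDiff_const.mul (contDiff_ek k)

theorem trigPoly_periodic (N : ℕ) (c : ℤ → ℂ) : Function.Periodic (trigPoly N c) (2 * Real.pi) :=
  fun x => Finset.sum_congr rfl fun k _ => by rw [ek_periodic]

theorem ek_mem_trigSpace {N : ℕ} {k : ℤ} (hk : k ∈ box N) : ek k ∈ trigSpace N :=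
  Submodule.subset_span ⟨k, (Finset.mem_Icc.1 hk).1, (Finset.mem_Icc.1 hk).2, rfl⟩

theorem exists_trigPoly {N : ℕ} {f : ℝ → ℂ} (hf : f ∈ trigSpace N) : ∃ c, f = trigPoly N c := by
  induction hf using Submodule.span_induction with
  | mem f hf =>
    obtain ⟨k, h1, h2, rfl⟩ := hf
    refine ⟨fun j => if j = k then 1 else 0, funext fun x => ?_⟩
    have hk : k ∈ box N := Finset.mem_Icc.2 ⟨h1, h2⟩
    simp [trigPoly, hk, ek]
  | zero => exact ⟨fun _ => 0, funext fun x => by simp [trigPoly]⟩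
  | add f g _ _ hf hg =>
    obtain ⟨c, rfl⟩ := hf
    obtain ⟨d, rfl⟩ := hg
    exact ⟨fun k => c k + d k, funext fun x => by
      simp [trigPoly, add_mul, Finset.sum_add_distrib]⟩
  | smul a f _ hf =>
    obtain ⟨c, rfl⟩ := hf
    exact ⟨fun k => a * c k, funext fun x => by
      simp [trigPoly, Finset.mul_sum, mul_assoc]⟩

theorem coef_trigPoly (N : ℕ) (c : ℤ → ℂ) (k : ℤ) : coef (trigPoly N c) k = low N c k := by
  have h : ∀ s : Finset ℤ, coef (fun x => ∑ j ∈ s, c j * ek j x) k = if k ∈ s then c k else 0 := by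
    intro s
    induction s using Finset.induction_on with
    | empty => simp [coef_eq]
    | insert j s hj ih =>
      simp only [Finset.sum_insert hj]
      rw [coef_add (f := fun x => c j * ek j x) (g := fun x => ∑ j ∈ s, c j * ek j x)
        ((continuous_const.mul (continuous_ek j)).intervalIntegrable _ _)
        ((continuous_finsetSum _ fun j _ => continuous_const.mul (continuous_ek j)).intervalIntegrable _ _),
        ih, coef_const_mul, coef_ek]
      rcases eq_or_ne k j with rfl | hkj
      · simp [hj]
      · simp [hkj, hkj.symm]
  exact h _

theorem eq_trigPoly_coef {N : ℕ} {f : ℝ → ℂ} (hf : f ∈ trigSpace N) : f = trigPoly N (coef f) := by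
  obtain ⟨c, rfl⟩ := exists_trigPoly hf
  funext x
  exact Finset.sum_congr rfl fun k hk => by rw [coef_trigPoly, low_of_mem _ hk]

theorem coef_bandLimited {N : ℕ} {f : ℝ → ℂ} (hf : f ∈ trigSpace N) : BandLimited N (coef f) := by
  obtain ⟨c, rfl⟩ := exists_trigPoly hf
  intro k hk
  rw [coef_trigPoly]; exact low_bandLimited N c k hk

theorem contDiff_of_mem_trigSpace {N : ℕ} {f : ℝ → ℂ} (hf : f ∈ trigSpace N) {n : WithTop ℕ∞} :
    ContDiff ℝ n f := by
  rw [eq_trigPoly_coef hf]; exact contDiff_trigPoly N _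

theorem periodic_of_mem_trigSpace {N : ℕ} {f : ℝ → ℂ} (hf : f ∈ trigSpace N) :
    Function.Periodic f (2 * Real.pi) := by
  rw [eq_trigPoly_coef hf]; exact trigPoly_periodic N _

/-- The coefficients of a trigonometric polynomial are combinations of point values. -/
theorem exists_quadrature (N : ℕ) {k : ℤ} (hk : k ∈ box N) :
    ∃ w : ℝ →₀ ℂ, ∀ f ∈ trigSpace N, coef f k = w.sum fun x a => a * f x := by
  have hli : LinearIndependent ℂ (fun (j : box N) (x : ℝ) => ek j x) := by
    rw [Fintype.linearIndependent_iff]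
    intro g hg j
    set c : ℤ → ℂ := fun k => if h : k ∈ box N then g ⟨k, h⟩ else 0 with hc
    have h1 : trigPoly N c = fun _ => 0 := by
      funext x
      have := congrFun hg x
      simp only [Finset.sum_apply, Pi.smul_apply, smul_eq_mul, Pi.zero_apply] at this
      rw [trigPoly, ← Finset.sum_coe_sort, ← this]
      exact Finset.sum_congr rfl fun j _ => by simp [hc]
    have h2 := coef_trigPoly N c j
    rw [h1, low_of_mem _ j.2] at h2
    simp [coef_eq, hc] at h2
    exact h2.symm
  -- Linear independence of the exponentials as functions means that their vectors of values at
  -- points x span all of ℂ^box. The k-th unit vector is thus a finite combination of such vectors.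
  have hspan := span_flip_eq_top_iff_linearIndependent.2 hli
  have hmem : (Pi.single ⟨k, hk⟩ 1 : box N → ℂ) ∈
      Submodule.span ℂ (range (flip fun (j : box N) (x : ℝ) => ek j x)) := by
    rw [hspan]; trivial
  obtain ⟨w, hw⟩ := (Finsupp.mem_span_range_iff_exists_finsupp).1 hmem
  refine ⟨w, fun f hf => ?_⟩
  have hw' : ∀ j ∈ box N, (w.sum fun x a => a * ek j x) = if j = k then 1 else 0 := fun j hj => by
    have := congrFun hw ⟨j, hj⟩
    rw [Finsupp.sum, Finset.sum_apply] at this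
    rw [Finsupp.sum]
    simpa [flip, Pi.single_apply] using this
  have hft := eq_trigPoly_coef hf
  have e : (w.sum fun x a => a * f x) = ∑ j ∈ box N, coef f j * (w.sum fun x a => a * ek j x) := by
    simp only [Finsupp.sum, Finset.mul_sum]
    rw [Finset.sum_comm]
    refine Finset.sum_congr rfl fun x _ => ?_
    conv_lhs => rw [hft]
    rw [trigPoly, Finset.mul_sum]
    exact Finset.sum_congr rfl fun j _ => by ring
  rw [e, Finset.sum_congr rfl fun j hj => by rw [hw' j hj]]
  simp [hk]

/-! ### Fourier series of periodic functions -/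

theorem hasSum_coef_mul_ek {g : ℝ → ℂ} {A : ℝ} (hp : Function.Periodic g (2 * Real.pi))
    (hg : Continuous g) (hA : SumsLE (fun n => ‖coef g n‖) A) (x : ℝ) :
    HasSum (fun k => coef g k * ek k x) (g x) := by
  have : Fact (0 < 2 * Real.pi) := ⟨Real.two_pi_pos⟩
  set G : C(AddCircle (2 * Real.pi), ℂ) := ⟨hp.lift, continuous_coinduced_dom.2 hg⟩ with hG
  have hGx : ∀ x : ℝ, G x = g x := fun x => hp.lift_coe x
  have hpi : (Real.pi : ℂ) ≠ 0 := by exact_mod_cast Real.pi_ne_zero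
  have hek : ∀ (k : ℤ) (x : ℝ), fourier k (x : AddCircle (2 * Real.pi)) = ek k x := fun k x => by
    rw [fourier_coe_apply, ek]; congr 1; push_cast; field_simp
  have hc : ∀ k, fourierCoeff G k = coef g k := fun k => by
    rw [fourierCoeff_eq_intervalIntegral _ _ (-Real.pi), coef_eq, Complex.real_smul]
    congr 1
    · push_cast; rw [one_div]
    · have : -Real.pi + 2 * Real.pi = Real.pi := by ring
      rw [this]
      exact intervalIntegral.integral_congr fun x _ => by
        simp only [hek, smul_eq_mul]; rw [hGx]
  have hs : Summable (fourierCoeff G) := by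
    have : fourierCoeff G = coef g := funext hc
    rw [this]
    exact (hA.summable fun _ => norm_nonneg _).of_norm
  have := has_pointwise_sum_fourier_series_of_summable hs x
  rw [hGx] at this
  refine this.congr_fun fun k => ?_
  rw [hc, smul_eq_mul, hek]

theorem norm_le_of_sumsLE {g : ℝ → ℂ} {A : ℝ} (hp : Function.Periodic g (2 * Real.pi))
    (hg : Continuous g) (hA : SumsLE (fun n => ‖coef g n‖) A) (x : ℝ) : ‖g x‖ ≤ A := by
  rw [← (hasSum_coef_mul_ek hp hg hA x).tsum_eq]
  refine tsum_of_norm_bounded (hA.summable fun _ => norm_nonneg _).hasSum (fun k => ?_) |>.trans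
    ((hA.summable fun _ => norm_nonneg _).tsum_le_of_sum_le hA)
  rw [norm_mul, norm_ek, mul_one]

/-- The absolutely convergent series of g is inserted and integrated term by term by dominated
convergence. -/
theorem coef_mul {f g : ℝ → ℂ} {A : ℝ} (hf : Continuous f) (hp : Function.Periodic g (2 * Real.pi))
    (hg : Continuous g) (hA : SumsLE (fun n => ‖coef g n‖) A) (k : ℤ) :
    coef (fun x => f x * g x) k = tconv (coef f) (coef g) k := by
  have hs : Summable fun j => ‖coef g j‖ := hA.summable fun _ => norm_nonneg _
  have h := intervalIntegral.hasSum_integral_of_dominated_convergence (μ := volume)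
    (a := -Real.pi) (b := Real.pi)
    (F := fun (j : ℤ) x => ek (-k) x * (f x * (coef g j * ek j x)))
    (f := fun x => ek (-k) x * (f x * g x)) (fun j x => ‖f x‖ * ‖coef g j‖)
    (fun j => Continuous.aestronglyMeasurable ((continuous_ek _).mul
      (hf.mul (continuous_const.mul (continuous_ek j)))))
    (fun j => Eventually.of_forall fun x _ => by
      rw [norm_mul, norm_mul, norm_mul, norm_ek, norm_ek, one_mul, mul_one])
    (Eventually.of_forall fun x _ => hs.mul_left _)
    (by
      simp_rw [tsum_mul_left]
      exact (hf.norm.mul continuous_const).intervalIntegrable _ _)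
    (Eventually.of_forall fun x _ =>
      ((hasSum_coef_mul_ek hp hg hA x).mul_left (f x)).mul_left (ek (-k) x))
  rw [coef_eq, ← h.tsum_eq, ← tsum_mul_left, tconv]
  refine tsum_congr fun j => ?_
  have e : ∫ x in (-Real.pi)..Real.pi, ek (-k) x * (f x * (coef g j * ek j x)) =
      coef g j * ∫ x in (-Real.pi)..Real.pi, ek (-(k - j)) x * f x := by
    rw [← intervalIntegral.integral_const_mul]
    refine intervalIntegral.integral_congr fun x _ => ?_
    have : -(k - j) = -k + j := by ring
    simp only [this, ek_add]; ring
  rw [coef_eq f (k - j), e]; ring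

theorem coef_deriv {g : ℝ → ℂ} (hp : Function.Periodic g (2 * Real.pi)) (hg : ContDiff ℝ 1 g) (k : ℤ) :
    coef (deriv g) k = Complex.I * k * coef g k := by
  have hd : ∀ x, HasDerivAt g (deriv g x) x := fun x =>
    (hg.differentiable (by norm_num) x).hasDerivAt
  have h := intervalIntegral.integral_mul_deriv_eq_deriv_mul (a := -Real.pi) (b := Real.pi)
    (u := ek (-k)) (v := g)
    (fun x _ => hasDerivAt_ek (-k) x) (fun x _ => hd x)
    ((continuous_const.mul (continuous_ek _)).intervalIntegrable _ _)
    ((hg.continuous_deriv le_rfl).intervalIntegrable _ _)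
  have e1 : ek (-k) Real.pi = ek (-k) (-Real.pi) := by
    rw [← ek_periodic (-k) (-Real.pi)]; congr 1; ring
  have e2 : g Real.pi = g (-Real.pi) := by
    rw [← hp (-Real.pi)]; congr 1; ring
  rw [coef_eq, coef_eq, h, e1, e2, sub_self, zero_sub]
  have : ∀ x, Complex.I * ((-k : ℤ) : ℂ) * ek (-k) x * g x = -(Complex.I * k) * (ek (-k) x * g x) := by
    intro x; push_cast; ring
  simp_rw [this]
  rw [intervalIntegral.integral_const_mul]; ring

theorem iteratedDeriv_periodic {g : ℝ → ℂ} {p : ℝ} (hp : Function.Periodic g p) (n : ℕ) :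
    Function.Periodic (iteratedDeriv n g) p := fun x => by
  have := iteratedDeriv_comp_add_const n g p
  have h2 : (fun z => g (z + p)) = g := funext hp
  rw [h2] at this
  exact (congrFun this x).symm

theorem coef_iteratedDeriv {g : ℝ → ℂ} (hp : Function.Periodic g (2 * Real.pi)) {n : ℕ}
    (hg : ContDiff ℝ n g) (k : ℤ) : coef (iteratedDeriv n g) k = (Complex.I * k) ^ n * coef g k := by
  induction n with
  | zero => simp
  | succ n ih =>
    have h1 : ContDiff ℝ 1 (iteratedDeriv n g) := by
      rw [iteratedDeriv_eq_iterate]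
      refine ContDiff.iterate_deriv' 1 n ?_
      rw [add_comm]; exact_mod_cast hg
    rw [iteratedDeriv_succ, coef_deriv (iteratedDeriv_periodic hp n) h1,
      ih (hg.of_le (by exact_mod_cast n.le_succ))]
    ring

theorem wBound_iteratedDeriv {g : ℝ → ℂ} {A : ℝ} (hp : Function.Periodic g (2 * Real.pi)) {n : ℕ}
    (hn : n ≤ 15) (hg : ContDiff ℝ n g) (hA : WBound 15 (coef g) A) :
    SumsLE (fun k => ‖coef (iteratedDeriv n g) k‖) A := by
  refine SumsLE.mono (hA.mono hn) (fun k => ?_) le_rfl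
  rw [coef_iteratedDeriv hp hg, norm_mul, norm_pow, norm_mul, Complex.norm_I, one_mul,
    Complex.norm_intCast]
  gcongr; linarith

theorem continuous_iteratedDeriv_of_le {g : ℝ → ℂ} (hg : ContDiff ℝ 5 g) {n : ℕ} (hn : n ≤ 5) :
    Continuous (iteratedDeriv n g) := hg.continuous_iteratedDeriv n (by exact_mod_cast hn)

theorem continuous_spatialOp {g : ℝ → ℂ} (hg : ContDiff ℝ 5 g) : Continuous (spatialOp g) :=
  ((hg.continuous.mul (hg.continuous_deriv (by norm_num))).add
    (continuous_iteratedDeriv_of_le hg (by norm_num))).sub (continuous_iteratedDeriv_of_le hg le_rfl)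

/-- Supplies the dominating constant for differentiating Fourier coefficients of u in time. -/
theorem norm_spatialOp_le {g : ℝ → ℂ} {A : ℝ} (hp : Function.Periodic g (2 * Real.pi))
    (hg : ContDiff ℝ 5 g) (hA : WBound 15 (coef g) A) (x : ℝ) :
    ‖spatialOp g x‖ ≤ A * A + A + A := by
  have h : ∀ n ≤ 5, ‖iteratedDeriv n g x‖ ≤ A := fun n hn =>
    norm_le_of_sumsLE (iteratedDeriv_periodic hp n) (continuous_iteratedDeriv_of_le hg hn)
      (wBound_iteratedDeriv hp (by omega) (hg.of_le (by exact_mod_cast hn)) hA) x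
  have h0 := h 0 (by norm_num)
  have h1 := h 1 (by norm_num)
  rw [iteratedDeriv_zero] at h0
  rw [iteratedDeriv_one] at h1
  refine (norm_sub_le _ _).trans (add_le_add ((norm_add_le _ _).trans (add_le_add ?_
    (h 3 (by norm_num)))) (h 5 le_rfl))
  rw [norm_mul]
  exact mul_le_mul h0 h1 (norm_nonneg _) (SumsLE.nonneg hA)

theorem coef_spatialOp {g : ℝ → ℂ} {A : ℝ} (hp : Function.Periodic g (2 * Real.pi))
    (hg : ContDiff ℝ 5 g) (hA : SumsLE (fun n => ‖coef g n‖) A) (k : ℤ) :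
    coef (spatialOp g) k = Complex.I * (k / 2) * tconv (coef g) (coef g) k -
      Complex.I * freq k * coef g k := by
  have hg1 : ContDiff ℝ 1 g := hg.of_le (by norm_num)
  have hgd : ∀ x, HasDerivAt g (deriv g x) x := fun x =>
    (hg1.differentiable (by norm_num) x).hasDerivAt
  -- Conservative form of the nonlinearity: g g' = ½(g²)'.
  have hsq : (fun x => g x * deriv g x) = fun x => (1 / 2 : ℂ) * deriv (fun x => g x * g x) x := by
    funext x
    have h : HasDerivAt (fun x => g x * g x) _ x := (hgd x).mul (hgd x)
    rw [h.deriv]; ring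
  have c3 := continuous_iteratedDeriv_of_le hg (n := 3) (by norm_num)
  have c5 := continuous_iteratedDeriv_of_le hg (n := 5) le_rfl
  have c1 : Continuous fun x => g x * deriv g x := hg.continuous.mul (hg.continuous_deriv (by norm_num))
  have hps : Function.Periodic (fun x => g x * g x) (2 * Real.pi) := fun x => by simp only [hp x]
  unfold spatialOp
  rw [coef_sub (f := fun x => g x * deriv g x + iteratedDeriv 3 g x)
      ((c1.add c3).intervalIntegrable _ _) (c5.intervalIntegrable _ _),
    coef_add (f := fun x => g x * deriv g x) (c1.intervalIntegrable _ _) (c3.intervalIntegrable _ _),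
    coef_iteratedDeriv hp (n := 3) (hg.of_le (by norm_num)), coef_iteratedDeriv hp (n := 5) hg, hsq,
    coef_const_mul, coef_deriv hps (hg1.mul hg1), coef_mul hg.continuous hp hg.continuous hA]
  have i3 : Complex.I ^ 3 = -Complex.I := Complex.I_pow_three
  have i5 : Complex.I ^ 5 = Complex.I := by rw [show 5 = 4 + 1 from rfl, pow_succ, Complex.I_pow_four, one_mul]
  rw [mul_pow, mul_pow, i3, i5, freq]
  push_cast; ring

/-! ### Parseval's identity -/

theorem memLp_of_continuous {f : ℝ → ℂ} (hf : Continuous f) :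
    MemLp f 2 (volume.restrict (Ioc (-Real.pi) Real.pi)) := by
  obtain ⟨C, hC⟩ := (isCompact_Icc (a := -Real.pi) (b := Real.pi)).exists_bound_of_continuousOn
    hf.continuousOn
  exact MemLp.of_bound hf.aestronglyMeasurable C
    (ae_restrict_of_forall_mem measurableSet_Ioc fun x hx => hC x (Ioc_subset_Icc_self hx))

theorem hasSum_norm_coef_sq {f : ℝ → ℂ} (hf : Continuous f) :
    HasSum (fun k => 2 * Real.pi * ‖coef f k‖ ^ 2) (∫ x in (-Real.pi)..Real.pi, ‖f x‖ ^ 2) := by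
  have h := (hasSum_sq_fourierCoeffOn (neg_lt_self Real.pi_pos) (memLp_of_continuous hf)).mul_left
    (2 * Real.pi)
  have e : Real.pi - -Real.pi = 2 * Real.pi := by ring
  rw [e, smul_eq_mul, ← mul_assoc, mul_inv_cancel₀ Real.two_pi_pos.ne', one_mul] at h
  exact h

theorem l2norm_le {f : ℝ → ℂ} (hf : Continuous f) {B : ℝ} (hB : ∀ F, l2 F (coef f) ≤ B) :
    l2norm f ≤ √(2 * Real.pi) * B := by
  have hB0 : 0 ≤ B := (l2_nonneg ∅ _).trans (hB ∅)
  rw [l2norm, ← Real.sqrt_sq hB0, ← Real.sqrt_mul Real.two_pi_pos.le]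
  refine Real.sqrt_le_sqrt ?_
  rw [← (hasSum_norm_coef_sq hf).tsum_eq]
  refine (hasSum_norm_coef_sq hf).summable.tsum_le_of_sum_le fun F => ?_
  rw [← Finset.mul_sum, ← l2_sq]
  exact mul_le_mul_of_nonneg_left (pow_le_pow_left₀ (l2_nonneg _ _) (hB F) 2) Real.two_pi_pos.le

theorem l2_coef_le {f : ℝ → ℂ} (hf : Continuous f) (F : Finset ℤ) :
    √(2 * Real.pi) * l2 F (coef f) ≤ l2norm f := by
  rw [l2norm, l2_eq_sqrt, ← Real.sqrt_mul Real.two_pi_pos.le, Finset.mul_sum]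
  exact Real.sqrt_le_sqrt (sum_le_hasSum F (fun k _ => by positivity) (hasSum_norm_coef_sq hf))

/-! ### From functions to coefficient sequences -/

theorem low_eq_self {N : ℕ} {c : ℤ → ℂ} (h : BandLimited N c) : low N c = c := by
  funext k
  unfold low
  split_ifs with hk
  · rfl
  · exact (h k hk).symm

theorem tconv_eq_conv {N : ℕ} (a : ℤ → ℂ) {b : ℤ → ℂ} (hb : BandLimited N b) (k : ℤ) :
    tconv a b k = conv N a b k :=
  tsum_eq_sum fun j hj => by rw [hb j hj, mul_zero]

theorem coef_spatialOp_of_mem {N : ℕ} {f : ℝ → ℂ} (hf : f ∈ trigSpace N) (k : ℤ) :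
    coef (spatialOp f) k = Complex.I * (k / 2) * conv N (coef f) (coef f) k -
      Complex.I * freq k * coef f k := by
  have hb := coef_bandLimited hf
  rw [coef_spatialOp (periodic_of_mem_trigSpace hf) (contDiff_of_mem_trigSpace hf)
    (SumsLE.of_box (fun n => norm_nonneg _) (fun n hn => by rw [hb n hn, norm_zero]) le_rfl),
    tconv_eq_conv _ hb]

theorem coef_eq_zero_of_ip {N : ℕ} {f : ℝ → ℂ} (h : ∀ φ ∈ trigSpace N, ip f φ = 0) {k : ℤ}
    (hk : k ∈ box N) : coef f k = 0 := by
  have := h _ (ek_mem_trigSpace hk)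
  rw [ip_ek] at this
  exact (mul_eq_zero.1 this).resolve_left two_pi_ne

theorem continuous_of_mem_trigSpace {N : ℕ} {f : ℝ → ℂ} (hf : f ∈ trigSpace N) : Continuous f :=
  (contDiff_of_mem_trigSpace hf (n := 0)).continuous

/-- The truncation `low N` changes nothing for t ≥ 0. It is there because U is unconstrained for t <
0, whereas `GalerkinFlow` asks for band limitation at all times. -/
theorem galerkinFlow_of_isSemiDiscrete {N : ℕ} {u₀ : ℝ → ℝ} {U : ℝ → ℝ → ℂ}
    (h : IsSemiDiscrete N u₀ U) : GalerkinFlow N fun t => low N (coef (U t)) where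
  band _ := low_bandLimited _ _
  herm t ht := by
    have e : U t = fun x => (((U t x).re : ℝ) : ℂ) := funext fun x =>
      Complex.ext (by simp) (by simp [h.real t ht x])
    rw [e]
    exact (hermitian_fhat fun x => (U t x).re).low N
  deriv t ht k hk := by
    obtain ⟨Ut, hUt, heq⟩ := h.equation t ht
    -- The time derivative is given only pointwise in x; as finite combinations of point values the
    -- coefficients inherit it.
    have hd : ∀ k ∈ box N, ∃ d, HasDerivWithinAt (fun s => coef (U s) k) d (Ici 0) t := fun k hk => by
      obtain ⟨w, hw⟩ := exists_quadrature N hk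
      refine ⟨∑ x ∈ w.support, w x * Ut x, ?_⟩
      exact (HasDerivWithinAt.fun_sum fun x _ => (hUt x).const_mul (w x)).congr
        (fun s hs => hw _ (h.mem s hs)) (hw _ (h.mem t ht))
    choose! d hd using hd
    -- Uniqueness of one-sided derivatives identifies Ut as a trigonometric polynomial, hence
    -- integrable.
    have hUd : Ut = trigPoly N d := funext fun x => by
      refine (uniqueDiffOn_Ici (0 : ℝ) t ht).eq_deriv _ (hUt x) ?_
      refine (HasDerivWithinAt.fun_sum fun k hk => (hd k hk).mul_const (ek k x)).congr
        (fun s hs => ?_) ?_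
      · exact congrFun (eq_trigPoly_coef (h.mem s hs)) x
      · exact congrFun (eq_trigPoly_coef (h.mem t ht)) x
    have h1 := coef_eq_zero_of_ip heq hk
    rw [coef_add (by rw [hUd]; exact (contDiff_trigPoly N d (n := 0)).continuous.intervalIntegrable _ _)
      ((continuous_spatialOp (contDiff_of_mem_trigSpace (h.mem t ht))).intervalIntegrable _ _), hUd,
      coef_trigPoly, low_of_mem _ hk, coef_spatialOp_of_mem (h.mem t ht)] at h1
    simp only [low_of_mem _ hk]
    rw [low_eq_self (coef_bandLimited (h.mem t ht))]
    refine (hd k hk).congr_deriv ?_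
    linear_combination h1

theorem leapFrogFlow_of_isLeapFrog {N M : ℕ} {dt : ℝ} {W : ℕ → ℝ → ℂ} (h : IsLeapFrog N dt M W) :
    LeapFrogFlow N dt M fun m => coef (W m) where
  band m hm := coef_bandLimited (h.mem m hm)
  step m hm k hk := by
    have h1 := h.step (m + 1) (by omega) hm _ (ek_mem_trigSpace hk)
    have hW := h.mem (m + 1) hm.le
    rw [Nat.add_sub_cancel, ip_ek, ip_ek,
      coef_sub ((continuous_of_mem_trigSpace (h.mem (m + 2) hm)).intervalIntegrable _ _)
        ((continuous_of_mem_trigSpace (h.mem m (by omega))).intervalIntegrable _ _),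
      coef_spatialOp_of_mem hW] at h1
    refine mul_left_cancel₀ two_pi_ne ?_
    linear_combination h1

theorem coef_initial {N : ℕ} {r : ℕ} {u₀ : ℝ → ℝ} (hu₀ : MemSobolev r u₀) {p : ℝ → ℂ}
    (h : IsProjection N (fun x => (u₀ x : ℂ)) p) {k : ℤ} (hk : k ∈ box N) : coef p k = fhat u₀ k := by
  have hle : -Real.pi ≤ Real.pi := by linarith [Real.pi_pos]
  have hi : IntervalIntegrable (fun x => (u₀ x : ℂ)) volume (-Real.pi) Real.pi :=
    (intervalIntegrable_iff_integrableOn_Ioc_of_le hle).2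
      (hu₀.memLp.integrable (by norm_num)).ofReal
  have h1 := coef_eq_zero_of_ip h.2 hk
  rw [coef_sub hi ((continuous_of_mem_trigSpace h.1).intervalIntegrable _ _), sub_eq_zero] at h1
  exact h1.symm

theorem MemSobolev.sumsLE {r : ℕ} {f : ℝ → ℝ} (h : MemSobolev r f) :
    SumsLE (fun k => (1 + (k : ℝ) ^ 2) ^ r * ‖fhat f k‖ ^ 2) (sobolevNorm r f ^ 2) := fun s => by
  rw [sobolevNorm, Real.sq_sqrt (tsum_nonneg fun k => by positivity)]
  exact h.summable.sum_le_tsum s fun k _ => by positivity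

theorem wBound_of_sumsLE {r : ℕ} (hr : 16 ≤ r) {c : ℤ → ℂ} {R : ℝ}
    (h : SumsLE (fun k => (1 + (k : ℝ) ^ 2) ^ r * ‖c k‖ ^ 2) R) :
    SumsLE (fun n => (n : ℝ) ^ (2 * r) * ‖c n‖ ^ 2) R ∧
      WBound 15 c √(embConst * (2 ^ 31 * (R + R))) := by
  have h1 : SumsLE (fun n => (n : ℝ) ^ (2 * r) * ‖c n‖ ^ 2) R := SumsLE.mono h (fun n =>
    mul_le_mul_of_nonneg_right (by
      rw [pow_mul]; exact pow_le_pow_left₀ (sq_nonneg _) (by linarith) r) (by positivity)) le_rfl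
  refine ⟨h1, wBound_of_sobolev hr (SumsLE.mono h (fun n => ?_) le_rfl) h1⟩
  exact le_mul_of_one_le_left (by positivity) (one_le_pow₀ (by linarith [sq_nonneg (n : ℝ)]))

namespace IsSolution

variable {r : ℕ} {u₀ : ℝ → ℝ} {u : ℝ → ℝ → ℝ} (h : IsSolution r u₀ u)
include h

theorem continuous_ofReal {t : ℝ} (ht : 0 ≤ t) : Continuous fun x => (u t x : ℂ) :=
  Complex.continuous_ofReal.comp (h.contDiff t ht).continuous

theorem fhat_sub {s t : ℝ} (hs : 0 ≤ s) (ht : 0 ≤ t) (k : ℤ) :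
    fhat (fun x => u s x - u t x) k = fhat (u s) k - fhat (u t) k := by
  simp only [fhat_eq_coef, Complex.ofReal_sub]
  exact coef_sub ((h.continuous_ofReal hs).intervalIntegrable _ _)
    ((h.continuous_ofReal ht).intervalIntegrable _ _) k

theorem sumsLE_sub {s t : ℝ} (hs : 0 ≤ s) (ht : 0 ≤ t) :
    SumsLE (fun k => (1 + (k : ℝ) ^ 2) ^ r * ‖fhat (u s) k - fhat (u t) k‖ ^ 2)
      (sobolevNorm r (fun x => u s x - u t x) ^ 2) := by
  simp only [← h.fhat_sub hs ht]
  refine MemSobolev.sumsLE ⟨?_, ?_, ?_⟩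
  · intro x; simp only [(h.memSobolev s hs).periodic x, (h.memSobolev t ht).periodic x]
  · exact (h.memSobolev s hs).memLp.sub (h.memSobolev t ht).memLp
  -- Summability has to be checked: a divergent `tsum` would be 0 and `sobolevNorm` would bound
  -- nothing.
  · refine Summable.of_nonneg_of_le (fun k => by positivity) (fun k => ?_)
      (((h.memSobolev s hs).summable.mul_left 2).add ((h.memSobolev t ht).summable.mul_left 2))
    rw [h.fhat_sub hs ht]
    have h1 : ‖fhat (u s) k - fhat (u t) k‖ ^ 2 ≤ 2 * ‖fhat (u s) k‖ ^ 2 + 2 * ‖fhat (u t) k‖ ^ 2 := by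
      have := norm_sub_le (fhat (u s) k) (fhat (u t) k)
      nlinarith [norm_nonneg (fhat (u s) k - fhat (u t) k), sq_nonneg (‖fhat (u s) k‖ - ‖fhat (u t) k‖)]
    have h2 : 0 ≤ (1 + (k : ℝ) ^ 2) ^ r := by positivity
    nlinarith [mul_le_mul_of_nonneg_left h1 h2]

theorem continuousOn_fhat (k : ℤ) : ContinuousOn (fun t => fhat (u t) k) (Ici 0) := fun t ht => by
  rw [ContinuousWithinAt, tendsto_iff_norm_sub_tendsto_zero]
  refine tendsto_of_tendsto_of_tendsto_of_le_of_le' tendsto_const_nhds (h.continuous t ht)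
    (Eventually.of_forall fun _ => norm_nonneg _) ?_
  filter_upwards [self_mem_nhdsWithin] with s hs
  have h1 := (h.sumsLE_sub hs ht).le k
  have h2 : ‖fhat (u s) k - fhat (u t) k‖ ^ 2 ≤ sobolevNorm r (fun x => u s x - u t x) ^ 2 :=
    (le_mul_of_one_le_left (by positivity)
      (one_le_pow₀ (by linarith [sq_nonneg (k : ℝ)]))).trans h1
  exact (sq_le_sq₀ (norm_nonneg _) (Real.sqrt_nonneg _)).1 h2

/-- Continuity in H^r gives a bound near each time, and compactness of [0, T] makes it uniform. -/
theorem exists_sumsLE (T : ℝ) : ∃ R, ∀ t ∈ Icc 0 T,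
    SumsLE (fun k => (1 + (k : ℝ) ^ 2) ^ r * ‖fhat (u t) k‖ ^ 2) R := by
  refine isCompact_Icc.induction_on
    (p := fun S => ∃ R, ∀ t ∈ S, SumsLE (fun k => (1 + (k : ℝ) ^ 2) ^ r * ‖fhat (u t) k‖ ^ 2) R)
    ⟨0, fun _ h => h.elim⟩ (fun S S' hS ⟨R, hR⟩ => ⟨R, fun t ht => hR t (hS ht)⟩) ?_ ?_
  · rintro S S' ⟨R, hR⟩ ⟨R', hR'⟩
    refine ⟨max R R', fun t ht => ?_⟩
    rcases ht with ht | ht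
    · exact (hR t ht).mono (fun _ => le_rfl) (le_max_left _ _)
    · exact (hR' t ht).mono (fun _ => le_rfl) (le_max_right _ _)
  · intro t ht
    have hev : ∀ᶠ s in 𝓝[Ici 0] t, sobolevNorm r (fun x => u s x - u t x) < 1 :=
      (h.continuous t ht.1).eventually_lt_const zero_lt_one
    have hev2 : ∀ᶠ s in 𝓝[Icc 0 T] t, s ∈ Icc 0 T ∧ sobolevNorm r (fun x => u s x - u t x) < 1 :=
      (eventually_mem_nhdsWithin).and (hev.filter_mono (nhdsWithin_mono t Icc_subset_Ici_self))
    refine ⟨_, hev2, 2 * 1 + 2 * sobolevNorm r (u t) ^ 2, fun s hs => ?_⟩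
    have h1 := (h.sumsLE_sub hs.1.1 ht.1).mono (B := 1) (fun _ => le_rfl)
      (pow_le_one₀ (Real.sqrt_nonneg _) hs.2.le)
    have h2 := (h.memSobolev t ht.1).sumsLE
    refine ((h1.const_mul zero_le_two).add (h2.const_mul zero_le_two)).mono (fun k => ?_) le_rfl
    have h3 : ‖fhat (u s) k‖ ^ 2 ≤ 2 * ‖fhat (u s) k - fhat (u t) k‖ ^ 2 + 2 * ‖fhat (u t) k‖ ^ 2 := by
      have : ‖fhat (u s) k‖ ≤ ‖fhat (u s) k - fhat (u t) k‖ + ‖fhat (u t) k‖ := by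
        simpa using norm_add_le (fhat (u s) k - fhat (u t) k) (fhat (u t) k)
      nlinarith [norm_nonneg (fhat (u s) k),
        sq_nonneg (‖fhat (u s) k - fhat (u t) k‖ - ‖fhat (u t) k‖)]
    have h4 : 0 ≤ (1 + (k : ℝ) ^ 2) ^ r := by positivity
    nlinarith [mul_le_mul_of_nonneg_left h3 h4]

end IsSolution

theorem iteratedDeriv_ofReal {f : ℝ → ℝ} {n : ℕ} (hf : ContDiff ℝ n f) :
    iteratedDeriv n (fun x => (f x : ℂ)) = fun x => ((iteratedDeriv n f x : ℝ) : ℂ) := by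
  induction n with
  | zero => simp
  | succ n ih =>
    have h1 := ContDiff.differentiable_iteratedDeriv' n (by exact_mod_cast hf)
    rw [iteratedDeriv_succ, ih (hf.of_le (by exact_mod_cast n.le_succ))]
    funext x
    rw [iteratedDeriv_succ]
    exact (h1 x).hasDerivAt.ofReal_comp.deriv

theorem spatialOp_ofReal {f : ℝ → ℝ} (hf : ContDiff ℝ 5 f) (x : ℝ) :
    -spatialOp (fun x => (f x : ℂ)) x =
      ((-(f x * deriv f x) - iteratedDeriv 3 f x + iteratedDeriv 5 f x : ℝ) : ℂ) := by
  have h1 := congrFun (iteratedDeriv_ofReal (n := 1) (hf.of_le (by norm_num))) x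
  rw [iteratedDeriv_one, iteratedDeriv_one] at h1
  rw [spatialOp, h1, iteratedDeriv_ofReal (n := 3) (hf.of_le (by norm_num)),
    iteratedDeriv_ofReal (n := 5) hf]
  push_cast; ring

/-- Differentiation under the integral sign: the weighted ℓ¹ bound controls u and its derivatives
uniformly in x and t, which provides a constant dominating function. -/
theorem IsSolution.kawaharaFlow {r : ℕ} {u₀ : ℝ → ℝ} {u : ℝ → ℝ → ℝ} (h : IsSolution r u₀ u)
    {T A : ℝ} (hA : ∀ t ∈ Icc 0 T, WBound 15 (fhat (u t)) A) :
    KawaharaFlow T fun t => fhat (u t) where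
  herm t _ := hermitian_fhat (u t)
  cont k := (h.continuousOn_fhat k).mono Icc_subset_Ici_self
  deriv t ht k := by
    have hcd : ∀ s, 0 ≤ s → ContDiff ℝ 5 fun x => (u s x : ℂ) := fun s hs =>
      Complex.ofRealCLM.contDiff.comp (h.contDiff s hs)
    have hper : ∀ s, 0 ≤ s → Function.Periodic (fun x => (u s x : ℂ)) (2 * Real.pi) := fun s hs x => by
      simp only [(h.memSobolev s hs).periodic x]
    have hnhds : Ioo 0 T ∈ 𝓝 t := Ioo_mem_nhds ht.1 ht.2
    have hderiv : ∀ x, ∀ s ∈ Ioo 0 T, HasDerivAt (fun s => ek (-k) x * (u s x : ℂ))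
        (ek (-k) x * -spatialOp (fun x => (u s x : ℂ)) x) s := fun x s hs => by
      rw [spatialOp_ofReal (h.contDiff s hs.1.le)]
      exact (((h.equation s hs.1.le x).hasDerivAt (Ici_mem_nhds hs.1)).ofReal_comp).const_mul _
    have hmain := intervalIntegral.hasDerivAt_integral_of_dominated_loc_of_deriv_le (μ := volume)
      (a := -Real.pi) (b := Real.pi) (F := fun s x => ek (-k) x * (u s x : ℂ))
      (F' := fun s x => ek (-k) x * -spatialOp (fun x => (u s x : ℂ)) x) (x₀ := t) (s := Ioo 0 T)
      (bound := fun _ => A * A + A + A) hnhds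
      (by
        filter_upwards [hnhds] with s hs
        exact ((continuous_ek _).mul (h.continuous_ofReal hs.1.le)).aestronglyMeasurable)
      (((continuous_ek _).mul (h.continuous_ofReal ht.1.le)).intervalIntegrable _ _)
      ((continuous_ek _).mul (continuous_spatialOp (hcd t ht.1.le)).neg).aestronglyMeasurable
      (Eventually.of_forall fun x _ s hs => by
        rw [norm_mul, norm_ek, one_mul, norm_neg]
        exact norm_spatialOp_le (hper s hs.1.le) (hcd s hs.1.le) (hA s (Ioo_subset_Icc_self hs)) x)
      (continuous_const.intervalIntegrable _ _)
      (Eventually.of_forall fun x _ s hs => hderiv x s hs)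
    have h2 := hmain.2.const_mul (((2 * Real.pi : ℝ) : ℂ)⁻¹)
    have e : (fun s => ((2 * Real.pi : ℝ) : ℂ)⁻¹ * ∫ x in (-Real.pi)..Real.pi, ek (-k) x * (u s x : ℂ)) =
        fun s => fhat (u s) k := funext fun s => by rw [fhat_eq_coef, coef_eq]
    rw [e] at h2
    refine h2.congr_deriv ?_
    have h3 := coef_spatialOp (hper t ht.1.le) (hcd t ht.1.le)
      (hA t (Ioo_subset_Icc_self ht)).sumsLE_norm k
    rw [coef_eq] at h3
    simp only [mul_neg, intervalIntegral.integral_neg]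
    rw [h3]
    change -(Complex.I * (k / 2) * tconv (fhat (u t)) (fhat (u t)) k -
      Complex.I * freq k * fhat (u t) k) = _
    ring

theorem IsSolution.fhat_zero {r : ℕ} {u₀ : ℝ → ℝ} {u : ℝ → ℝ → ℝ} (h : IsSolution r u₀ u) :
    fhat (u 0) = fhat u₀ := by
  refine fourierCoeffOn_congr_ae (neg_lt_self Real.pi_pos) ?_
  filter_upwards [ae_restrict_of_ae h.initial] with x hx
  rw [hx]

theorem l2_low_le (N : ℕ) (F : Finset ℤ) (d : ℤ → ℂ) : l2 F (low N d) ≤ l2 (box N) d := by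
  refine l2_le_of_sq (l2_nonneg _ _) ?_
  rw [l2_sq]
  refine SumsLE.of_box (a := fun k => ‖low N d k‖ ^ 2) (N := N) (fun _ => by positivity)
    (fun k hk => by rw [low_bandLimited N d k hk]; simp) (le_of_eq ?_) F
  exact Finset.sum_congr rfl fun k hk => by rw [low_of_mem _ hk]

/-! ### Assembly of the error bounds -/

/-- The error of the semi-discrete Fourier-Galerkin method. -/
theorem exists_semiDiscrete_error {r : ℕ} (hr : 16 ≤ r) {u₀ : ℝ → ℝ} (hu₀ : MemSobolev r u₀)
    {T S : ℝ} (hS : 1 ≤ S) : ∃ C, 0 ≤ C ∧ ∀ (N : ℕ) (U : ℝ → ℝ → ℂ) (u : ℝ → ℝ → ℝ), 1 ≤ N →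
      IsSemiDiscrete N u₀ U → (∀ t ∈ Icc 0 T, WBound 15 (low N (coef (U t))) S) →
      IsSolution r u₀ u → ∀ t ∈ Icc 0 T, ∀ F,
      l2 F (fun k => fhat (u t) k - coef (U t) k) ≤ C / (N : ℝ) ^ r := by
  -- The constant must not depend on u. It is taken from one solution v, with which every other
  -- solution has the same coefficients by uniqueness; if there is none the claim is vacuous.
  by_cases hex : ∃ u, IsSolution r u₀ u
  swap
  · exact ⟨0, le_rfl, fun N U u _ _ _ hu => (hex ⟨u, hu⟩).elim⟩
  obtain ⟨v, hv⟩ := hex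
  obtain ⟨R, hR⟩ := hv.exists_sumsLE T
  set A := √(embConst * (2 ^ 31 * (R + R))) with hA
  have hvA : ∀ t ∈ Icc 0 T, WBound 15 (fhat (v t)) A := fun t ht => (wBound_of_sumsLE hr (hR t ht)).2
  obtain ⟨C, hC⟩ := exists_galerkin_error (T := T) r (Real.sqrt_nonneg _ : 0 ≤ A) (Real.sqrt_nonneg R)
    (zero_le_one.trans hS)
  refine ⟨|C| + √R, by positivity, fun N U u hN hU hUS hu t ht F => ?_⟩
  have hN0 : (0 : ℝ) < N := by exact_mod_cast hN
  have hR0 : 0 ≤ R := (hR t ht).nonneg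
  have huv : fhat (u t) = fhat (v t) := by
    obtain ⟨R', hR'⟩ := hu.exists_sumsLE T
    have huA := fun t ht => (wBound_of_sumsLE hr (hR' t ht)).2
    set A' := √(embConst * (2 ^ 31 * (R' + R')))
    funext k
    exact (hu.kawaharaFlow huA).unique (hv.kawaharaFlow hvA) (A := max A A')
      (fun t ht => SumsLE.mono (huA t ht) (fun _ => le_rfl) (le_max_right _ _))
      (fun t ht => SumsLE.mono (hvA t ht) (fun _ => le_rfl) (le_max_left _ _))
      (fun k => by rw [hu.fhat_zero, hv.fhat_zero]) ht k
  have hsob : ∀ t ∈ Icc 0 T, SumsLE (fun n => (n : ℝ) ^ (2 * r) * ‖fhat (v t) n‖ ^ 2) (√R ^ 2) :=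
    fun t ht => by
      rw [Real.sq_sqrt hR0]; exact (wBound_of_sumsLE hr (hR t ht)).1
  have h1 := hC N hN _ _ (hv.kawaharaFlow hvA) (galerkinFlow_of_isSemiDiscrete hU) hvA hsob hUS
    (fun k hk => by
      rw [low_of_mem _ hk, coef_initial hu₀ hU.initial hk, hv.fhat_zero]) t ht
  have h2 := l2_high_le (M := N) (Real.sqrt_nonneg R) (hsob t ht) F
  -- Low frequencies carry the Galerkin error, high frequencies the truncation tail of the exact
  -- solution.
  have e : l2 F (fun k => fhat (u t) k - coef (U t) k) =
      l2 F (fun k => low N (fun k => fhat (v t) k - low N (coef (U t)) k) k + high N (fhat (v t)) k) := by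
    refine l2_congr fun k _ => ?_
    rw [huv, low_eq_self (coef_bandLimited (hU.mem t ht.1))]
    unfold low high
    split_ifs with hk
    · rw [add_zero]
    · rw [coef_bandLimited (hU.mem t ht.1) k hk]; simp
  rw [e]
  refine (l2_add_le _ _ _).trans ((add_le_add ((l2_low_le _ _ _).trans h1) h2).trans ?_)
  rw [add_div]
  refine add_le_add (div_le_div_of_nonneg_right (le_abs_self C) (by positivity)) ?_
  gcongr; linarith

end Kawahara

end

theorem mainTheorem2 (r : ℕ) (hr : 16 ≤ r) (u₀ : ℝ → ℝ) (hu₀ : Kawahara.MemSobolev r u₀)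
    (T : ℝ) (hT : 0 < T) (K : ℝ) :
    ∃ C₁ : ℝ, 0 < C₁ ∧ ∃ C : ℝ,
      ∀ (N : ℕ) (dt : ℝ) (M : ℕ), 1 ≤ N → 0 < dt → (M : ℝ) * dt = T → (N : ℝ) ^ 5 * dt ≤ C₁ →
      ∀ (U : ℝ → ℝ → ℂ) (W : ℕ → ℝ → ℂ),
        Kawahara.IsSemiDiscrete N u₀ U → Kawahara.IsLeapFrog N dt M W →
        W 0 = U 0 → Kawahara.l2norm (fun x => W 1 x - U dt x) ≤ K * dt ^ 2 →
        (∀ m : ℕ, m ≤ M → Kawahara.l2norm (fun x => W m x - U (m * dt) x) ≤ C * dt ^ 2) ∧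
        (∀ u : ℝ → ℝ → ℝ, Kawahara.IsSolution r u₀ u → ∀ m : ℕ, m ≤ M →
          Kawahara.l2norm (fun x => (u (m * dt) x : ℂ) - W m x) ≤
            C * (1 / (N : ℝ) ^ r + dt ^ 2)) := by
  open Kawahara in
  obtain ⟨S, hS, hgal⟩ := exists_galerkin_bound hr T (sobolevNorm r u₀ ^ 2)
  -- By Parseval's identity the L² norm is √(2π) times the ℓ² norm of the coefficients, which
  -- explains the rescaled K and the factor in the final constant.
  obtain ⟨C₁, hC₁, C₂, hleap⟩ := exists_leapfrog_bound hS hT (K / √(2 * Real.pi))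
  obtain ⟨C₃, hC₃, hsemi⟩ := exists_semiDiscrete_error hr hu₀ (T := T) hS
  have hpi : 0 < √(2 * Real.pi) := Real.sqrt_pos.2 Real.two_pi_pos
  refine ⟨C₁, hC₁, √(2 * Real.pi) * (C₃ + |C₂|), ?_⟩
  intro N dt M hN hdt hM hC U W hU hW h0 h1
  have hflow := galerkinFlow_of_isSemiDiscrete hU
  -- The initial coefficients are those of u₀ inside the box and 0 outside, so the H^r norm of u₀
  -- bounds them for every N.
  have hbd := hgal N _ hflow (hu₀.sumsLE.mono (fun k => by
    by_cases hk : k ∈ box N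
    · rw [low_of_mem _ hk, coef_initial hu₀ hU.initial hk]
    · rw [low_bandLimited N _ k hk]; simp; positivity) le_rfl)
  have htime : ∀ m : ℕ, m ≤ M → ((m : ℝ) * dt) ∈ Icc 0 T := fun m hm =>
    ⟨by positivity, by rw [← hM]; exact mul_le_mul_of_nonneg_right (Nat.cast_le.2 hm) hdt.le⟩
  have hM1 : 1 ≤ M := by
    rcases Nat.eq_zero_or_pos M with rfl | h
    · simp at hM; linarith
    · exact h
  have hUlow : ∀ t, 0 ≤ t → low N (coef (U t)) = coef (U t) := fun t ht =>
    low_eq_self (coef_bandLimited (hU.mem t ht))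
  have hcW : ∀ m ≤ M, Continuous (W m) := fun m hm => continuous_of_mem_trigSpace (hW.mem m hm)
  have hcU : ∀ t, 0 ≤ t → Continuous (U t) := fun t ht => continuous_of_mem_trigSpace (hU.mem t ht)
  have hsub : ∀ m ≤ M, ∀ t, 0 ≤ t → ∀ k,
      coef (fun x => W m x - U t x) k = coef (W m) k - coef (U t) k := fun m hm t ht k =>
    coef_sub ((hcW m hm).intervalIntegrable _ _) ((hcU t ht).intervalIntegrable _ _) k
  have hinit : l2 (box N) (fun k => coef (W 1) k - low N (coef (U dt)) k) ≤
      K / √(2 * Real.pi) * dt ^ 2 := by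
    have h2 := (l2_coef_le ((hcW 1 hM1).sub (hcU dt hdt.le)) (box N)).trans h1
    rw [div_mul_eq_mul_div, le_div_iff₀ hpi, mul_comm]
    refine le_trans (le_of_eq ?_) h2
    congr 1
    exact l2_congr fun k _ => by rw [hUlow dt hdt.le]; exact (hsub 1 hM1 dt hdt.le k).symm
  have herr := hleap N dt M hN hdt hM hC _ _ hflow
    (fun t ht => ⟨(hbd t ht).1.mono (by norm_num), (hbd t ht).2.1.mono (by norm_num), (hbd t ht).2.2.2⟩)
    (leapFrogFlow_of_isLeapFrog hW) (fun k => by rw [h0, hUlow 0 le_rfl]) hinit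
  have herrF : ∀ m ≤ M, ∀ F, l2 F (fun k => coef (W m) k - coef (U (m * dt)) k) ≤ |C₂| * dt ^ 2 := by
    intro m hm F
    have h2 := herr m hm
    rw [hUlow _ (htime m hm).1] at h2
    have h3 : BandLimited N (fun k => coef (W m) k - coef (U (m * dt)) k) := fun k hk => by
      simp only [coef_bandLimited (hW.mem m hm) k hk,
        coef_bandLimited (hU.mem _ (htime m hm).1) k hk, sub_zero]
    rw [← low_eq_self h3]
    refine (l2_low_le N F _).trans (h2.trans ?_)
    exact mul_le_mul_of_nonneg_right (le_abs_self C₂) (by positivity)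
  refine ⟨fun m hm => ?_, fun u hu m hm => ?_⟩
  · have h2 := l2norm_le ((hcW m hm).sub (hcU _ (htime m hm).1)) (B := |C₂| * dt ^ 2) fun F => by
      refine le_trans (le_of_eq (l2_congr fun k _ => ?_)) (herrF m hm F)
      exact hsub m hm _ (htime m hm).1 k
    refine h2.trans ?_
    rw [← mul_assoc]
    gcongr
    linarith
  · have hcu := hu.continuous_ofReal (htime m hm).1
    have h2 := l2norm_le (hcu.sub (hcW m hm)) (B := C₃ / (N : ℝ) ^ r + |C₂| * dt ^ 2) fun F => by
      have h3 := hsemi N U u hN hU (fun t ht => (hbd t ht).1) hu _ (htime m hm) F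
      refine le_trans (le_of_eq (l2_congr fun k _ => ?_)) ((l2_sub_le F _ _).trans
        (add_le_add h3 (herrF m hm F)))
      refine (coef_sub (hcu.intervalIntegrable _ _) ((hcW m hm).intervalIntegrable _ _) k).trans ?_
      rw [fhat_eq_coef]; ring
    refine h2.trans ?_
    rw [mul_assoc]
    refine mul_le_mul_of_nonneg_left ?_ hpi.le
    have h4 : 0 ≤ 1 / (N : ℝ) ^ r := by positivity
    have h5 : 0 ≤ dt ^ 2 := by positivity
    have h6 := mul_nonneg hC₃ h5
    have h7 := mul_nonneg (abs_nonneg C₂) h4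
    rw [div_eq_mul_one_div]
    linarith
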